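/- **Setting.** Let $\mathcal Z$ be a measurable space and let $P$ range over laws of $(Y,X,Z)\in\mathbb R\times\mathbb R^d\times\mathcal Z$. Let $\mathcal P_0$ be the set of laws $P$ for which the conditional mean $f_P(x,z)=\mathbb E_P(Y\mid X=x,Z=z)$ and the conditional Lebesgue density $p_P(x\mid z)$ of $X$ given $Z$ exist and, for almost every $z$, the functions $x\mapsto f_P(x,z)$ and $x\mapsto p_P(x\mid z)$ are differentiable on $\mathbb R^d$ and $p_P(\cdot\mid z)$ has full support. Let $\nabla$ denote the gradient in $x$, and put $$\rho_P(x,z)=\nabla\log p_P(x\mid z),\qquad \theta_P=\mathbb E_P[\nabla f_P(X,Z)],$$ $$\psi_P(y,x,z)=\nabla f_P(x,z)-\rho_P(x,z)\{y-f_P(x,z)\}-\theta_P,\qquad \Sigma_P=\mathbb E_P[\psi_P\psi_P^\top].$$ **Estimators.** Fix $K\ge 1$. For each multiple $n$ of $K$, let $I^{(n,1)},\dots,I^{(n,K)}$ be a partition of $\{1,\dots,n\}$ into sets of size $n/K$, and let $(y_i,x_i,z_i)$, $i\le n$, be i.i.d. from $P$. Let $D^{(n,k)}=\{(y_i,x_i,z_i):i\notin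 I^{(n,k)}\}$, listed by increasing index. For each $n$, a regression method and a score estimation method (measurable functions of the training data and of $(x,z)$, the same for all folds and not depending on $P$) are applied to $D^{(n,k)}$ to give $\hat f^{(n,k)}:\mathbb R^d\times\mathcal Z\to\mathbb R$ and $\hat\rho^{(n,k)}:\mathbb R^d\times\mathcal Z\to\mathbb R^d$; $\hat f^{(n,k)}(\cdot,z)$ is differentiable on $\mathbb{R}^d$, for almost every $z$ and almost every realisation of the training data. Write $$\hat\varphi^{(n,k)}(y,x,z)=\nabla\hat f^{(n,k)}(x,z)-\hat\rho^{(n,k)}(x,z)\{y-\hat f^{(n,k)}(x,z)\},$$ $$\hat\theta^{(n)}=\frac1n\sum_{k=1}^K\sum_{i\in I^{(n,k)}}\hat\varphi^{(n,k)}(y_i,x_i,z_i),$$ $$\hat\Sigma^{(n)}=\frac1n\sum_{k=1}^K\sum_{i\in I^{(n,k)}}\big[\hat\varphi^{(n,k)}(y_i,x_i,z_i)-\hat\theta^{(n)}\big]\big[\hat\varphi^{(n,k)}(y_i,x_i,z_i)-\hat\theta^{(n)}\big]^\top .$$ **Nuisance errors.** With $(Y,X,Z)\sim P$ independent of the data,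 let $$A_f^{(n)}=\mathbb E_P\big[\{f_P-\hat f^{(n,1)}\}^2(X,Z)\mid D^{(n,1)}\big],$$ $$A_\rho^{(n)}=\max_j\mathbb E_P\big[\{\rho_{P,j}-\hat\rho_j^{(n,1)}\}^2(X,Z)\mid D^{(n,1)}\big],$$ $$E_f^{(n)}=\max_j\mathbb E_P\big([\nabla_jf_P-\nabla_j\hat f^{(n,1)}+\rho_{P,j}\{f_P-\hat f^{(n,1)}\}]^2(X,Z)\mid D^{(n,1)}\big),$$ $$E_\rho^{(n)}=\max_j\mathbb E_P\big[\{\rho_{P,j}-\hat\rho_j^{(n,1)}\}^2(X,Z)\,\mathrm{Var}_P(Y\mid X,Z)\mid D^{(n,1)}\big].$$ **Uniform orders.** For a class $\mathcal P$ of laws, $W_{P,n}=o_{\mathcal P}(1)$ means $\sup_{P\in\mathcal P}\Pr_P(\|W_{P,n}\|>\epsilon)\to0$ for every $\epsilon>0$. Further, $W_{P,n}=O_{\mathcal P}(1)$ means that for every $\epsilon>0$ there are $M,N>0$ with $\sup_{n\ge N}\sup_{P\in\mathcal P}\Pr_P(\|W_{P,n}\|>M)<\epsilon$, and $W_{P,n}=o_{\mathcal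 P}(n^{-1})$ means $nW_{P,n}=o_{\mathcal P}(1)$. All limits are along multiples $n$ of $K$. **Theorem.** Let $\mathcal P\subset\mathcal P_0$ and suppose that there are $c_1,c_2,\eta>0$ such that, for every $P\in\mathcal P$, $\Sigma_P$ exists with all eigenvalues at least $c_1$, and $\mathbb E_P[\|\psi_P(Y,X,Z)\|_2^{2+\eta}]\le c_2$. Suppose also that $$A_f^{(n)}=O_{\mathcal P}(1),\quad A_f^{(n)}A_\rho^{(n)}=o_{\mathcal P}(n^{-1}),\quad E_f^{(n)}=o_{\mathcal P}(1),\quad E_\rho^{(n)}=o_{\mathcal P}(1).$$ Then, with $\Phi$ the standard $d$-dimensional normal c.d.f. and $\le$ between vectors taken elementwise, $$\lim_{n\to\infty}\sup_{P\in\mathcal P}\sup_{t\in\mathbb R^d}\Big|\Pr_P\big[\sqrt n\,\Sigma_P^{-1/2}(\hat\theta^{(n)}-\theta_P)\le t\big]-\Phi(t)\Big|=0 .$$ Moreover $\hat\Sigma^{(n)}=\Sigma_P+o_{\mathcal P}(1)$, and $$\lim_{n\to\infty}\sup_{P\in\mathcal P}\sup_{t\in\mathbb R^d}\Big|\Pr_P\big[\sqrt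 n\,(\hat\Sigma^{(n)})^{-1/2}(\hat\theta^{(n)}-\theta_P)\le t\big]-\Phi(t)\Big|=0 .$$ -/

import Mathlib

open MeasureTheory ProbabilityTheory Filter Topology
open scoped ENNReal NNReal

noncomputable section

namespace APE

/-- The space of `x`, with the Euclidean norm. -/
abbrev E (d : ℕ) : Type := EuclideanSpace ℝ (Fin d)

/-- An observation `w = (y, x, z)`. -/
abbrev Obs (d : ℕ) (𝒵 : Type*) : Type _ := ℝ × E d × 𝒵

variable {d : ℕ} {𝒵 : Type*} [MeasurableSpace 𝒵]

/-! ### The population quantities -/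

/-- The law of `(X, Z)` under `P`. -/
def lawXZ (P : ProbabilityMeasure (Obs d 𝒵)) : Measure (E d × 𝒵) :=
  (P : Measure (Obs d 𝒵)).map (fun w => w.2)

/-- The law of `Z` under `P`. -/
def lawZ (P : ProbabilityMeasure (Obs d 𝒵)) : Measure 𝒵 :=
  (P : Measure (Obs d 𝒵)).map (fun w => w.2.2)

/-- The (regular) conditional distribution of `Y` given `(X, Z)`. -/
def condLawY (P : ProbabilityMeasure (Obs d 𝒵)) : Kernel (E d × 𝒵) ℝ :=
  condDistrib (fun w : Obs d 𝒵 => w.1) (fun w => w.2) (P : Measure (Obs d 𝒵))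

/-- The (regular) conditional distribution of `X` given `Z`. -/
def condLawX (P : ProbabilityMeasure (Obs d 𝒵)) : Kernel 𝒵 (E d) :=
  condDistrib (fun w : Obs d 𝒵 => w.2.1) (fun w => w.2.2) (P : Measure (Obs d 𝒵))

/-- `f` is a version of the conditional mean `(x, z) ↦ E_P(Y | X = x, Z = z)` that is
differentiable in `x` on all of `ℝ^d`, for almost every `z`. -/
structure IsRegFun (P : ProbabilityMeasure (Obs d 𝒵)) (f : E d → 𝒵 → ℝ) : Prop where
  measurable : Measurable (fun q : E d × 𝒵 => f q.1 q.2)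
  integrable : ∀ᵐ q ∂(lawXZ P), Integrable (fun y : ℝ => y) (condLawY P q)
  eq_mean : ∀ᵐ q ∂(lawXZ P), f q.1 q.2 = ∫ y, y ∂(condLawY P q)
  differentiable : ∀ᵐ z ∂(lawZ P), Differentiable ℝ (fun x => f x z)

/-- `p` is a version of the conditional Lebesgue density `p(x | z)` of `X` given `Z` that, for almost
every `z`, is differentiable in `x` on all of `ℝ^d` and has full support (the closure of
`{x | p(x | z) > 0}` is `ℝ^d`). -/
structure IsCondDensity (P : ProbabilityMeasure (Obs d 𝒵)) (p : E d → 𝒵 → ℝ) : Prop where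
  measurable : Measurable (fun q : E d × 𝒵 => p q.1 q.2)
  nonneg : ∀ x z, 0 ≤ p x z
  density : ∀ᵐ z ∂(lawZ P), condLawX P z = volume.withDensity (fun x => ENNReal.ofReal (p x z))
  differentiable : ∀ᵐ z ∂(lawZ P), Differentiable ℝ (fun x => p x z)
  fullSupport : ∀ᵐ z ∂(lawZ P), Dense {x | 0 < p x z}

variable (d 𝒵) in
/-- The class `𝒫₀` of laws of `(Y, X, Z)` for which `f_P` and `p_P` exist as above. -/
def P₀ : Set (ProbabilityMeasure (Obs d 𝒵)) :=
  {P | (∃ f, IsRegFun P f) ∧ ∃ p, IsCondDensity P p}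

/-- The conditional mean function `f_P`. For almost every `z`, the function `f_P(·, z)` does not
depend on the version chosen, as two versions are continuous and agree on a dense set. -/
def regFun (P : ProbabilityMeasure (Obs d 𝒵)) : E d → 𝒵 → ℝ :=
  Classical.epsilon (IsRegFun P)

/-- The conditional density `p_P`; again `p_P(· | z)` is unique for almost every `z`. -/
def condDensity (P : ProbabilityMeasure (Obs d 𝒵)) : E d → 𝒵 → ℝ :=
  Classical.epsilon (IsCondDensity P)

/-- The gradient `∇ g(x, z)` with respect to `x`. -/
def gradX (g : E d → 𝒵 → ℝ) (x : E d) (z : 𝒵) : E d :=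
  gradient (fun x' => g x' z) x

/-- The score function `ρ_P(x, z) = ∇ log p_P(x | z)`. -/
def score (P : ProbabilityMeasure (Obs d 𝒵)) : E d → 𝒵 → E d :=
  gradX (fun x z => Real.log (condDensity P x z))

/-- `Var_P(Y | X = x, Z = z) ∈ [0, ∞]`: the variance of the conditional distribution. -/
def condVarY (P : ProbabilityMeasure (Obs d 𝒵)) (q : E d × 𝒵) : ℝ≥0∞ :=
  evariance (fun y : ℝ => y) (condLawY P q)

/-- The average partial effect `θ_P = E_P[∇ f_P(X, Z)]`. -/
def theta (P : ProbabilityMeasure (Obs d 𝒵)) : E d :=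
  ∫ w, gradX (regFun P) w.2.1 w.2.2 ∂(P : Measure (Obs d 𝒵))

/-- `∇ f(x, z) - ρ(x, z) {y - f(x, z)}`. -/
def drTerm (f : E d → 𝒵 → ℝ) (ρ : E d → 𝒵 → E d) (w : Obs d 𝒵) : E d :=
  gradX f w.2.1 w.2.2 - (w.1 - f w.2.1 w.2.2) • ρ w.2.1 w.2.2

/-- The efficient influence function `ψ_P`. -/
def psi (P : ProbabilityMeasure (Obs d 𝒵)) (w : Obs d 𝒵) : E d :=
  drTerm (regFun P) (score P) w - theta P

/-- `Σ_P = E_P[ψ_P ψ_Pᵀ]`. -/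
def Sigma (P : ProbabilityMeasure (Obs d 𝒵)) : Matrix (Fin d) (Fin d) ℝ :=
  Matrix.of fun i j => ∫ w, psi P w i * psi P w j ∂(P : Measure (Obs d 𝒵))

/-! ### Cross-fitting -/

/-- A partition of the indices `1, …, K m` into `K` labelled folds of size `m`:
`I^(k)` is the set of indices with label `k`. -/
structure Folds (K m : ℕ) where
  label : Fin (K * m) → Fin K
  card_fold : ∀ k, (Finset.univ.filter (fun i => label i = k)).card = m

namespace Folds

variable {K m : ℕ}

/-- The fold `I^(k)`. -/
def fold (I : Folds K m) (k : Fin K) : Finset (Fin (K * m)) :=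
  Finset.univ.filter (fun i => I.label i = k)

theorem card_compl (I : Folds K m) (k : Fin K) : (I.fold k)ᶜ.card = (K - 1) * m := by
  rw [Finset.card_compl, Fintype.card_fin, fold, I.card_fold k, Nat.sub_mul, one_mul]

/-- The data `D^(k)` outside the fold `I^(k)`, listed by increasing index. -/
def train {W : Type*} (I : Folds K m) (k : Fin K) (D : Fin (K * m) → W) :
    Fin ((K - 1) * m) → W :=
  fun i => D ((I.fold k)ᶜ.orderEmbOfFin (I.card_compl k) i)

end Folds

section Estimators

variable {K m : ℕ} (I : Folds K m)
  (fhat : (Fin ((K - 1) * m) → Obs d 𝒵) → E d → 𝒵 → ℝ)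
  (ρhat : (Fin ((K - 1) * m) → Obs d 𝒵) → E d → 𝒵 → E d)

/-- The cross-fitted doubly robust estimator `θ̂^(n)`, `n = K m`. -/
def thetaHat (D : Fin (K * m) → Obs d 𝒵) : E d :=
  (1 / ((K * m : ℕ) : ℝ)) •
    ∑ k, ∑ i ∈ I.fold k, drTerm (fhat (I.train k D)) (ρhat (I.train k D)) (D i)

/-- The summand of `Σ̂^(n)`'s outer products: the estimated influence function. -/
def psiHat (D : Fin (K * m) → Obs d 𝒵) (k : Fin K) (w : Obs d 𝒵) : E d :=
  drTerm (fhat (I.train k D)) (ρhat (I.train k D)) w - thetaHat I fhat ρhat D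

/-- The variance estimator `Σ̂^(n)`, `n = K m`. -/
def SigmaHat (D : Fin (K * m) → Obs d 𝒵) : Matrix (Fin d) (Fin d) ℝ :=
  Matrix.of fun a b => (1 / ((K * m : ℕ) : ℝ)) *
    ∑ k, ∑ i ∈ I.fold k, psiHat I fhat ρhat D k (D i) a * psiHat I fhat ρhat D k (D i) b

end Estimators

/-! ### The nuisance errors

The conditional expectations given the training data are integrals over a fresh observation
`w ∼ P`, the estimates being held fixed; they take values in `[0, ∞]`. -/

/-- `E_P[{f_P - f̂}²]`. -/
def errAf (P : ProbabilityMeasure (Obs d 𝒵)) (f : E d → 𝒵 → ℝ) : ℝ≥0∞ :=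
  ∫⁻ w, ‖regFun P w.2.1 w.2.2 - f w.2.1 w.2.2‖ₑ ^ 2 ∂(P : Measure (Obs d 𝒵))

/-- `max_j E_P[{ρ_{P,j} - ρ̂_j}²]`. -/
def errAρ (P : ProbabilityMeasure (Obs d 𝒵)) (ρ : E d → 𝒵 → E d) : ℝ≥0∞ :=
  ⨆ j, ∫⁻ w, ‖score P w.2.1 w.2.2 j - ρ w.2.1 w.2.2 j‖ₑ ^ 2 ∂(P : Measure (Obs d 𝒵))

/-- `max_j E_P([∇_j f_P - ∇_j f̂ + ρ_{P,j} {f_P - f̂}]²)`. -/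
def errEf (P : ProbabilityMeasure (Obs d 𝒵)) (f : E d → 𝒵 → ℝ) : ℝ≥0∞ :=
  ⨆ j, ∫⁻ w, ‖gradX (regFun P) w.2.1 w.2.2 j - gradX f w.2.1 w.2.2 j
    + score P w.2.1 w.2.2 j * (regFun P w.2.1 w.2.2 - f w.2.1 w.2.2)‖ₑ ^ 2
      ∂(P : Measure (Obs d 𝒵))

/-- `max_j E_P[{ρ_{P,j} - ρ̂_j}² Var_P(Y | X, Z)]`. -/
def errEρ (P : ProbabilityMeasure (Obs d 𝒵)) (ρ : E d → 𝒵 → E d) : ℝ≥0∞ :=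
  ⨆ j, ∫⁻ w, ‖score P w.2.1 w.2.2 j - ρ w.2.1 w.2.2 j‖ₑ ^ 2 * condVarY P w.2
    ∂(P : Measure (Obs d 𝒵))

/-! ### Uniform stochastic orders and convergence in distribution

Samples have size `n = K m`, and `n → ∞` through the multiples of `K`, that is, `m → ∞`. -/

/-- The law of `n` i.i.d. observations from `P`. -/
def sampleLaw (P : ProbabilityMeasure (Obs d 𝒵)) (n : ℕ) : Measure (Fin n → Obs d 𝒵) :=
  Measure.pi fun _ => (P : Measure (Obs d 𝒵))

/-- `W_{P,n} = o_𝒬(1)`, for `W` with values in `[0, ∞]`. -/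
def IsLittleOP {K : ℕ} (𝒬 : Set (ProbabilityMeasure (Obs d 𝒵)))
    (W : ProbabilityMeasure (Obs d 𝒵) → (m : ℕ) → (Fin (K * m) → Obs d 𝒵) → ℝ≥0∞) : Prop :=
  ∀ ε : ℝ≥0, 0 < ε →
    Tendsto (fun m => ⨆ P ∈ 𝒬, sampleLaw P (K * m) {D | ε < W P m D}) atTop (𝓝 0)

/-- `W_{P,n} = O_𝒬(1)`, for `W` with values in `[0, ∞]`. -/
def IsBigOP {K : ℕ} (𝒬 : Set (ProbabilityMeasure (Obs d 𝒵)))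
    (W : ProbabilityMeasure (Obs d 𝒵) → (m : ℕ) → (Fin (K * m) → Obs d 𝒵) → ℝ≥0∞) : Prop :=
  ∀ ε : ℝ≥0, 0 < ε → ∃ M : ℝ≥0, 0 < M ∧ ∃ N : ℕ,
    (⨆ m ≥ N, ⨆ P ∈ 𝒬, sampleLaw P (K * m) {D | M < W P m D}) < ε

/-- The standard `d`-dimensional normal c.d.f. -/
def Phi (t : Fin d → ℝ) : ℝ :=
  (stdGaussian (E d)).real {x | ∀ j, x j ≤ t j}

/-- `lim_n sup_{P ∈ 𝒬} sup_t |Pr_P(V_{P,n} ≤ t) - Φ(t)| = 0`, with `≤` taken elementwise. -/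
def UnifAsympGaussian {K : ℕ} (𝒬 : Set (ProbabilityMeasure (Obs d 𝒵)))
    (V : ProbabilityMeasure (Obs d 𝒵) → (m : ℕ) → (Fin (K * m) → Obs d 𝒵) → Fin d → ℝ) : Prop :=
  Tendsto (fun m => ⨆ P ∈ 𝒬, ⨆ t : Fin d → ℝ,
    ENNReal.ofReal |(sampleLaw P (K * m)).real {D | ∀ j, V P m D j ≤ t j} - Phi t|) atTop (𝓝 0)

/-- The symmetric inverse square root `A^{-1/2}` of a positive definite matrix `A`, obtained by
applying `s ↦ s^{-1/2}` to its eigenvalues. (For a singular positive semidefinite `A` the zero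
eigenvalues are kept at zero.) -/
def invSqrt (A : Matrix (Fin d) (Fin d) ℝ) : Matrix (Fin d) (Fin d) ℝ :=
  cfc (fun s : ℝ => (√s)⁻¹) A

/-- `√n A^{-1/2} v`. -/
def standardize (n : ℕ) (A : Matrix (Fin d) (Fin d) ℝ) (v : E d) : Fin d → ℝ :=
  √(n : ℝ) • (invSqrt A).mulVec v.ofLp

end APE

end

namespace APE

/-! ### A central limit theorem for triangular arrays -/

/-! The error of the estimated doubly robust term, for nuisance estimates held fixed, splits as
`centredError` + `productError` (`drError_eq`). The product (ρ_P − ρ̂)(f_P − f̂) has L¹ norm at most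
(A_f A_ρ)^{1/2} = o(n^{-1/2}) by Cauchy–Schwarz, so Markov's inequality makes its sum o(√n).

The centred part is (ρ_P − ρ̂)(Y − f_P) − [∇(f_P − f̂) + ρ_P (f_P − f̂)]. Its first term has mean
zero given (X, Z). Its second term, multiplied by the density p, is the x-gradient of (f_P − f̂) p,
which integrates to zero over ℝ^d (`integral_gradX_add_score_mul`). Its second moment is at most
2(E_f + E_ρ) = o(1), so Chebyshev's inequality makes its sum o(√n) as well. The bound A_f = O(1)
enters only through finiteness of A_f with high probability, which gives the integrability needed
for integration by parts.

Cross-fitting makes this legitimate for random estimates: a fold is independent of its training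
data, and all training sets have the same law, so assumptions on one fold serve for every fold
(`sampleLaw_fold_error_le`). Hence √n(θ̂ − θ_P) is n^{-1/2} ∑ ψ_P plus a negligible error. The
squared errors average to o(1), so Σ̂ behaves like the empirical covariance of ψ_P, which converges
by a law of large numbers under 1 + η/2 moments of the products ψ_a ψ_b.

Uniformity over the class is reduced to convergence along arbitrary sequences of laws P_m
(`tendsto_iSup_zero_of_forall_seq`). Along such a sequence Σ^{-1/2}ψ has mean zero, identity
covariance and bounded moments of some order above 2, so a triangular-array central limit theorem
holds by characteristic functions (`tendsto_map_sum_stdGaussian`). The Lévy–Prokhorov metric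
upgrades it to uniformity in t, because thickening an orthant costs little Gaussian mass.

Finally, A ↦ A^{-1/2} is uniformly continuous on compact sets of matrices bounded below
(`exists_forall_abs_invSqrt_sub_le`), and a quantitative Slutsky argument
(`tendsto_iSup_standardize`) treats standardization by Σ_P and by Σ̂ together. -/

theorem norm_pow_sub_pow_le {z w : ℂ} (hz : ‖z‖ ≤ 1) (hw : ‖w‖ ≤ 1) (n : ℕ) :
    ‖z ^ n - w ^ n‖ ≤ n * ‖z - w‖ := by
  induction n with
  | zero => simp
  | succ n ih =>
    have h : z ^ (n + 1) - w ^ (n + 1) = z ^ n * (z - w) + (z ^ n - w ^ n) * w := by ring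
    calc ‖z ^ (n + 1) - w ^ (n + 1)‖ ≤ ‖z ^ n‖ * ‖z - w‖ + ‖z ^ n - w ^ n‖ * ‖w‖ := by
          rw [h, ← norm_mul, ← norm_mul]; exact norm_add_le _ _
      _ ≤ 1 * ‖z - w‖ + (n * ‖z - w‖) * 1 := by
          gcongr
          rw [norm_pow]; exact pow_le_one₀ (norm_nonneg _) hz
      _ = (n + 1 : ℕ) * ‖z - w‖ := by push_cast; ring

/-- The Taylor remainder is of order |x|³ near 0 and of order x² away from 0, so any power between 2
and 3 dominates it. This lets 2 + η moments replace third moments. -/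
theorem norm_cexp_mul_I_sub_le {p : ℝ} (hp2 : 2 ≤ p) (hp3 : p ≤ 3) (x : ℝ) :
    ‖Complex.exp (x * Complex.I) - (1 + x * Complex.I - (x : ℂ) ^ 2 / 2)‖ ≤ 4 * |x| ^ p := by
  rcases le_or_gt |x| 1 with hx | hx
  · have h := Complex.exp_bound (x := x * Complex.I) (by simpa using hx) (n := 3) (by norm_num)
    have e : ∑ m ∈ Finset.range 3, (x * Complex.I : ℂ) ^ m / (m.factorial : ℂ)
        = 1 + x * Complex.I - (x : ℂ) ^ 2 / 2 := by
      simp [Finset.sum_range_succ, mul_pow, Nat.factorial]; ring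
    rw [e] at h
    refine h.trans ?_
    have h3 : |x| ^ (3 : ℕ) ≤ |x| ^ p := by
      rw [← Real.rpow_natCast]
      exact Real.rpow_le_rpow_of_exponent_ge' (abs_nonneg x) hx (by linarith) (by simpa using hp3)
    have h0 : 0 ≤ |x| ^ (3 : ℕ) := by positivity
    norm_num [Nat.factorial]
    linarith
  · have h2 : |x| ^ (2 : ℕ) ≤ |x| ^ p := by
      rw [← Real.rpow_natCast]
      exact Real.rpow_le_rpow_of_exponent_le hx.le (by simpa using hp2)
    have : ‖Complex.exp (x * Complex.I) - (1 + x * Complex.I - (x : ℂ) ^ 2 / 2)‖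
        ≤ 1 + (1 + |x| + |x| ^ 2 / 2) := by
      refine (norm_sub_le _ _).trans ?_
      rw [Complex.norm_exp_ofReal_mul_I]
      gcongr
      refine (norm_sub_le _ _).trans ?_
      gcongr
      · refine (norm_add_le _ _).trans ?_
        simp
      · simp
    nlinarith

variable {Ω : Type*} [MeasurableSpace Ω]

theorem norm_integral_cexp_sub_le {μ : Measure Ω} [IsProbabilityMeasure μ] {X : Ω → ℝ}
    (hX : AEMeasurable X μ) (h2 : MemLp X 2 μ) {p : ℝ} (hp2 : 2 ≤ p) (hp3 : p ≤ 3)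
    (hp : Integrable (fun ω => |X ω| ^ p) μ) (h0 : ∫ ω, X ω ∂μ = 0) (s : ℝ) :
    ‖∫ ω, Complex.exp ((s * X ω : ℝ) * Complex.I) ∂μ
      - (1 - (s ^ 2 * ∫ ω, X ω ^ 2 ∂μ : ℝ) / 2)‖ ≤ 4 * |s| ^ p * ∫ ω, |X ω| ^ p ∂μ := by
  have hi1 : Integrable (fun ω => Complex.exp ((s * X ω : ℝ) * Complex.I)) μ := by
    refine Integrable.of_bound (C := 1) ?_
      (Eventually.of_forall fun ω => (Complex.norm_exp_ofReal_mul_I _).le)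
    exact (Complex.measurable_exp.comp_aemeasurable
      ((Complex.measurable_ofReal.comp_aemeasurable
        (hX.const_mul s)).mul_const _)).aestronglyMeasurable
  have hi2 : Integrable (fun ω => (((s * X ω : ℝ)) : ℂ) * Complex.I) μ :=
    ((h2.integrable (by norm_num)).const_mul s).ofReal.mul_const _
  have hi3 : Integrable (fun ω => (((s * X ω : ℝ)) : ℂ) ^ 2 / 2) μ := by
    have := ((h2.integrable_sq.const_mul (s ^ 2)).ofReal (𝕜 := ℂ)).div_const 2
    refine this.congr (Eventually.of_forall fun ω => ?_)
    simp [mul_pow]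
  have e : ∫ ω, Complex.exp ((s * X ω : ℝ) * Complex.I) ∂μ - (1 - (s ^ 2 * ∫ ω, X ω ^ 2 ∂μ : ℝ) / 2)
      = ∫ ω, (Complex.exp ((s * X ω : ℝ) * Complex.I)
        - (1 + ((s * X ω : ℝ) : ℂ) * Complex.I - ((s * X ω : ℝ) : ℂ) ^ 2 / 2)) ∂μ := by
    have hi4 : Integrable (fun ω => 1 + (((s * X ω : ℝ)) : ℂ) * Complex.I) μ :=
      (integrable_const _).add hi2
    have hi5 : Integrable (fun ω => 1 + (((s * X ω : ℝ)) : ℂ) * Complex.I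
        - (((s * X ω : ℝ)) : ℂ) ^ 2 / 2) μ := hi4.sub hi3
    rw [integral_sub hi1 hi5, integral_sub hi4 hi3, integral_add (integrable_const _) hi2,
        integral_mul_const,
      integral_complex_ofReal, integral_const_mul, h0]
    have : ∫ ω, ((s * X ω : ℝ) : ℂ) ^ 2 / 2 ∂μ = ((s ^ 2 * ∫ ω, X ω ^ 2 ∂μ : ℝ) : ℂ) / 2 := by
      rw [integral_div, ← integral_const_mul, ← integral_complex_ofReal]
      simp [mul_pow]
    rw [this]; simp
  rw [e, mul_assoc, ← integral_const_mul, ← integral_const_mul]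
  refine norm_integral_le_of_norm_le ((hp.const_mul _).const_mul _)
      (Eventually.of_forall fun ω => ?_)
  refine (norm_cexp_mul_I_sub_le hp2 hp3 (s * X ω)).trans_eq ?_
  rw [abs_mul, Real.mul_rpow (abs_nonneg _) (abs_nonneg _)]

/-- Both the characteristic function at s/√N and exp(−v/(2N)) agree with 1 − v/(2N) up to
O(N^{-p/2}) + O(N^{-2}). Taking N-th powers inside the unit disc multiplies the discrepancy by at
most N, and p > 2 still makes it vanish. Only the moment bounds enter, so the law may change with m.
-/
theorem tendsto_integral_cexp_pow (ν : ℕ → Measure Ω) [∀ m, IsProbabilityMeasure (ν m)]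
    (X : ℕ → Ω → ℝ) (N : ℕ → ℕ) (hN : Tendsto N atTop atTop) {p : ℝ} (hp2 : 2 < p) (hp3 : p ≤ 3)
    (hX2 : ∀ m, MemLp (X m) 2 (ν m)) (hXp : ∀ m, Integrable (fun ω => |X m ω| ^ p) (ν m))
    {C : ℝ} (hC : ∀ m, ∫ ω, |X m ω| ^ p ∂(ν m) ≤ C) (h0 : ∀ m, ∫ ω, X m ω ∂(ν m) = 0)
    {v : ℝ} (hv : 0 ≤ v) (h1 : ∀ m, ∫ ω, X m ω ^ 2 ∂(ν m) = v) :
    Tendsto (fun m => (∫ ω, Complex.exp (((√(N m : ℝ))⁻¹ * X m ω : ℝ) * Complex.I) ∂(ν m)) ^ (N m))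
      atTop (𝓝 (Complex.exp (-(v : ℂ) / 2))) := by
  have hNr : Tendsto (fun m => (N m : ℝ)) atTop atTop := tendsto_natCast_atTop_atTop.comp hN
  rw [tendsto_iff_norm_sub_tendsto_zero]
  have hlim : Tendsto (fun m => 4 * C * (N m : ℝ) ^ (-(p / 2 - 1)) + (v / 2) ^ 2 * (N m : ℝ)⁻¹)
      atTop (𝓝 0) := by
    have a := ((tendsto_rpow_neg_atTop (show 0 < p / 2 - 1 by linarith)).comp hNr).const_mul (4 * C)
    have b := (tendsto_inv_atTop_zero.comp hNr).const_mul ((v / 2) ^ 2)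
    simpa using a.add b
  refine squeeze_zero' (Eventually.of_forall fun _ => norm_nonneg _) ?_ hlim
  filter_upwards [hNr.eventually_ge_atTop 1, hNr.eventually_ge_atTop (v / 2)] with m hm1 hmv
  set n : ℝ := (N m : ℝ) with hn
  have hn0 : 0 < n := by linarith
  set z := ∫ ω, Complex.exp (((√n)⁻¹ * X m ω : ℝ) * Complex.I) ∂(ν m) with hz
  -- Chosen so that its N-th power is exactly the limit exp(−v/2).
  set w := Complex.exp (-((v / 2 / n : ℝ) : ℂ)) with hw
  have hwN : w ^ (N m) = Complex.exp (-(v : ℂ) / 2) := by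
    rw [hw, ← Complex.exp_nat_mul]
    congr 1
    have : ((N m : ℕ) : ℂ) = (n : ℂ) := by simp [hn]
    rw [this]
    push_cast
    have : (n : ℂ) ≠ 0 := by exact_mod_cast hn0.ne'
    field_simp
  rw [← hwN]
  have hz1 : ‖z‖ ≤ 1 := by
    refine (norm_integral_le_of_norm_le_const (C := 1) (Eventually.of_forall fun ω => ?_)).trans ?_
    · rw [Complex.norm_exp_ofReal_mul_I]
    · simp
  have hw1 : ‖w‖ ≤ 1 := by
    rw [hw, Complex.norm_exp]
    simp only [Complex.neg_re, Complex.ofReal_re, Real.exp_le_one_iff, Left.neg_nonpos_iff]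
    positivity
  refine (norm_pow_sub_pow_le hz1 hw1 _).trans ?_
  have hzb := norm_integral_cexp_sub_le (hX2 m).aestronglyMeasurable.aemeasurable (hX2 m) hp2.le hp3
    (hXp m) (h0 m) (√n)⁻¹
  rw [h1 m, ← hz] at hzb
  have hsq : ((√n)⁻¹) ^ 2 = n⁻¹ := by rw [inv_pow, Real.sq_sqrt hn0.le]
  have hq : (((√n)⁻¹ ^ 2 * v : ℝ) : ℂ) / 2 = ((v / 2 / n : ℝ) : ℂ) := by
    rw [hsq]; push_cast; ring
  rw [hq] at hzb
  have habs : |(√n)⁻¹| ^ p = n ^ (-(p / 2)) := by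
    rw [abs_of_nonneg (by positivity), Real.sqrt_eq_rpow, ← Real.rpow_neg hn0.le,
      ← Real.rpow_mul hn0.le]
    congr 1; ring
  have hle1 : v / 2 / n ≤ 1 := by rw [div_le_one hn0]; exact hmv
  have hwb : ‖w - (1 - ((v / 2 / n : ℝ) : ℂ))‖ ≤ (v / 2 / n) ^ 2 := by
    have := Complex.norm_exp_sub_one_sub_id_le (x := -((v / 2 / n : ℝ) : ℂ)) (by
      rw [norm_neg, Complex.norm_real, Real.norm_of_nonneg (by positivity)]; exact hle1)
    rw [norm_neg, Complex.norm_real, Real.norm_of_nonneg (by positivity)] at this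
    refine le_trans (le_of_eq ?_) this
    congr 1; rw [hw]; ring
  have hzw : ‖z - w‖ ≤ 4 * n ^ (-(p / 2)) * C + (v / 2 / n) ^ 2 := by
    have : z - w = (z - (1 - ((v / 2 / n : ℝ) : ℂ))) - (w - (1 - ((v / 2 / n : ℝ) : ℂ))) := by ring
    rw [this]
    refine (norm_sub_le _ _).trans (add_le_add (hzb.trans ?_) hwb)
    rw [habs]
    gcongr
    exact hC m
  calc n * ‖z - w‖ ≤ n * (4 * n ^ (-(p / 2)) * C + (v / 2 / n) ^ 2) := by gcongr
    _ = 4 * C * n ^ (-(p / 2 - 1)) + (v / 2) ^ 2 * n⁻¹ := by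
      have : n ^ (-(p / 2 - 1)) = n * n ^ (-(p / 2)) := by
        rw [show -(p / 2 - 1) = 1 + -(p / 2) by ring, Real.rpow_add hn0, Real.rpow_one]
      rw [this]; field_simp

theorem aemeasurable_pi_sum {F : Type*} [AddCommMonoid F] [MeasurableSpace F] [MeasurableAdd₂ F]
    {ν : Measure Ω} [SigmaFinite ν] {ξ : Ω → F} (hξ : AEMeasurable ξ ν) (n : ℕ) :
    AEMeasurable (fun v : Fin n → Ω => ∑ i, ξ (v i)) (Measure.pi fun _ : Fin n => ν) :=
  Finset.aemeasurable_fun_sum _ fun i _ => hξ.comp_quasiMeasurePreserving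
    (Measure.quasiMeasurePreserving_eval (fun _ => ν) i)

/-- By independence the characteristic function of the normalized sum is the N-th power of a
one-dimensional one, and Lévy's continuity theorem applies. Mean zero and identity covariance are
expressed through the projections on each u, so the limit is the same for all laws of the array. -/
theorem tendsto_map_sum_stdGaussian {d : ℕ} (ν : ℕ → Measure Ω) [∀ m, IsProbabilityMeasure (ν m)]
    (ξ : ℕ → Ω → E d) (hξ : ∀ m, AEMeasurable (ξ m) (ν m)) (N : ℕ → ℕ) (hN : Tendsto N atTop atTop)
    {p : ℝ} (hp2 : 2 < p) (hp3 : p ≤ 3)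
    (hX2 : ∀ m, MemLp (ξ m) 2 (ν m)) (hXp : ∀ m, Integrable (fun ω => ‖ξ m ω‖ ^ p) (ν m))
    {C : ℝ} (hC : ∀ m, ∫ ω, ‖ξ m ω‖ ^ p ∂(ν m) ≤ C)
    (h0 : ∀ m u, ∫ ω, inner ℝ (ξ m ω) u ∂(ν m) = 0)
    (h1 : ∀ m u, ∫ ω, (inner ℝ (ξ m ω) u) ^ 2 ∂(ν m) = ‖u‖ ^ 2)
    {M : ℕ → ProbabilityMeasure (E d)} {G : ProbabilityMeasure (E d)}
    (hM : ∀ m, (M m : Measure (E d)) = (Measure.pi fun _ : Fin (N m) => ν m).map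
      fun v => (√(N m : ℝ))⁻¹ • ∑ i, ξ m (v i))
    (hG : (G : Measure (E d)) = stdGaussian (E d)) :
    Tendsto M atTop (𝓝 G) := by
  rw [ProbabilityMeasure.tendsto_iff_tendsto_charFun]
  intro u
  have key : ∀ m, charFun ((Measure.pi fun _ : Fin (N m) => ν m).map
      fun v => (√(N m : ℝ))⁻¹ • ∑ i, ξ m (v i)) u
      = (∫ ω, Complex.exp (((√(N m : ℝ))⁻¹ * inner ℝ (ξ m ω) u : ℝ) * Complex.I) ∂(ν m))
          ^ (N m) := by
    intro m
    have hm : AEMeasurable (fun v : Fin (N m) → Ω => (√(N m : ℝ))⁻¹ • ∑ i, ξ m (v i))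
        (Measure.pi fun _ : Fin (N m) => ν m) :=
      (measurable_const_smul ((√(N m : ℝ))⁻¹)).comp_aemeasurable (aemeasurable_pi_sum (hξ m) (N m))
    rw [charFun_apply, integral_map hm (by fun_prop)]
    simp_rw [real_inner_smul_left, sum_inner, Finset.mul_sum, Complex.ofReal_sum, Finset.sum_mul,
      Complex.exp_sum]
    rw [integral_fintype_prod_eq_prod (f := fun _ (ω : Ω) =>
      Complex.exp (((√(N m : ℝ))⁻¹ * inner ℝ (ξ m ω) u : ℝ) * Complex.I))]
    simp
  have hint : ∀ m, Integrable (fun ω => |inner ℝ (ξ m ω) u| ^ p) (ν m) ∧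
      ∫ ω, |inner ℝ (ξ m ω) u| ^ p ∂(ν m) ≤ C * ‖u‖ ^ p := by
    intro m
    have hb : ∀ ω, |inner ℝ (ξ m ω) u| ^ p ≤ ‖ξ m ω‖ ^ p * ‖u‖ ^ p := fun ω => by
      rw [← Real.mul_rpow (norm_nonneg _) (norm_nonneg _)]
      exact Real.rpow_le_rpow (abs_nonneg _) (abs_real_inner_le_norm _ _) (by linarith)
    have hi : Integrable (fun ω => |inner ℝ (ξ m ω) u| ^ p) (ν m) := by
      refine ((hXp m).mul_const (‖u‖ ^ p)).mono' ?_ (Eventually.of_forall fun ω => ?_)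
      · have : AEMeasurable (fun ω => |inner ℝ (ξ m ω) u|) (ν m) := by
          have := (hξ m).inner (𝕜 := ℝ) (aemeasurable_const (b := u))
          exact measurable_norm.comp_aemeasurable this
        exact (this.pow_const p).aestronglyMeasurable
      · rw [Real.norm_of_nonneg (by positivity)]; exact hb ω
    refine ⟨hi, (integral_mono hi ((hXp m).mul_const _) hb).trans ?_⟩
    rw [integral_mul_const]
    gcongr
    exact hC m
  have := tendsto_integral_cexp_pow ν (fun m ω => inner ℝ (ξ m ω) u) N hN hp2 hp3
    (fun m => (hX2 m).inner_const (𝕜 := ℝ) u) (fun m => (hint m).1) (fun m => (hint m).2)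
    (fun m => h0 m u) (sq_nonneg ‖u‖) (fun m => h1 m u)
  rw [hG, charFun_stdGaussian]
  refine Tendsto.congr (fun m => by rw [hM m, key m]) ?_
  convert this using 2
  push_cast; rfl

end APE

namespace APE

/-! ### Uniform convergence of distribution functions -/

theorem gaussianReal_Ioc_le (a ε : ℝ) :
    gaussianReal 0 1 (Set.Ioc a (a + ε)) ≤ ENNReal.ofReal ε := by
  rw [gaussianReal_apply _ one_ne_zero]
  calc ∫⁻ x in Set.Ioc a (a + ε), gaussianPDF 0 1 x
      ≤ ∫⁻ _ in Set.Ioc a (a + ε), 1 := by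
        refine lintegral_mono fun x => ?_
        rw [gaussianPDF, ENNReal.ofReal_le_one, gaussianPDFReal]
        refine mul_le_one₀ ?_ (Real.exp_nonneg _) ?_
        · apply inv_le_one_of_one_le₀
          rw [Real.one_le_sqrt]
          have := Real.pi_gt_three
          norm_num
          linarith
        · rw [Real.exp_le_one_iff]
          apply div_nonpos_of_nonpos_of_nonneg
          · simp [sq_nonneg]
          · simp
    _ = ENNReal.ofReal ε := by simp

theorem measurableSet_orthant {d : ℕ} (t : Fin d → ℝ) :
    MeasurableSet {x : E d | ∀ j, x j ≤ t j} := by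
  have : {x : E d | ∀ j, x j ≤ t j} = ⋂ j, {x : E d | x j ≤ t j} := by ext; simp
  rw [this]
  exact MeasurableSet.iInter fun j => measurableSet_le (by fun_prop) measurable_const

/-- The enlarged orthant exceeds the original one by at most d slabs of width ε, and the
one-dimensional Gaussian density is below 1. -/
theorem Phi_add_le {d : ℕ} (t : Fin d → ℝ) {ε : ℝ} (hε : 0 ≤ ε) :
    Phi (fun j => t j + ε) ≤ Phi t + d * ε := by
  have hj : ∀ j : Fin d, (stdGaussian (E d)).real {x | x j ∈ Set.Ioc (t j) (t j + ε)} ≤ ε := by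
    intro j
    apply ENNReal.toReal_le_of_le_ofReal hε
    have hm : MeasurableSet {x : E d | x j ∈ Set.Ioc (t j) (t j + ε)} :=
      measurableSet_preimage (f := fun x : E d => x j) (by fun_prop) measurableSet_Ioc
    rw [← map_pi_eq_stdGaussian, Measure.map_apply (WithLp.measurable_toLp 2 _) hm]
    have := (measurePreserving_eval (fun _ : Fin d => gaussianReal 0 1) j).measure_preimage
      (measurableSet_Ioc (a := t j) (b := t j + ε)).nullMeasurableSet
    refine (le_of_eq ?_).trans (gaussianReal_Ioc_le (t j) ε)
    rw [← this]; rfl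
  have hsub : {x : E d | ∀ j, x j ≤ t j + ε} ⊆
      {x | ∀ j, x j ≤ t j} ∪ ⋃ j, {x | x j ∈ Set.Ioc (t j) (t j + ε)} := by
    intro x hx
    by_cases h : ∀ j, x j ≤ t j
    · exact Or.inl h
    · push Not at h
      obtain ⟨j, hj⟩ := h
      exact Or.inr (Set.mem_iUnion.2 ⟨j, hj, hx j⟩)
  calc Phi (fun j => t j + ε) ≤ _ := measureReal_mono hsub
    _ ≤ _ := measureReal_union_le _ _
    _ ≤ Phi t + ∑ j, (stdGaussian (E d)).real {x | x j ∈ Set.Ioc (t j) (t j + ε)} := by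
        gcongr
        · exact le_rfl
        · exact measureReal_iUnion_fintype_le _
    _ ≤ Phi t + ∑ _j : Fin d, ε := by gcongr with j; exact hj j
    _ = Phi t + d * ε := by simp

theorem thickening_orthant_subset {d : ℕ} (t : Fin d → ℝ) (ε : ℝ) :
    Metric.thickening ε {x : E d | ∀ j, x j ≤ t j} ⊆ {x | ∀ j, x j ≤ t j + ε} := by
  intro x hx j
  obtain ⟨z, hz, hxz⟩ := Metric.mem_thickening_iff.1 hx
  have h1 : ‖(x - z) j‖ ≤ ‖x - z‖ := PiLp.norm_apply_le (x - z) j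
  rw [← dist_eq_norm] at h1
  have h2 := hz j
  have h3 := (le_abs_self ((x - z) j)).trans h1
  simp only [PiLp.sub_apply] at h3
  linarith

/-- Weak convergence is convergence in the Lévy–Prokhorov metric, which compares a set with its
thickening. A thickened orthant lies in a shifted orthant, and the Gaussian cost of the shift does
not depend on t, so the estimate is uniform in t. -/
theorem eventually_abs_orthant_sub_Phi_le {d : ℕ} {M : ℕ → ProbabilityMeasure (E d)}
    {G : ProbabilityMeasure (E d)} (hG : (G : Measure (E d)) = stdGaussian (E d))
    (h : Tendsto M atTop (𝓝 G)) {r : ℝ} (hr : 0 < r) :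
    ∀ᶠ m in atTop, ∀ t : Fin d → ℝ,
      |(M m : Measure (E d)).real {x | ∀ j, x j ≤ t j} - Phi t| ≤ r := by
  -- The error is d ε for the slabs plus ε for the Lévy–Prokhorov slack, which add up to r.
  set ε : ℝ := r / (d + 1) with hε
  have hd : (0 : ℝ) < d + 1 := by positivity
  have hε0 : 0 < ε := by positivity
  have hrε : d * ε + ε = r := by rw [hε]; field_simp
  have hLP := (LevyProkhorov.probabilityMeasureHomeomorph (Ω := E d)).continuous.tendsto G |>.comp h
  have hev := (tendsto_iff_edist_tendsto_0.1 hLP).eventually_lt_const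
    (show (0 : ℝ≥0∞) < ENNReal.ofReal ε by simpa using hε0)
  filter_upwards [hev] with m hm t
  change levyProkhorovEDist (M m : Measure (E d)) (G : Measure (E d)) < _ at hm
  have hl := left_measure_le_of_levyProkhorovEDist_lt hm (measurableSet_orthant t)
  have hr' := right_measure_le_of_levyProkhorovEDist_lt hm (measurableSet_orthant fun j => t j - ε)
  rw [ENNReal.toReal_ofReal hε0.le, hG] at hl hr'
  have e1 : (M m : Measure (E d)).real {x | ∀ j, x j ≤ t j} ≤ Phi (fun j => t j + ε) + ε := by
    rw [Phi]
    have := ENNReal.toReal_mono (by finiteness)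
      (hl.trans (add_le_add_left (measure_mono (thickening_orthant_subset t ε)) _))
    rwa [ENNReal.toReal_add (by finiteness) (by finiteness), ENNReal.toReal_ofReal hε0.le] at this
  have e2 : Phi (fun j => t j - ε) ≤ (M m : Measure (E d)).real {x | ∀ j, x j ≤ t j} + ε := by
    have hsub := thickening_orthant_subset (fun j => t j - ε) ε
    simp only [sub_add_cancel] at hsub
    have := ENNReal.toReal_mono (by finiteness)
      (hr'.trans (add_le_add_left (measure_mono hsub) _))
    rwa [ENNReal.toReal_add (by finiteness) (by finiteness), ENNReal.toReal_ofReal hε0.le] at this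
  have e3 := Phi_add_le t hε0.le
  have e4 := Phi_add_le (fun j => t j - ε) hε0.le
  simp only [sub_add_cancel] at e4
  rw [abs_le]
  constructor <;> linarith

/-- A quantitative Slutsky lemma: off an exceptional set the orthant event for V lies between
shifted orthant events for V₀. Only monotonicity and subadditivity of the measure are used, so V
need not be measurable. -/
theorem abs_orthant_sub_Phi_le_of_close {d : ℕ} {Ω : Type*} [MeasurableSpace Ω] {μ : Measure Ω}
    [IsProbabilityMeasure μ] {V V₀ : Ω → Fin d → ℝ} {r δ ε : ℝ} (hε : 0 ≤ ε)
    (h₀ : ∀ t : Fin d → ℝ, |μ.real {ω | ∀ j, V₀ ω j ≤ t j} - Phi t| ≤ r)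
    (h : μ.real {ω | ∃ j, ε < |V ω j - V₀ ω j|} ≤ δ) (t : Fin d → ℝ) :
    |μ.real {ω | ∀ j, V ω j ≤ t j} - Phi t| ≤ r + δ + d * ε := by
  set B := {ω | ∃ j, ε < |V ω j - V₀ ω j|} with hB
  have e1 : μ.real {ω | ∀ j, V ω j ≤ t j} ≤ μ.real {ω | ∀ j, V₀ ω j ≤ t j + ε} + μ.real B := by
    refine (measureReal_mono ?_).trans (measureReal_union_le _ _)
    intro ω hω
    by_cases hb : ω ∈ B
    · exact Or.inr hb
    · refine Or.inl fun j => ?_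
      simp only [hB, Set.mem_ofPred_eq, not_exists, not_lt] at hb
      have := abs_le.1 (hb j)
      have := hω j
      linarith
  have e2 : μ.real {ω | ∀ j, V₀ ω j ≤ t j - ε} ≤ μ.real {ω | ∀ j, V ω j ≤ t j} + μ.real B := by
    refine (measureReal_mono ?_).trans (measureReal_union_le _ _)
    intro ω hω
    by_cases hb : ω ∈ B
    · exact Or.inr hb
    · refine Or.inl fun j => ?_
      simp only [hB, Set.mem_ofPred_eq, not_exists, not_lt] at hb
      have := abs_le.1 (hb j)
      have := hω j
      linarith
  have e3 := Phi_add_le t hε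
  have e4 := Phi_add_le (fun j => t j - ε) hε
  simp only [sub_add_cancel] at e4
  have e5 := abs_le.1 (h₀ fun j => t j + ε)
  have e6 := abs_le.1 (h₀ fun j => t j - ε)
  rw [abs_le]
  constructor <;> linarith

/-! ### Uniform limits along sequences of laws -/

/-- If the supremum stayed above ε for infinitely many m, one could pick at each such m a law
exceeding ε, and convergence along the resulting sequence would fail. This turns every uniform
statement into one about a triangular array. -/
theorem tendsto_iSup_zero_of_forall_seq {α : Type*} {𝒬 : Set α} {G : α → ℕ → ℝ≥0∞}
    (h : ∀ P : ℕ → α, (∀ m, P m ∈ 𝒬) → Tendsto (fun m => G (P m) m) atTop (𝓝 0)) :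
    Tendsto (fun m => ⨆ P ∈ 𝒬, G P m) atTop (𝓝 0) := by
  rcases 𝒬.eq_empty_or_nonempty with rfl | ⟨P₁, hP₁⟩
  · simp
  rw [ENNReal.tendsto_nhds_zero]
  intro ε hε
  classical
  -- A law that violates the bound ε whenever some law of the class does; the supremum need not be
  -- attained.
  have hch : ∀ m, ∃ P ∈ 𝒬, (∃ P' ∈ 𝒬, ε < G P' m) → ε < G P m := by
    intro m
    by_cases hm : ∃ P' ∈ 𝒬, ε < G P' m
    · obtain ⟨P', h1, h2⟩ := hm
      exact ⟨P', h1, fun _ => h2⟩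
    · exact ⟨P₁, hP₁, fun h => absurd h hm⟩
  choose P hP hPG using hch
  filter_upwards [ENNReal.tendsto_nhds_zero.1 (h P hP) ε hε] with m hm
  refine iSup₂_le fun P' hP' => ?_
  by_contra hlt
  exact (hPG m ⟨P', hP', not_le.1 hlt⟩).not_ge hm

theorem tendsto_of_tendsto_iSup_zero {α : Type*} {𝒬 : Set α} {G : α → ℕ → ℝ≥0∞}
    (h : Tendsto (fun m => ⨆ P ∈ 𝒬, G P m) atTop (𝓝 0)) {P : ℕ → α} (hP : ∀ m, P m ∈ 𝒬) :
    Tendsto (fun m => G (P m) m) atTop (𝓝 0) :=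
  tendsto_of_tendsto_of_tendsto_of_le_of_le tendsto_const_nhds h (fun _ => zero_le)
    fun m => le_iSup₂ (f := fun P _ => G P m) (P m) (hP m)

/-! ### Laws of large numbers -/

variable {Ω : Type*} [MeasurableSpace Ω]

theorem measure_pi_abs_sum_gt_le {ν : Measure Ω} [IsProbabilityMeasure ν] {X : Ω → ℝ}
    (hX : MemLp X 2 ν) (h0 : ∫ ω, X ω ∂ν = 0) (n : ℕ) {t : ℝ} (ht : 0 < t) :
    (Measure.pi fun _ : Fin n => ν) {v | t < |∑ i, X (v i)|}
      ≤ ENNReal.ofReal (n * (∫ ω, X ω ^ 2 ∂ν) / t ^ 2) := by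
  have hi : ∀ i : Fin n, MemLp (fun v : Fin n → Ω => X (v i)) 2 (Measure.pi fun _ : Fin n => ν) :=
    fun i => hX.comp_measurePreserving (measurePreserving_eval _ i)
  have hS : MemLp (fun v : Fin n → Ω => ∑ i, X (v i)) 2 (Measure.pi fun _ : Fin n => ν) :=
    memLp_finsetSum _ fun i _ => hi i
  have hmean : ∫ v, ∑ i, X (v i) ∂(Measure.pi fun _ : Fin n => ν) = 0 := by
    rw [integral_finsetSum _ fun i _ => (hi i).integrable (by norm_num)]
    refine Finset.sum_eq_zero fun i _ => ?_
    rw [integral_comp_eval (μ := fun _ : Fin n => ν) hX.aestronglyMeasurable, h0]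
  have hvar : Var[fun v : Fin n → Ω => ∑ i, X (v i); Measure.pi fun _ : Fin n => ν]
      = n * ∫ ω, X ω ^ 2 ∂ν := by
    have := variance_sum_pi (μ := fun _ : Fin n => ν) (X := fun _ => X) fun _ => hX
    have e : (fun v : Fin n → Ω => ∑ i, X (v i)) = ∑ i, fun v : Fin n → Ω => X (v i) := by
      ext v; simp
    rw [e, this, variance_of_integral_eq_zero hX.aestronglyMeasurable.aemeasurable h0]
    simp
  have := meas_ge_le_variance_div_sq hS ht
  rw [hmean, hvar] at this
  refine (measure_mono fun v hv => ?_).trans this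
  simp only [Set.mem_ofPred_eq, sub_zero] at hv ⊢
  exact hv.le

theorem measure_pi_sum_gt_le {ν : Measure Ω} [IsProbabilityMeasure ν] {X : Ω → ℝ≥0∞}
    (hX : AEMeasurable X ν) (n : ℕ) {t : ℝ≥0∞} (ht : t ≠ 0) (ht' : t ≠ ∞) :
    (Measure.pi fun _ : Fin n => ν) {v | t < ∑ i, X (v i)} ≤ n * (∫⁻ ω, X ω ∂ν) / t := by
  have h := meas_ge_le_lintegral_div (aemeasurable_pi_sum hX n) ht ht'
  have hi : ∀ i : Fin n, AEMeasurable (fun v : Fin n → Ω => X (v i))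
      (Measure.pi fun _ : Fin n => ν) := fun i =>
    hX.comp_quasiMeasurePreserving (Measure.quasiMeasurePreserving_eval (fun _ => ν) i)
  have he : ∫⁻ v, ∑ i, X (v i) ∂(Measure.pi fun _ : Fin n => ν) = n * ∫⁻ ω, X ω ∂ν := by
    rw [lintegral_finsetSum' _ fun i _ => hi i]
    have : ∀ i : Fin n, ∫⁻ v, X (v i) ∂(Measure.pi fun _ : Fin n => ν) = ∫⁻ ω, X ω ∂ν := by
      intro i
      have hmp := measurePreserving_eval (fun _ : Fin n => ν) i
      conv_rhs => rw [← hmp.map_eq]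
      rw [lintegral_map' (by rw [hmp.map_eq]; exact hX) hmp.measurable.aemeasurable]
    simp [this]
  rw [he] at h
  exact (measure_mono fun v hv => (le_of_lt hv : t ≤ _)).trans h

/-- Truncation at level M. The centred truncated part is bounded by 2M and is handled by Chebyshev's
inequality. The tail has mean at most C M^{1−q} in absolute value and is handled by Markov's
inequality. The tolerance ε is shared as ε/4 for the truncated average, ε/2 for the tail average and
ε/4 for the tail mean. -/
theorem measure_pi_average_le {ν : Measure Ω} [IsProbabilityMeasure ν]
    {X : Ω → ℝ} (hX : AEMeasurable X ν) {n : ℕ} (hn : 0 < n) {q C : ℝ} (hq : 1 < q)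
    (hC : ∫⁻ ω, ‖X ω‖ₑ ^ q ∂ν ≤ ENNReal.ofReal C) {M ε : ℝ} (hM : 0 < M) (hε : 0 < ε)
    (hMε : C * M ^ (1 - q) ≤ ε / 4) :
    (Measure.pi fun _ : Fin n => ν) {v | ε < |(n : ℝ)⁻¹ * ∑ i, X (v i) - ∫ ω, X ω ∂ν|}
      ≤ ENNReal.ofReal (64 * M ^ 2 / (n * ε ^ 2)) + ENNReal.ofReal (2 * (C * M ^ (1 - q)) / ε) := by
  have hn' : (0 : ℝ) < n := by exact_mod_cast hn
  set X₁ : Ω → ℝ := fun ω => if |X ω| ≤ M then X ω else 0 with hX₁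
  set X₂ : Ω → ℝ := fun ω => X ω - X₁ ω with hX₂
  have hT : Measurable fun x : ℝ => if |x| ≤ M then x else 0 :=
    Measurable.ite (measurableSet_le (by fun_prop) measurable_const) measurable_id measurable_const
  have hm₁ : AEMeasurable X₁ ν := hT.comp_aemeasurable hX
  have hm₂ : AEMeasurable X₂ ν := hX.sub hm₁
  have hb₁ : ∀ ω, ‖X₁ ω‖ ≤ M := by
    intro ω
    simp only [hX₁]
    split_ifs with h
    · exact h
    · simpa using hM.le
  have hb₂ : ∀ ω, ‖X₂ ω‖ₑ ≤ ‖X ω‖ₑ ^ q * ENNReal.ofReal (M ^ (1 - q)) := by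
    intro ω
    simp only [hX₂, hX₁]
    split_ifs with h
    · simp
    · push Not at h
      have hpos : 0 < |X ω| := hM.trans h
      rw [sub_zero, ← ofReal_norm, ENNReal.ofReal_rpow_of_pos (by simpa using hpos),
        ← ENNReal.ofReal_mul (by positivity), Real.norm_eq_abs]
      refine ENNReal.ofReal_le_ofReal ?_
      calc |X ω| = |X ω| ^ q * |X ω| ^ (1 - q) := by
            rw [← Real.rpow_add hpos]; simp
        _ ≤ |X ω| ^ q * M ^ (1 - q) := by
            gcongr ?_ * ?_
            exact Real.rpow_le_rpow_of_nonpos hM h.le (by linarith)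
  have hC0 : ENNReal.ofReal C * ENNReal.ofReal (M ^ (1 - q)) =
      ENNReal.ofReal (C * M ^ (1 - q)) := by
    rw [ENNReal.ofReal_mul' (by positivity)]
  have hl₂ : ∫⁻ ω, ‖X₂ ω‖ₑ ∂ν ≤ ENNReal.ofReal (C * M ^ (1 - q)) := by
    rw [← hC0]
    refine (lintegral_mono hb₂).trans ?_
    rw [lintegral_mul_const' _ _ ENNReal.ofReal_ne_top]
    gcongr
  have hi₁ : MemLp X₁ 2 ν := MemLp.of_bound hm₁.aestronglyMeasurable M (Eventually.of_forall hb₁)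
  have hi₂ : Integrable X₂ ν := ⟨hm₂.aestronglyMeasurable, hl₂.trans_lt ENNReal.ofReal_lt_top⟩
  have hEX : ∫ ω, X ω ∂ν = ∫ ω, X₁ ω ∂ν + ∫ ω, X₂ ω ∂ν := by
    rw [← integral_add (hi₁.integrable (by norm_num)) hi₂]
    simp [hX₂]
  have hE₂ : |∫ ω, X₂ ω ∂ν| ≤ ε / 4 := by
    have h1 := (enorm_integral_le_lintegral_enorm (μ := ν) X₂).trans hl₂
    rw [← ofReal_norm] at h1
    have h2 : ENNReal.ofReal (C * M ^ (1 - q)) ≤ ENNReal.ofReal (ε / 4) :=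
      ENNReal.ofReal_le_ofReal hMε
    exact (ENNReal.ofReal_le_ofReal_iff (by positivity)).1 (h1.trans h2)
  set Y : Ω → ℝ := fun ω => X₁ ω - ∫ ω, X₁ ω ∂ν with hY
  have hY2 : MemLp Y 2 ν := hi₁.sub (memLp_const _)
  have hY0 : ∫ ω, Y ω ∂ν = 0 := by
    rw [hY, integral_sub (hi₁.integrable (by norm_num)) (integrable_const _)]
    simp
  have hE₁ : ‖∫ ω, X₁ ω ∂ν‖ ≤ M := by
    simpa using norm_integral_le_of_norm_le_const (μ := ν) (Eventually.of_forall hb₁)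
  have hYb : ∀ ω, |Y ω| ≤ 2 * M := fun ω => by
    have := norm_sub_le (X₁ ω) (∫ ω, X₁ ω ∂ν)
    have := hb₁ ω
    rw [← Real.norm_eq_abs]
    linarith
  have hYsq : ∫ ω, Y ω ^ 2 ∂ν ≤ 4 * M ^ 2 := by
    refine (le_abs_self _).trans ?_
    have := norm_integral_le_of_norm_le_const (μ := ν) (f := fun ω => Y ω ^ 2) (C := 4 * M ^ 2)
      (Eventually.of_forall fun ω => by
        rw [norm_pow, Real.norm_eq_abs]
        calc |Y ω| ^ 2 ≤ (2 * M) ^ 2 := by gcongr; exact hYb ω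
          _ = 4 * M ^ 2 := by ring)
    simpa using this
  have hsub : {v : Fin n → Ω | ε < |(n : ℝ)⁻¹ * ∑ i, X (v i) - ∫ ω, X ω ∂ν|} ⊆
      {v | n * (ε / 4) < |∑ i, Y (v i)|} ∪
        {v | ENNReal.ofReal (n * (ε / 2)) < ∑ i, ‖X₂ (v i)‖ₑ} := by
    intro v hv
    by_contra hcon
    simp only [Set.mem_union, Set.mem_ofPred_eq, not_or, not_lt] at hcon hv
    obtain ⟨c1, c2⟩ := hcon
    have c3 : |∑ i, X₂ (v i)| ≤ n * (ε / 2) := by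
      have h1 : ‖∑ i, X₂ (v i)‖ₑ ≤ ENNReal.ofReal (n * (ε / 2)) := (enorm_sum_le _ _).trans c2
      rw [← ofReal_norm] at h1
      exact (ENNReal.ofReal_le_ofReal_iff (by positivity)).1 h1
    have e : (n : ℝ)⁻¹ * ∑ i, X (v i) - ∫ ω, X ω ∂ν
        = (n : ℝ)⁻¹ * ∑ i, Y (v i) + (n : ℝ)⁻¹ * ∑ i, X₂ (v i) - ∫ ω, X₂ ω ∂ν := by
      have : ∀ i, X (v i) = Y (v i) + X₂ (v i) + ∫ ω, X₁ ω ∂ν := fun i => by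
        simp only [hY, hX₂]; ring
      simp only [this, Finset.sum_add_distrib, Finset.sum_const, Finset.card_univ,
        Fintype.card_fin, nsmul_eq_mul]
      rw [hEX]
      field_simp
      ring
    have c4 : |(n : ℝ)⁻¹ * ∑ i, Y (v i)| ≤ ε / 4 := by
      rw [abs_mul, abs_of_pos (inv_pos.2 hn'), inv_mul_le_iff₀ hn']; exact c1
    have c5 : |(n : ℝ)⁻¹ * ∑ i, X₂ (v i)| ≤ ε / 2 := by
      rw [abs_mul, abs_of_pos (inv_pos.2 hn'), inv_mul_le_iff₀ hn']; exact c3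
    rw [e] at hv
    rw [abs_le] at c4 c5 hE₂
    rcases lt_abs.1 hv with h | h <;> linarith [c4.1, c4.2, c5.1, c5.2, hE₂.1, hE₂.2]
  refine (measure_mono hsub).trans ((measure_union_le _ _).trans (add_le_add ?_ ?_))
  · refine (measure_pi_abs_sum_gt_le hY2 hY0 n (t := n * (ε / 4)) (by positivity)).trans ?_
    refine ENNReal.ofReal_le_ofReal ?_
    calc n * (∫ ω, Y ω ^ 2 ∂ν) / (n * (ε / 4)) ^ 2 ≤ n * (4 * M ^ 2) / (n * (ε / 4)) ^ 2 := by
          gcongr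
      _ = 64 * M ^ 2 / (n * ε ^ 2) := by field_simp; norm_num
  · refine (measure_pi_sum_gt_le hm₂.enorm n (t := ENNReal.ofReal (n * (ε / 2)))
      (ENNReal.ofReal_pos.2 (by positivity)).ne' ENNReal.ofReal_ne_top).trans ?_
    calc n * (∫⁻ ω, ‖X₂ ω‖ₑ ∂ν) / ENNReal.ofReal (n * (ε / 2))
        ≤ ENNReal.ofReal n * ENNReal.ofReal (C * M ^ (1 - q)) / ENNReal.ofReal (n * (ε / 2)) := by
          rw [ENNReal.ofReal_natCast]
          gcongr
      _ = ENNReal.ofReal (2 * (C * M ^ (1 - q)) / ε) := by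
          rw [← ENNReal.ofReal_mul (by positivity), ← ENNReal.ofReal_div_of_pos (by positivity)]
          congr 1
          field_simp

theorem tendsto_measure_pi_average {ν : ℕ → Measure Ω} [∀ m, IsProbabilityMeasure (ν m)]
    {X : ℕ → Ω → ℝ} (hX : ∀ m, AEMeasurable (X m) (ν m)) {N : ℕ → ℕ} (hN : Tendsto N atTop atTop)
    {q C : ℝ} (hq : 1 < q) (hC : ∀ m, ∫⁻ ω, ‖X m ω‖ₑ ^ q ∂(ν m) ≤ ENNReal.ofReal C)
    {ε : ℝ} (hε : 0 < ε) :
    Tendsto (fun m => (Measure.pi fun _ : Fin (N m) => ν m)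
      {v | ε < |(N m : ℝ)⁻¹ * ∑ i, X m (v i) - ∫ ω, X m ω ∂(ν m)|}) atTop (𝓝 0) := by
  have hNr : Tendsto (fun m => (N m : ℝ)) atTop atTop := tendsto_natCast_atTop_atTop.comp hN
  -- The truncation level is M = N^{1/4}: it tends to infinity, so the tail vanishes, while M²/N =
  -- N^{-1/2} still tends to zero.
  have ht : Tendsto (fun m => C * ((N m : ℝ) ^ (1 / 4 : ℝ)) ^ (1 - q)) atTop (𝓝 0) := by
    have h1 := (tendsto_rpow_atTop (show (0 : ℝ) < 1 / 4 by norm_num)).comp hNr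
    have h2 := ((tendsto_rpow_neg_atTop (show 0 < q - 1 by linarith)).comp h1).const_mul C
    simpa using h2
  have ht2 : Tendsto (fun m => 64 * ((N m : ℝ) ^ (1 / 4 : ℝ)) ^ 2 / ((N m : ℝ) * ε ^ 2)) atTop
      (𝓝 0) := by
    have h1 := ((tendsto_rpow_neg_atTop (show (0 : ℝ) < 1 / 2 by norm_num)).comp hNr).const_mul
      (64 / ε ^ 2)
    rw [mul_zero] at h1
    refine h1.congr' ?_
    filter_upwards [hNr.eventually_gt_atTop 0] with m hm
    have e1 : ((N m : ℝ) ^ (1 / 4 : ℝ)) ^ 2 = (N m : ℝ) ^ (1 / 2 : ℝ) := by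
      rw [← Real.rpow_natCast, ← Real.rpow_mul hm.le]; norm_num
    have e2 : (N m : ℝ) = (N m : ℝ) ^ (1 / 2 : ℝ) * (N m : ℝ) ^ (1 / 2 : ℝ) := by
      rw [← Real.rpow_add hm]; norm_num
    simp only [Function.comp_apply]
    rw [Real.rpow_neg hm.le, e1]
    have : (0 : ℝ) < (N m : ℝ) ^ (1 / 2 : ℝ) := by positivity
    rw [show (64 * (N m : ℝ) ^ (1 / 2 : ℝ)) / ((N m : ℝ) * ε ^ 2)
      = (64 * (N m : ℝ) ^ (1 / 2 : ℝ)) / ((N m : ℝ) ^ (1 / 2 : ℝ) * (N m : ℝ) ^ (1 / 2 : ℝ) * ε ^ 2)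
      by rw [← e2]]
    field_simp
  have hlim : Tendsto (fun m => ENNReal.ofReal (64 * ((N m : ℝ) ^ (1 / 4 : ℝ)) ^ 2 / (N m * ε ^ 2))
      + ENNReal.ofReal (2 * (C * ((N m : ℝ) ^ (1 / 4 : ℝ)) ^ (1 - q)) / ε)) atTop (𝓝 0) := by
    have h2 := (ht.const_mul 2).div_const ε
    simpa using (ENNReal.tendsto_ofReal ht2).add (ENNReal.tendsto_ofReal h2)
  refine tendsto_of_tendsto_of_tendsto_of_le_of_le' tendsto_const_nhds hlim
    (Eventually.of_forall fun _ => zero_le) ?_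
  filter_upwards [hN.eventually_gt_atTop 0, ht.eventually_le_const (show 0 < ε / 4 by positivity)]
    with m hm hmε
  have : (0 : ℝ) < N m := by exact_mod_cast hm
  exact measure_pi_average_le (hX m) hm hq (hC m) (by positivity) hε hmε

/-! ### Conditioning on an independent component -/

/-- Conditioning on the first component: integrate the section probabilities, bounding them by 1 on
B and by δ elsewhere. A is only null-measurable and B is arbitrary, so both are replaced by
measurable sets, almost equal to A and of the same measure as B. -/
theorem prod_measure_le_of_ae {α β : Type*} [MeasurableSpace α] [MeasurableSpace β]
    {μ : Measure α} [IsProbabilityMeasure μ] {ν : Measure β} [IsProbabilityMeasure ν]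
    {A : Set (α × β)} (hA : NullMeasurableSet A (μ.prod ν)) {B : Set α} {δ : ℝ≥0∞}
    (h : ∀ᵐ a ∂μ, a ∉ B → ν {b | (a, b) ∈ A} ≤ δ) : (μ.prod ν) A ≤ μ B + δ := by
  obtain ⟨A', hA', hAA'⟩ := hA
  rw [measure_congr hAA', Measure.prod_apply hA']
  have hsec := Measure.ae_ae_of_ae_prod hAA'
  calc ∫⁻ a, ν (Prod.mk a ⁻¹' A') ∂μ
      ≤ ∫⁻ a, (toMeasurable μ B).indicator 1 a + δ ∂μ := by
        refine lintegral_mono_ae ?_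
        filter_upwards [h, hsec] with a ha hs
        by_cases haB : a ∈ toMeasurable μ B
        · rw [Set.indicator_of_mem haB]
          exact prob_le_one.trans le_self_add
        · refine le_trans (le_of_eq ?_) ((ha fun hb => haB (subset_toMeasurable μ B hb)).trans
            le_add_self)
          refine measure_congr ?_
          filter_upwards [hs] with b hb
          exact hb.symm
    _ = μ B + δ := by
        rw [lintegral_add_right _ measurable_const, lintegral_indicator_one
          (measurableSet_toMeasurable μ B), measure_toMeasurable]
        simp

end APE

namespace APE

/-! ### The inverse square root of a matrix -/

section InvSqrt

variable {d : ℕ} {A : Matrix (Fin d) (Fin d) ℝ} {c : ℝ}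

theorem isSelfAdjoint_invSqrt (A : Matrix (Fin d) (Fin d) ℝ) : IsSelfAdjoint (invSqrt A) :=
  cfc_predicate _ A

theorem invSqrt_mul_mul_invSqrt (hA : A.IsHermitian) (hc : 0 < c)
    (hs : ∀ s ∈ spectrum ℝ A, c ≤ s) : invSqrt A * A * invSqrt A = 1 := by
  have hA' : IsSelfAdjoint A := hA
  have hf : ContinuousOn (fun s : ℝ => (√s)⁻¹) (spectrum ℝ A) :=
    Real.continuous_sqrt.continuousOn.inv₀ fun s h => (Real.sqrt_pos.2 (hc.trans_le (hs s h))).ne'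
  have h1 : invSqrt A * A = cfc (fun s : ℝ => (√s)⁻¹ * s) A := by
    rw [cfc_mul (fun s : ℝ => (√s)⁻¹) (fun s => s) A hf continuousOn_id, cfc_id' ℝ A]
    rfl
  rw [h1, invSqrt, ← cfc_mul (fun s : ℝ => (√s)⁻¹ * s) _ A (hf.mul continuousOn_id) hf]
  rw [← cfc_one ℝ A]
  refine cfc_congr fun s h => ?_
  have hpos := hc.trans_le (hs s h)
  have h2 := Real.mul_self_sqrt hpos.le
  have h3 := Real.sqrt_pos.2 hpos
  simp only [Pi.one_apply]
  field_simp
  linarith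

theorem le_dotProduct_mulVec_of_spectrum (hA : A.IsHermitian) (hs : ∀ s ∈ spectrum ℝ A, c ≤ s)
    (v : Fin d → ℝ) : c * (v ⬝ᵥ v) ≤ v ⬝ᵥ A.mulVec v := by
  have h : (A - algebraMap ℝ _ c).PosSemidef := by
    rw [Matrix.posSemidef_iff_isHermitian_and_spectrum_nonneg]
    refine ⟨hA.sub ?_, fun s hmem => ?_⟩
    · rw [Matrix.algebraMap_eq_diagonal]; exact Matrix.isHermitian_diagonal _
    · rw [← spectrum.sub_singleton_eq] at hmem
      obtain ⟨a, ha, b, hb, rfl⟩ := hmem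
      rw [Set.mem_singleton_iff] at hb
      have := hs a ha
      simp only [Set.mem_ofPred_eq]
      linarith
  have := h.dotProduct_mulVec_nonneg v
  rw [Matrix.sub_mulVec, dotProduct_sub, Algebra.algebraMap_eq_smul_one, Matrix.smul_mulVec,
    Matrix.one_mulVec, dotProduct_smul] at this
  simp only [star_trivial, smul_eq_mul] at this
  linarith

theorem le_of_mem_spectrum (hA : A.IsHermitian)
    (h : ∀ v : Fin d → ℝ, c * (v ⬝ᵥ v) ≤ v ⬝ᵥ A.mulVec v) {s : ℝ} (hs : s ∈ spectrum ℝ A) :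
    c ≤ s := by
  have hp : (A - algebraMap ℝ _ c).PosSemidef := by
    refine Matrix.PosSemidef.of_dotProduct_mulVec_nonneg (hA.sub ?_) fun v => ?_
    · rw [Matrix.algebraMap_eq_diagonal]; exact Matrix.isHermitian_diagonal _
    · rw [Matrix.sub_mulVec, dotProduct_sub, Algebra.algebraMap_eq_smul_one, Matrix.smul_mulVec,
        Matrix.one_mulVec, dotProduct_smul]
      simp only [star_trivial, smul_eq_mul]
      linarith [h v]
  rw [Matrix.posSemidef_iff_isHermitian_and_spectrum_nonneg] at hp
  have := hp.2 (show s - c ∈ spectrum ℝ (A - algebraMap ℝ _ c) by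
    rw [← spectrum.sub_singleton_eq]
    exact Set.sub_mem_sub hs rfl)
  simp only [Set.mem_ofPred_eq] at this
  linarith

theorem dotProduct_invSqrt_mulVec (hA : A.IsHermitian) (hc : 0 < c)
    (hs : ∀ s ∈ spectrum ℝ A, c ≤ s) (v : Fin d → ℝ) :
    ((invSqrt A).mulVec v) ⬝ᵥ A.mulVec ((invSqrt A).mulVec v) = v ⬝ᵥ v := by
  have hT : (invSqrt A).transpose = invSqrt A := by
    have := isSelfAdjoint_invSqrt A
    rwa [IsSelfAdjoint, Matrix.star_eq_conjTranspose, Matrix.conjTranspose_eq_transpose_of_trivial]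
      at this
  calc ((invSqrt A).mulVec v) ⬝ᵥ A.mulVec ((invSqrt A).mulVec v)
      = v ⬝ᵥ (invSqrt A * A * invSqrt A).mulVec v := by
        rw [← Matrix.mulVec_mulVec, ← Matrix.mulVec_mulVec, Matrix.dotProduct_mulVec v (invSqrt A),
          ← Matrix.mulVec_transpose, hT]
    _ = v ⬝ᵥ v := by rw [invSqrt_mul_mul_invSqrt hA hc hs, Matrix.one_mulVec]

theorem dotProduct_invSqrt_mulVec_self_le (hA : A.IsHermitian) (hc : 0 < c)
    (hs : ∀ s ∈ spectrum ℝ A, c ≤ s) (v : Fin d → ℝ) :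
    c * (((invSqrt A).mulVec v) ⬝ᵥ ((invSqrt A).mulVec v)) ≤ v ⬝ᵥ v := by
  rw [← dotProduct_invSqrt_mulVec hA hc hs v]
  exact le_dotProduct_mulVec_of_spectrum hA hs _

/-- The symmetric matrices `A ≥ c` whose entries are bounded by `C`. -/
def boundedPosDef (d : ℕ) (c C : ℝ) : Set (Matrix (Fin d) (Fin d) ℝ) :=
  {A | A.IsHermitian ∧ (∀ v : Fin d → ℝ, c * (v ⬝ᵥ v) ≤ v ⬝ᵥ A.mulVec v) ∧ ∀ i j, |A i j| ≤ C}

/-- Closed and bounded in finite dimension. The lower bound is stated through the quadratic form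
because that is visibly a closed condition on the entries. -/
theorem isCompact_boundedPosDef (d : ℕ) (c C : ℝ) : IsCompact (boundedPosDef d c C) := by
  have hb : IsCompact {A : Matrix (Fin d) (Fin d) ℝ |
      ∀ i, A i ∈ {r : Fin d → ℝ | ∀ j, r j ∈ Set.Icc (-C) C}} :=
    isCompact_pi_infinite fun _ => isCompact_pi_infinite fun _ => isCompact_Icc
  refine hb.of_isClosed_subset ?_ ?_
  · have h1 : IsClosed {A : Matrix (Fin d) (Fin d) ℝ | A.IsHermitian} :=
      isClosed_eq (continuous_id.matrix_conjTranspose) continuous_id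
    have h2 : IsClosed {A : Matrix (Fin d) (Fin d) ℝ |
        ∀ v : Fin d → ℝ, c * (v ⬝ᵥ v) ≤ v ⬝ᵥ A.mulVec v} := by
      simp only [Set.ofPred_forall]
      refine isClosed_iInter fun v => isClosed_le continuous_const ?_
      exact Continuous.dotProduct continuous_const (continuous_id.matrix_mulVec continuous_const)
    have h3 : IsClosed {A : Matrix (Fin d) (Fin d) ℝ | ∀ i j, |A i j| ≤ C} := by
      simp only [Set.ofPred_forall]
      refine isClosed_iInter fun i => isClosed_iInter fun j => isClosed_le ?_ continuous_const
      exact (continuous_id.matrix_elem i j).abs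
    exact h1.inter (h2.inter h3)
  · intro A hA i j
    exact abs_le.1 (hA.2.2 i j)

-- The operator norm is bounded on this compact set, so all spectra lie in one interval [c, R] on
-- which s ↦ s^{-1/2} is continuous; the functional calculus is then continuous in the matrix.
open scoped Matrix.Norms.L2Operator in
theorem continuousOn_invSqrt (hc : 0 < c) (C : ℝ) :
    ContinuousOn (invSqrt (d := d)) (boundedPosDef d c C) := by
  obtain ⟨R, hR⟩ := (isCompact_boundedPosDef d c C).exists_bound_of_continuousOn
    (f := fun A : Matrix (Fin d) (Fin d) ℝ => ‖A‖) continuous_norm.continuousOn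
  have hf : ContinuousOn (fun s : ℝ => (√s)⁻¹) (Set.Icc c R) :=
    Real.continuous_sqrt.continuousOn.inv₀ fun s h => (Real.sqrt_pos.2 (hc.trans_le h.1)).ne'
  refine (continuousOn_cfc (p := IsSelfAdjoint) (Matrix (Fin d) (Fin d) ℝ) isCompact_Icc _ hf).mono
    fun A hA => ⟨hA.1, fun s hs => ⟨le_of_mem_spectrum hA.1 hA.2.1 hs, ?_⟩⟩
  -- For d = 0 the spectrum is empty; otherwise the spectrum is bounded by the norm.
  rcases isEmpty_or_nonempty (Fin d) with h | h
  · have : Subsingleton (Matrix (Fin d) (Fin d) ℝ) := inferInstance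
    exact absurd hs (by simp)
  have h1 := spectrum.norm_le_norm_of_mem hs
  have h2 := hR A hA
  rw [norm_norm] at h2
  exact (le_abs_self s).trans (h1.trans h2)

theorem abs_dotProduct_mulVec_le {D : Matrix (Fin d) (Fin d) ℝ} {δ : ℝ} (hδ : 0 ≤ δ)
    (hD : ∀ i j, |D i j| ≤ δ) (v : Fin d → ℝ) : |v ⬝ᵥ D.mulVec v| ≤ δ * d * (v ⬝ᵥ v) := by
  calc |v ⬝ᵥ D.mulVec v| ≤ ∑ i, ∑ j, |v i| * (δ * |v j|) := by
        simp only [dotProduct, Matrix.mulVec]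
        refine (Finset.abs_sum_le_sum_abs _ _).trans (Finset.sum_le_sum fun i _ => ?_)
        rw [abs_mul, ← Finset.mul_sum]
        gcongr
        refine (Finset.abs_sum_le_sum_abs _ _).trans (Finset.sum_le_sum fun j _ => ?_)
        rw [abs_mul]
        gcongr
        exact hD i j
    _ = δ * (∑ i, |v i|) ^ 2 := by
        rw [sq, Finset.sum_mul_sum, Finset.mul_sum]
        refine Finset.sum_congr rfl fun i _ => ?_
        rw [Finset.mul_sum]
        exact Finset.sum_congr rfl fun j _ => by ring
    _ ≤ δ * (d * ∑ i, |v i| ^ 2) := by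
        gcongr
        simpa using sq_sum_le_card_mul_sum_sq (s := Finset.univ) (f := fun i => |v i|)
    _ = δ * d * (v ⬝ᵥ v) := by
        simp only [sq_abs, dotProduct, ← sq]
        ring

/-- A small perturbation of a matrix bounded below by c is still bounded below by c/2, so both
matrices lie in a single compact set, on which Heine–Cantor gives a modulus of continuity
independent of A. -/
theorem exists_forall_abs_invSqrt_sub_le (hc : 0 < c) (C : ℝ) {ε : ℝ} (hε : 0 < ε) :
    ∃ δ > 0, ∀ A B : Matrix (Fin d) (Fin d) ℝ, A.IsHermitian → B.IsHermitian →
      (∀ s ∈ spectrum ℝ A, c ≤ s) → (∀ i j, |A i j| ≤ C) → (∀ i j, |B i j - A i j| ≤ δ) →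
      ∀ i j, |invSqrt B i j - invSqrt A i j| ≤ ε := by
  -- Matrices are viewed as families of entries here, so that distances are maxima of entrywise
  -- distances.
  have hcont : ContinuousOn (X := Fin d → Fin d → ℝ) (Y := Fin d → Fin d → ℝ) (invSqrt (d := d))
    (boundedPosDef d (c / 2) (C + 1)) := continuousOn_invSqrt (half_pos hc) (C + 1)
  have hu := IsCompact.uniformContinuousOn_of_continuous (α := Fin d → Fin d → ℝ)
    (β := Fin d → Fin d → ℝ) (isCompact_boundedPosDef d (c / 2) (C + 1)) hcont
  obtain ⟨δ₀, hδ₀, hu⟩ := (Metric.uniformContinuousOn_iff (α := Fin d → Fin d → ℝ)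
    (β := Fin d → Fin d → ℝ)).1 hu ε hε
  -- The three bounds keep B within the modulus of continuity, its entries below C + 1, and its
  -- quadratic form above c/2, since a perturbation with entries at most δ changes the form by at
  -- most δ d |v|².
  set δ : ℝ := min (min (δ₀ / 2) 1) (c / 2 / (d + 1)) with hδdef
  have hδ : 0 < δ := by positivity
  have hδ1 : δ ≤ δ₀ / 2 := (min_le_left _ _).trans (min_le_left _ _)
  have hδ2 : δ ≤ 1 := (min_le_left _ _).trans (min_le_right _ _)
  have hδ3 : δ * d ≤ c / 2 := by
    have h1 : δ ≤ c / 2 / (d + 1) := min_le_right _ _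
    rw [le_div_iff₀ (by positivity)] at h1
    nlinarith
  refine ⟨δ, hδ, fun A B hA hB hs hAC hBA i j => ?_⟩
  have hform := le_dotProduct_mulVec_of_spectrum hA hs
  have hAT : A ∈ boundedPosDef d (c / 2) (C + 1) := by
    refine ⟨hA, fun v => (?_ : _ ≤ _).trans (hform v), fun i j => (hAC i j).trans (by linarith)⟩
    have := dotProduct_self_star_nonneg v
    rw [star_trivial] at this
    nlinarith
  have hBT : B ∈ boundedPosDef d (c / 2) (C + 1) := by
    refine ⟨hB, fun v => ?_, fun i j => ?_⟩
    · have h1 := abs_le.1 (abs_dotProduct_mulVec_le (D := B - A) hδ.le (fun i j => hBA i j) v)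
      have h2 := hform v
      have h3 := dotProduct_self_star_nonneg v
      rw [star_trivial] at h3
      rw [Matrix.sub_mulVec, dotProduct_sub] at h1
      nlinarith [mul_le_mul_of_nonneg_right hδ3 h3]
    · have h1 := abs_le.1 (hBA i j)
      have h2 := abs_le.1 (hAC i j)
      rw [abs_le]
      constructor <;> linarith
  have hd : dist (α := Fin d → Fin d → ℝ) B A < δ₀ := by
    refine lt_of_le_of_lt ?_ (half_lt_self hδ₀)
    refine (dist_pi_le_iff (by positivity)).2 fun i => (dist_pi_le_iff (by positivity)).2
        fun j => ?_
    rw [Real.dist_eq]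
    exact (hBA i j).trans hδ1
  have h : dist (α := Fin d → ℝ) (invSqrt B i) (invSqrt A i) < ε :=
    (dist_pi_lt_iff hε).1 (hu B hBT A hAT hd) i
  exact ((dist_pi_lt_iff hε).1 h j).le

end InvSqrt

end APE

namespace APE

/-! ### Measurability of gradients -/

theorem gradient_apply_eq_fderiv {d : ℕ} (F : E d → ℝ) (x : E d) (j : Fin d) :
    gradient F x j = fderiv ℝ F x (EuclideanSpace.single j 1) := by
  rw [gradient, ← InnerProductSpace.toDual_symm_apply (𝕜 := ℝ), EuclideanSpace.inner_single_right]
  simp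

theorem aemeasurable_euclidean {α : Type*} [MeasurableSpace α] {μ : Measure α} {d : ℕ}
    {F : α → E d} (h : ∀ j, AEMeasurable (fun a => F a j) μ) : AEMeasurable F μ :=
  (WithLp.measurable_toLp 2 (Fin d → ℝ)).comp_aemeasurable (aemeasurable_pi_iff.2 h)

/-- Each partial derivative is the limit of the quotients n (F(x + e_j/n) − F(x)), which are
measurable; convergence is needed only almost everywhere. -/
theorem aemeasurable_gradient {α : Type*} [MeasurableSpace α] {d : ℕ} {μ : Measure α}
    {F : α → E d → ℝ} (hF : Measurable fun q : α × E d => F q.1 q.2) {X : α → E d}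
    (hX : Measurable X) (hd : ∀ᵐ q ∂μ, DifferentiableAt ℝ (F q) (X q)) :
    AEMeasurable (fun q => gradient (F q) (X q)) μ := by
  refine aemeasurable_euclidean fun j => ?_
  have hc : Tendsto (fun n : ℕ => ‖(n : ℝ)‖) atTop atTop :=
    tendsto_norm_atTop_atTop.comp tendsto_natCast_atTop_atTop
  refine aemeasurable_of_tendsto_metrizable_ae atTop (f := fun (n : ℕ) q =>
    (n : ℝ) • (F q (X q + (n : ℝ)⁻¹ • EuclideanSpace.single j 1) - F q (X q))) (fun n => ?_) ?_
  · have h1 : Measurable fun q => F q (X q + (n : ℝ)⁻¹ • EuclideanSpace.single j 1) :=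
      hF.comp (measurable_id.prodMk (hX.add_const _))
    have h2 : Measurable fun q => F q (X q) := hF.comp (measurable_id.prodMk hX)
    exact ((h1.sub h2).const_smul (n : ℝ)).aemeasurable
  · filter_upwards [hd] with q hq
    rw [gradient_apply_eq_fderiv]
    exact hq.hasFDerivAt.lim _ hc

variable {d : ℕ} {𝒵 : Type*} [MeasurableSpace 𝒵] {P : ProbabilityMeasure (Obs d 𝒵)}

/-! ### Disintegration of the law of an observation -/

theorem isRegFun_regFun (hP : P ∈ P₀ d 𝒵) : IsRegFun P (regFun P) := Classical.epsilon_spec hP.1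

theorem isCondDensity_condDensity (hP : P ∈ P₀ d 𝒵) : IsCondDensity P (condDensity P) :=
  Classical.epsilon_spec hP.2

theorem measurePreserving_lawXZ (P : ProbabilityMeasure (Obs d 𝒵)) :
    MeasurePreserving (fun w : Obs d 𝒵 => w.2) (P : Measure (Obs d 𝒵)) (lawXZ P) :=
  ⟨measurable_snd, rfl⟩

instance (P : ProbabilityMeasure (Obs d 𝒵)) : IsProbabilityMeasure (lawXZ P) :=
  Measure.isProbabilityMeasure_map measurable_snd.aemeasurable

instance (P : ProbabilityMeasure (Obs d 𝒵)) : IsProbabilityMeasure (lawZ P) :=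
  Measure.isProbabilityMeasure_map measurable_snd.snd.aemeasurable

instance (P : ProbabilityMeasure (Obs d 𝒵)) : IsMarkovKernel (condLawX P) := by
  unfold condLawX; infer_instance

instance (P : ProbabilityMeasure (Obs d 𝒵)) : IsMarkovKernel (condLawY P) := by
  unfold condLawY; infer_instance

theorem measurePreserving_lawZ (P : ProbabilityMeasure (Obs d 𝒵)) :
    MeasurePreserving (fun q : E d × 𝒵 => q.2) (lawXZ P) (lawZ P) :=
  ⟨measurable_snd, by rw [lawXZ, lawZ, Measure.map_map measurable_snd measurable_snd]; rfl⟩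

theorem measurePreserving_compProd_condLawX (P : ProbabilityMeasure (Obs d 𝒵)) :
    MeasurePreserving (fun q : 𝒵 × E d => (q.2, q.1)) (lawZ P ⊗ₘ condLawX P) (lawXZ P) := by
  refine ⟨measurable_swap, ?_⟩
  rw [lawZ, condLawX, compProd_map_condDistrib measurable_snd.fst.aemeasurable, lawXZ,
    Measure.map_map (g := fun q : 𝒵 × E d => (q.2, q.1)) measurable_swap (by fun_prop)]
  rfl

theorem measurePreserving_condLawY (P : ProbabilityMeasure (Obs d 𝒵)) :
    MeasurePreserving (fun w : Obs d 𝒵 => (w.2, w.1)) (P : Measure (Obs d 𝒵))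
      (lawXZ P ⊗ₘ condLawY P) := by
  refine ⟨measurable_swap, ?_⟩
  rw [lawXZ, condLawY, compProd_map_condDistrib measurable_fst.aemeasurable]

theorem ae_lawXZ_of_ae_lawZ {p : 𝒵 → Prop} (h : ∀ᵐ z ∂(lawZ P), p z) :
    ∀ᵐ q ∂(lawXZ P), p q.2 :=
  (measurePreserving_lawZ P).quasiMeasurePreserving.ae h

theorem ae_of_ae_lawXZ {p : E d × 𝒵 → Prop} (h : ∀ᵐ q ∂(lawXZ P), p q) :
    ∀ᵐ w ∂(P : Measure (Obs d 𝒵)), p w.2 :=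
  (measurePreserving_lawXZ P).quasiMeasurePreserving.ae h

/-- A law with density p gives no mass to {p = 0}, so the score is almost surely a genuine
logarithmic derivative. -/
theorem ae_condDensity_pos (hP : P ∈ P₀ d 𝒵) : ∀ᵐ q ∂(lawXZ P), 0 < condDensity P q.1 q.2 := by
  have hp := isCondDensity_condDensity hP
  have hm : MeasurableSet {q : E d × 𝒵 | 0 < condDensity P q.1 q.2} :=
    measurableSet_lt measurable_const hp.measurable
  rw [← (measurePreserving_compProd_condLawX P).map_eq, ae_map_iff
    (measurePreserving_compProd_condLawX P).measurable.aemeasurable hm]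
  refine Measure.ae_compProd_of_ae_ae
    (hm.preimage (measurePreserving_compProd_condLawX P).measurable) ?_
  filter_upwards [hp.density] with z hz
  have hmz : Measurable fun x => condDensity P x z :=
      hp.measurable.comp (by fun_prop : Measurable fun x : E d => (x, z))
  rw [hz, ae_withDensity_iff hmz.ennreal_ofReal]
  refine Eventually.of_forall fun x hx => ?_
  simpa using hx

theorem aemeasurable_gradX {g : E d → 𝒵 → ℝ} (hg : Measurable fun q : E d × 𝒵 => g q.1 q.2)
    (hd : ∀ᵐ z ∂(lawZ P), Differentiable ℝ fun x => g x z) :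
    AEMeasurable (fun q : E d × 𝒵 => gradX g q.1 q.2) (lawXZ P) := by
  refine aemeasurable_gradient (F := fun (q : E d × 𝒵) x => g x q.2) (X := fun q => q.1)
    (hg.comp (by fun_prop : Measurable fun r : (E d × 𝒵) × E d => (r.2, r.1.2))) measurable_fst ?_
  filter_upwards [ae_lawXZ_of_ae_lawZ hd] with q hq
  exact hq _

theorem aemeasurable_score (hP : P ∈ P₀ d 𝒵) :
    AEMeasurable (fun q : E d × 𝒵 => score P q.1 q.2) (lawXZ P) := by
  have hp := isCondDensity_condDensity hP
  refine aemeasurable_gradient (F := fun (q : E d × 𝒵) x => Real.log (condDensity P x q.2))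
    (X := fun q => q.1) (Real.measurable_log.comp (hp.measurable.comp
      (by fun_prop : Measurable fun r : (E d × 𝒵) × E d => (r.2, r.1.2)))) measurable_fst ?_
  filter_upwards [ae_lawXZ_of_ae_lawZ hp.differentiable, ae_condDensity_pos hP] with q hq hq0
  exact (hq _).log hq0.ne'

/-! ### Integration by parts -/

/-- Integration by parts against the constant 1. Integrability of h and of its derivative replaces
compact support, and no continuity of the derivative is needed. -/
theorem integral_fderiv_eq_zero {h : E d → ℝ} (hd : Differentiable ℝ h) (hi : Integrable h)
    {v : E d}
    (hi' : Integrable fun x => fderiv ℝ h x v) : ∫ x, fderiv ℝ h x v = 0 := by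
  have := integral_mul_fderiv_eq_neg_fderiv_mul_of_integrable (𝕜 := ℝ) (μ := volume) (f := h)
    (g := fun _ => (1 : ℝ)) (v := v) (by simpa using hi') (by simp) (by simpa using hi)
    (fun x _ => hd x) (fun x _ => differentiableAt_const _)
  simpa using this

/-- Where p > 0 this is the product rule. Where p = 0 the nonnegative function p attains its
minimum, so its derivative vanishes and both sides are 0, whatever value the gradient of log p takes
there. Hence the identity holds everywhere without positivity of p. -/
theorem density_mul_score {p g : E d → ℝ} (hp0 : ∀ x, 0 ≤ p x) (hp : Differentiable ℝ p)
    (hg : Differentiable ℝ g) (x : E d) (j : Fin d) :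
    p x * (gradient g x j + gradient (fun x => Real.log (p x)) x j * g x)
      = fderiv ℝ (fun x => g x * p x) x (EuclideanSpace.single j 1) := by
  rw [gradient_apply_eq_fderiv, gradient_apply_eq_fderiv, fderiv_fun_mul (hg x) (hp x)]
  simp only [add_apply, smul_apply, smul_eq_mul]
  rcases (hp0 x).eq_or_lt with h0 | h0
  · have hmin : IsLocalMin p x := Eventually.of_forall fun y => by rw [← h0]; exact hp0 y
    rw [hmin.fderiv_eq_zero, ← h0]
    simp
  · rw [fderiv.log (hp x) h0.ne']
    simp only [smul_apply, smul_eq_mul]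
    field_simp
    ring

/-- Given z, the integrand times the density is the j-th partial derivative of g p, which has zero
integral over ℝ^d. The two integrability hypotheses say, for almost every z, that g p and this
derivative are Lebesgue integrable. -/
theorem integral_gradX_add_score_mul (hP : P ∈ P₀ d 𝒵) {g : E d → 𝒵 → ℝ}
    (hd : ∀ᵐ z ∂(lawZ P), Differentiable ℝ fun x => g x z) (j : Fin d)
    (hg : Integrable (fun q : E d × 𝒵 => g q.1 q.2) (lawXZ P))
    (hi : Integrable (fun q : E d × 𝒵 => gradX g q.1 q.2 j + score P q.1 q.2 j * g q.1 q.2)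
      (lawXZ P)) :
    ∫ q : E d × 𝒵, gradX g q.1 q.2 j + score P q.1 q.2 j * g q.1 q.2 ∂(lawXZ P) = 0 := by
  have hp := isCondDensity_condDensity hP
  have hmp := measurePreserving_compProd_condLawX P
  rw [← hmp.map_eq, integral_map hmp.measurable.aemeasurable
    (by rw [hmp.map_eq]; exact hi.aestronglyMeasurable)]
  have hi' := (hmp.integrable_comp hi.aestronglyMeasurable).2 hi
  have hg' := (hmp.integrable_comp hg.aestronglyMeasurable).2 hg
  refine (Measure.integral_compProd hi').trans ?_
  refine integral_eq_zero_of_ae ?_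
  filter_upwards [((Measure.integrable_compProd_iff hi'.aestronglyMeasurable).1 hi').1,
    ((Measure.integrable_compProd_iff hg'.aestronglyMeasurable).1 hg').1, hp.density,
    hp.differentiable, hd] with z hiz hgz hz hpz hdz
  have hmz : Measurable fun x => ENNReal.ofReal (condDensity P x z) :=
    (hp.measurable.comp (by fun_prop : Measurable fun x : E d => (x, z))).ennreal_ofReal
  have hlt : ∀ᵐ x : E d, ENNReal.ofReal (condDensity P x z) < ∞ :=
    Eventually.of_forall fun _ => ENNReal.ofReal_lt_top
  rw [hz, integrable_withDensity_iff_integrable_smul' hmz hlt] at hiz hgz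
  rw [hz, integral_withDensity_eq_integral_toReal_smul hmz hlt]
  simp only [Function.comp_apply, ENNReal.toReal_ofReal (hp.nonneg _ z), smul_eq_mul, Pi.zero_apply]
    at hiz hgz ⊢
  have key := density_mul_score (fun x => hp.nonneg x z) hpz hdz
  have e : ∀ x, condDensity P x z * (gradX g x z j + score P x z j * g x z)
      = fderiv ℝ (fun x => g x z * condDensity P x z) x (EuclideanSpace.single j 1) :=
    fun x => key x j
  simp_rw [e] at hiz ⊢
  exact integral_fderiv_eq_zero (hdz.mul hpz) (hgz.congr (Eventually.of_forall fun x =>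
    mul_comm _ _)) hiz

/-! ### Conditional moments of the outcome -/

/-- The residual has mean zero given (X, Z), so a is the conditional mean of the sum. It is
therefore integrable with the same integral, although neither summand is assumed integrable
separately. -/
theorem integrable_and_integral_of_add_residual (hP : P ∈ P₀ d 𝒵) {a b : E d × 𝒵 → ℝ}
    (ha : AEMeasurable a (lawXZ P)) (hb : AEMeasurable b (lawXZ P))
    (hi : Integrable (fun w : Obs d 𝒵 => a w.2 + b w.2 * (w.1 - regFun P w.2.1 w.2.2))
      (P : Measure (Obs d 𝒵))) :
    Integrable a (lawXZ P) ∧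
      ∫ w : Obs d 𝒵, a w.2 + b w.2 * (w.1 - regFun P w.2.1 w.2.2) ∂(P : Measure (Obs d 𝒵))
        = ∫ q, a q ∂(lawXZ P) := by
  have hf := isRegFun_regFun hP
  have hmp := measurePreserving_condLawY P
  set F : (E d × 𝒵) × ℝ → ℝ := fun q => a q.1 + b q.1 * (q.2 - regFun P q.1.1 q.1.2) with hF
  have hfst : Measure.QuasiMeasurePreserving (Prod.fst : (E d × 𝒵) × ℝ → E d × 𝒵)
      (lawXZ P ⊗ₘ condLawY P) (lawXZ P) := by
    refine ⟨measurable_fst, ?_⟩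
    rw [show (lawXZ P ⊗ₘ condLawY P).map Prod.fst = lawXZ P from Measure.fst_compProd _ _]
  have hFm : AEMeasurable F (lawXZ P ⊗ₘ condLawY P) :=
    (ha.comp_quasiMeasurePreserving hfst).add ((hb.comp_quasiMeasurePreserving hfst).mul
      (measurable_snd.sub (hf.measurable.comp measurable_fst)).aemeasurable)
  have hFi : Integrable F (lawXZ P ⊗ₘ condLawY P) :=
    (hmp.integrable_comp hFm.aestronglyMeasurable).1 hi
  have hcond : ∀ᵐ q ∂(lawXZ P), ∫ y, F (q, y) ∂(condLawY P q) = a q := by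
    filter_upwards [hf.integrable, hf.eq_mean] with q h1 h2
    simp only [hF]
    have h3 : Integrable (fun y => b q * (y - regFun P q.1 q.2)) (condLawY P q) :=
      (h1.sub (integrable_const _)).const_mul _
    rw [integral_add (integrable_const _) h3, integral_const_mul,
        integral_sub h1 (integrable_const _),
        ← h2]
    simp
  have h2 := (Measure.integrable_compProd_iff hFm.aestronglyMeasurable).1 hFi
  refine ⟨h2.2.mono' ha.aestronglyMeasurable ?_, ?_⟩
  · filter_upwards [hcond] with q hq
    rw [← hq]
    exact norm_integral_le_integral_norm _
  · calc ∫ w : Obs d 𝒵, a w.2 + b w.2 * (w.1 - regFun P w.2.1 w.2.2) ∂(P : Measure (Obs d 𝒵))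
        = ∫ q, F q ∂(lawXZ P ⊗ₘ condLawY P) := by
          rw [← hmp.map_eq, integral_map hmp.measurable.aemeasurable
            (by rw [hmp.map_eq]; exact hFm.aestronglyMeasurable)]
      _ = ∫ q, a q ∂(lawXZ P) := by
          rw [Measure.integral_compProd hFi]
          exact integral_congr_ae hcond

theorem lintegral_sq_mul_residual (hP : P ∈ P₀ d 𝒵) {b : E d × 𝒵 → ℝ}
    (hb : AEMeasurable b (lawXZ P)) :
    ∫⁻ w : Obs d 𝒵, ‖b w.2 * (w.1 - regFun P w.2.1 w.2.2)‖ₑ ^ 2 ∂(P : Measure (Obs d 𝒵))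
      ≤ ∫⁻ w : Obs d 𝒵, ‖b w.2‖ₑ ^ 2 * condVarY P w.2 ∂(P : Measure (Obs d 𝒵)) := by
  have hf := isRegFun_regFun hP
  have hmp := measurePreserving_condLawY P
  obtain ⟨b', hb', hbb'⟩ := hb
  set F : (E d × 𝒵) × ℝ → ℝ≥0∞ := fun q => ‖b' q.1 * (q.2 - regFun P q.1.1 q.1.2)‖ₑ ^ 2 with hF
  have hFm : Measurable F :=
    ((hb'.comp measurable_fst).mul
      (measurable_snd.sub (hf.measurable.comp measurable_fst))).enorm.pow_const 2
  have hw := ae_of_ae_lawXZ hbb'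
  have hcond : ∀ᵐ q ∂(lawXZ P), ∫⁻ y, F (q, y) ∂(condLawY P q) = ‖b' q‖ₑ ^ 2 * condVarY P q := by
    filter_upwards [hf.eq_mean] with q h2
    simp only [hF, enorm_mul, mul_pow]
    rw [lintegral_const_mul _ (by fun_prop), condVarY, evariance, h2]
  calc ∫⁻ w : Obs d 𝒵, ‖b w.2 * (w.1 - regFun P w.2.1 w.2.2)‖ₑ ^ 2 ∂(P : Measure (Obs d 𝒵))
      = ∫⁻ w : Obs d 𝒵, F (w.2, w.1) ∂(P : Measure (Obs d 𝒵)) := by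
        refine lintegral_congr_ae ?_
        filter_upwards [hw] with w h
        simp only [hF, h]
    _ = ∫⁻ q, F q ∂(lawXZ P ⊗ₘ condLawY P) := hmp.lintegral_comp hFm
    _ = ∫⁻ q, ‖b' q‖ₑ ^ 2 * condVarY P q ∂(lawXZ P) := by
        rw [Measure.lintegral_compProd hFm]
        exact lintegral_congr_ae hcond
    -- This direction of the change of variables holds without measurability of `condVarY`.
    _ ≤ ∫⁻ w : Obs d 𝒵, ‖b' w.2‖ₑ ^ 2 * condVarY P w.2 ∂(P : Measure (Obs d 𝒵)) :=
        lintegral_map_le _ _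
    _ = ∫⁻ w : Obs d 𝒵, ‖b w.2‖ₑ ^ 2 * condVarY P w.2 ∂(P : Measure (Obs d 𝒵)) := by
        refine lintegral_congr_ae ?_
        filter_upwards [hw] with w h
        rw [h]

end APE

namespace APE

variable {d : ℕ} {𝒵 : Type*} [MeasurableSpace 𝒵] {P : ProbabilityMeasure (Obs d 𝒵)}
  {f : E d → 𝒵 → ℝ} {ρ : E d → 𝒵 → E d}

/-! ### Decomposition of the error of the estimated influence function -/

/-- The error `φ̂ - φ_P` of the `j`-th coordinate of the doubly robust term. -/
noncomputable def drError (P : ProbabilityMeasure (Obs d 𝒵)) (f : E d → 𝒵 → ℝ) (ρ : E d → 𝒵 → E d)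
    (j : Fin d) (w : Obs d 𝒵) : ℝ :=
  drTerm f ρ w j - drTerm (regFun P) (score P) w j

/-- The gradient term `∇_j f_P - ∇_j f + ρ_{P,j} {f_P - f}`. -/
noncomputable def gradError (P : ProbabilityMeasure (Obs d 𝒵)) (f : E d → 𝒵 → ℝ) (j : Fin d)
    (q : E d × 𝒵) : ℝ :=
  gradX (regFun P) q.1 q.2 j - gradX f q.1 q.2 j
    + score P q.1 q.2 j * (regFun P q.1 q.2 - f q.1 q.2)

/-- The part of `drError` with mean zero. -/
noncomputable def centredError (P : ProbabilityMeasure (Obs d 𝒵)) (f : E d → 𝒵 → ℝ)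
    (ρ : E d → 𝒵 → E d) (j : Fin d) (w : Obs d 𝒵) : ℝ :=
  (score P w.2.1 w.2.2 j - ρ w.2.1 w.2.2 j) * (w.1 - regFun P w.2.1 w.2.2) - gradError P f j w.2

/-- The product of the two nuisance errors. -/
noncomputable def productError (P : ProbabilityMeasure (Obs d 𝒵)) (f : E d → 𝒵 → ℝ)
    (ρ : E d → 𝒵 → E d) (j : Fin d) (w : Obs d 𝒵) : ℝ :=
  (score P w.2.1 w.2.2 j - ρ w.2.1 w.2.2 j) * (regFun P w.2.1 w.2.2 - f w.2.1 w.2.2)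

/-- Double robustness: in (ρ_P − ρ̂)(y − f̂) write y − f̂ = (y − f_P) + (f_P − f̂). Every term that
is of first order in the nuisance errors falls into the centred part, and only the product of the
errors remains. -/
theorem drError_eq (j : Fin d) (w : Obs d 𝒵) :
    drError P f ρ j w = centredError P f ρ j w + productError P f ρ j w := by
  simp only [drError, centredError, productError, gradError, drTerm, PiLp.sub_apply,
    PiLp.smul_apply, smul_eq_mul]
  ring

theorem aemeasurable_coord {α : Type*} [MeasurableSpace α] {μ : Measure α} {F : α → E d}
    (hF : AEMeasurable F μ) (j : Fin d) : AEMeasurable (fun a => F a j) μ :=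
  (by fun_prop : Measurable fun x : E d => x j).comp_aemeasurable hF

/-! ### Moments of the error for fixed nuisance estimates -/

section Fixed

variable (hP : P ∈ P₀ d 𝒵) (hf : Measurable fun q : E d × 𝒵 => f q.1 q.2)
  (hρ : Measurable fun q : E d × 𝒵 => ρ q.1 q.2)
  (hd : ∀ᵐ z ∂(lawZ P), Differentiable ℝ fun x => f x z)
include hP

theorem aemeasurable_gradX_regFun :
    AEMeasurable (fun q : E d × 𝒵 => gradX (regFun P) q.1 q.2) (lawXZ P) :=
  aemeasurable_gradX (isRegFun_regFun hP).measurable (isRegFun_regFun hP).differentiable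

include hρ in
theorem aemeasurable_scoreError (j : Fin d) :
    AEMeasurable (fun q : E d × 𝒵 => score P q.1 q.2 j - ρ q.1 q.2 j) (lawXZ P) :=
  (aemeasurable_coord (aemeasurable_score hP) j).sub (aemeasurable_coord hρ.aemeasurable j)

include hf in
theorem measurable_regError :
    Measurable fun q : E d × 𝒵 => regFun P q.1 q.2 - f q.1 q.2 :=
  (isRegFun_regFun hP).measurable.sub hf

include hf hd in
theorem aemeasurable_gradError (j : Fin d) : AEMeasurable (gradError P f j) (lawXZ P) :=
  ((aemeasurable_coord (aemeasurable_gradX_regFun hP) j).sub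
    (aemeasurable_coord (aemeasurable_gradX hf hd) j)).add
    ((aemeasurable_coord (aemeasurable_score hP) j).mul (measurable_regError hP hf).aemeasurable)

omit hP in
theorem aemeasurable_comp_lawXZ {β : Type*} [MeasurableSpace β] {g : E d × 𝒵 → β}
    (hg : AEMeasurable g (lawXZ P)) :
    AEMeasurable (fun w : Obs d 𝒵 => g w.2) (P : Measure (Obs d 𝒵)) :=
  hg.comp_quasiMeasurePreserving (measurePreserving_lawXZ P).quasiMeasurePreserving

include hρ in
theorem aemeasurable_scoreError_mul_residual (j : Fin d) :
    AEMeasurable (fun w : Obs d 𝒵 => (score P w.2.1 w.2.2 j - ρ w.2.1 w.2.2 j)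
      * (w.1 - regFun P w.2.1 w.2.2)) (P : Measure (Obs d 𝒵)) :=
  (aemeasurable_comp_lawXZ (aemeasurable_scoreError hP hρ j)).mul
    (measurable_fst.sub ((isRegFun_regFun hP).measurable.comp measurable_snd)).aemeasurable

include hf hρ hd in
theorem aemeasurable_centredError (j : Fin d) :
    AEMeasurable (centredError P f ρ j) (P : Measure (Obs d 𝒵)) :=
  (aemeasurable_scoreError_mul_residual hP hρ j).sub
    (aemeasurable_comp_lawXZ (aemeasurable_gradError hP hf hd j))

include hf hρ in
theorem aemeasurable_productError (j : Fin d) :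
    AEMeasurable (productError P f ρ j) (P : Measure (Obs d 𝒵)) :=
  (aemeasurable_comp_lawXZ (aemeasurable_scoreError hP hρ j)).mul
    ((measurable_regError hP hf).comp measurable_snd).aemeasurable

include hρ in
theorem lintegral_sq_scoreError_mul_residual_le (j : Fin d) :
    ∫⁻ w : Obs d 𝒵, ‖(score P w.2.1 w.2.2 j - ρ w.2.1 w.2.2 j) * (w.1 - regFun P w.2.1 w.2.2)‖ₑ ^ 2
      ∂(P : Measure (Obs d 𝒵)) ≤ errEρ P ρ :=
  (lintegral_sq_mul_residual hP (aemeasurable_scoreError hP hρ j)).trans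
    (le_iSup (fun j => ∫⁻ w : Obs d 𝒵, ‖score P w.2.1 w.2.2 j - ρ w.2.1 w.2.2 j‖ₑ ^ 2
      * condVarY P w.2 ∂(P : Measure (Obs d 𝒵))) j)

omit hP in
theorem lintegral_sq_gradError_le (j : Fin d) :
    ∫⁻ w : Obs d 𝒵, ‖gradError P f j w.2‖ₑ ^ 2 ∂(P : Measure (Obs d 𝒵)) ≤ errEf P f :=
  le_iSup (fun j => ∫⁻ w : Obs d 𝒵, ‖gradError P f j w.2‖ₑ ^ 2 ∂(P : Measure (Obs d 𝒵))) j

omit hP in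
theorem memLp_two_of_lintegral_sq {α : Type*} [MeasurableSpace α] {μ : Measure α} {X : α → ℝ}
    (hX : AEMeasurable X μ) (h : ∫⁻ a, ‖X a‖ₑ ^ 2 ∂μ < ∞) : MemLp X 2 μ := by
  refine ⟨hX.aestronglyMeasurable, ?_⟩
  rw [eLpNorm_lt_top_iff_lintegral_rpow_enorm_lt_top (by norm_num) (by norm_num)]
  simpa using h

omit hP in
theorem integral_sq_eq_toReal {α : Type*} [MeasurableSpace α] {μ : Measure α} {X : α → ℝ}
    (hX : AEMeasurable X μ) : ∫ a, X a ^ 2 ∂μ = (∫⁻ a, ‖X a‖ₑ ^ 2 ∂μ).toReal := by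
  rw [integral_eq_lintegral_of_nonneg_ae (Eventually.of_forall fun a => sq_nonneg _)
    (hX.pow_const 2).aestronglyMeasurable]
  congr 1
  refine lintegral_congr fun a => ?_
  rw [← ofReal_norm, ← ENNReal.ofReal_pow (norm_nonneg _), Real.norm_eq_abs, sq_abs]

include hρ in
theorem lintegral_sq_centredError_le (j : Fin d) :
    ∫⁻ w, ‖centredError P f ρ j w‖ₑ ^ 2 ∂(P : Measure (Obs d 𝒵))
      ≤ 2 * (errEf P f + errEρ P ρ) := by
  have hb : ∀ x y : ℝ, ‖x - y‖ₑ ^ 2 ≤ 2 * (‖x‖ₑ ^ 2 + ‖y‖ₑ ^ 2) := by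
    intro x y
    simp only [← ofReal_norm]
    rw [← ENNReal.ofReal_pow (norm_nonneg _), ← ENNReal.ofReal_pow (norm_nonneg _),
      ← ENNReal.ofReal_pow (norm_nonneg _), ← ENNReal.ofReal_add (by positivity) (by positivity),
      ← ENNReal.ofReal_ofNat 2, ← ENNReal.ofReal_mul (by norm_num)]
    refine ENNReal.ofReal_le_ofReal ?_
    simp only [Real.norm_eq_abs, sq_abs]
    nlinarith [sq_nonneg (x + y)]
  refine (lintegral_mono fun w => hb _ _).trans ?_
  rw [lintegral_const_mul' _ _ (by norm_num), lintegral_add_left'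
    ((aemeasurable_scoreError_mul_residual hP hρ j).enorm.pow_const 2), add_comm]
  gcongr
  · exact lintegral_sq_gradError_le j
  · exact lintegral_sq_scoreError_mul_residual_le hP hρ j

include hf hρ hd in
theorem memLp_centredError (hEf : errEf P f < ∞) (hEρ : errEρ P ρ < ∞) (j : Fin d) :
    MemLp (centredError P f ρ j) 2 (P : Measure (Obs d 𝒵)) :=
  memLp_two_of_lintegral_sq (aemeasurable_centredError hP hf hρ hd j)
    ((lintegral_sq_centredError_le hP hρ j).trans_lt
      (ENNReal.mul_lt_top (by norm_num) (ENNReal.add_lt_top.2 ⟨hEf, hEρ⟩)))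

-- Finite A_f and E_f place f_P − f̂ and the gradient term in L², hence in L¹ under a probability
-- law, which is what integration by parts with g = f_P − f̂ requires.
include hf hd in
theorem integral_gradError_eq_zero (hAf : errAf P f < ∞) (hEf : errEf P f < ∞) (j : Fin d) :
    Integrable (gradError P f j) (lawXZ P) ∧ ∫ q, gradError P f j q ∂(lawXZ P) = 0 := by
  have hmp := measurePreserving_lawXZ P
  have hr := isRegFun_regFun hP
  have hgi : Integrable (fun q : E d × 𝒵 => regFun P q.1 q.2 - f q.1 q.2) (lawXZ P) := by
    rw [← hmp.integrable_comp (measurable_regError hP hf).aestronglyMeasurable]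
    exact (memLp_two_of_lintegral_sq ((measurable_regError hP hf).comp measurable_snd).aemeasurable
      hAf).integrable (by norm_num)
  have hei : Integrable (gradError P f j) (lawXZ P) := by
    rw [← hmp.integrable_comp (aemeasurable_gradError hP hf hd j).aestronglyMeasurable]
    exact (memLp_two_of_lintegral_sq (aemeasurable_comp_lawXZ (aemeasurable_gradError hP hf hd j))
      ((lintegral_sq_gradError_le j).trans_lt hEf)).integrable (by norm_num)
  have heq : gradError P f j =ᵐ[lawXZ P] fun q => gradX (fun x z => regFun P x z - f x z) q.1 q.2 j
      + score P q.1 q.2 j * (regFun P q.1 q.2 - f q.1 q.2) := by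
    filter_upwards [ae_lawXZ_of_ae_lawZ hd, ae_lawXZ_of_ae_lawZ hr.differentiable] with q h1 h2
    simp only [gradError, gradX, gradient_apply_eq_fderiv]
    rw [fderiv_fun_sub (h2 _) (h1 _)]
    rfl
  refine ⟨hei, ?_⟩
  rw [integral_congr_ae heq]
  refine integral_gradX_add_score_mul hP ?_ j hgi (hei.congr heq)
  filter_upwards [hd, hr.differentiable] with z h1 h2
  exact h2.sub h1

-- The residual term vanishes by conditioning on (X, Z), the gradient term by integration by parts.
include hf hρ hd in
theorem integral_centredError_eq_zero (hAf : errAf P f < ∞) (hEf : errEf P f < ∞)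
    (hEρ : errEρ P ρ < ∞) (j : Fin d) :
    ∫ w, centredError P f ρ j w ∂(P : Measure (Obs d 𝒵)) = 0 := by
  have hmp := measurePreserving_lawXZ P
  obtain ⟨h1, h2⟩ := integral_gradError_eq_zero hP hf hd hAf hEf j
  have h3 : Integrable (fun w : Obs d 𝒵 => gradError P f j w.2) (P : Measure (Obs d 𝒵)) :=
    (hmp.integrable_comp h1.aestronglyMeasurable).2 h1
  have h4 : Integrable (fun w : Obs d 𝒵 => (score P w.2.1 w.2.2 j - ρ w.2.1 w.2.2 j)
      * (w.1 - regFun P w.2.1 w.2.2)) (P : Measure (Obs d 𝒵)) :=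
    (memLp_two_of_lintegral_sq (aemeasurable_scoreError_mul_residual hP hρ j)
      ((lintegral_sq_scoreError_mul_residual_le hP hρ j).trans_lt hEρ)).integrable (by norm_num)
  have h5 := (integrable_and_integral_of_add_residual hP (a := fun _ => 0)
    (b := fun q => score P q.1 q.2 j - ρ q.1 q.2 j) aemeasurable_const
    (aemeasurable_scoreError hP hρ j) (by simpa using h4)).2
  simp only [zero_add, integral_zero] at h5
  unfold centredError
  rw [integral_sub h4 h3, h5]
  have h6 : ∫ w : Obs d 𝒵, gradError P f j w.2 ∂(P : Measure (Obs d 𝒵)) = 0 := by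
    rw [← h2, ← hmp.map_eq, integral_map hmp.measurable.aemeasurable
      (by rw [hmp.map_eq]; exact h1.aestronglyMeasurable)]
  simpa using h6

include hf hρ in
theorem lintegral_productError_le (j : Fin d) :
    ∫⁻ w, ‖productError P f ρ j w‖ₑ ∂(P : Measure (Obs d 𝒵))
      ≤ (errAf P f * errAρ P ρ) ^ (1 / 2 : ℝ) := by
  have h := ENNReal.lintegral_mul_le_Lp_mul_Lq (P : Measure (Obs d 𝒵)) Real.HolderConjugate.two_two
    (aemeasurable_comp_lawXZ (aemeasurable_scoreError hP hρ j)).enorm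
    ((measurable_regError hP hf).comp measurable_snd).aemeasurable.enorm
  simp only [Pi.mul_apply] at h
  calc ∫⁻ w, ‖productError P f ρ j w‖ₑ ∂(P : Measure (Obs d 𝒵)) ≤ _ := by
        refine (lintegral_mono fun w => ?_).trans h
        simp [productError, enorm_mul]
    _ ≤ errAρ P ρ ^ (1 / 2 : ℝ) * errAf P f ^ (1 / 2 : ℝ) := by
        gcongr
        · simp only [ENNReal.rpow_ofNat]
          exact le_iSup (fun j => ∫⁻ w : Obs d 𝒵, ‖score P w.2.1 w.2.2 j - ρ w.2.1 w.2.2 j‖ₑ ^ 2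
            ∂(P : Measure (Obs d 𝒵))) j
        · simp only [ENNReal.rpow_ofNat]
          rfl
    _ = (errAf P f * errAρ P ρ) ^ (1 / 2 : ℝ) := by
        rw [mul_comm, ENNReal.mul_rpow_of_nonneg _ _ (by norm_num)]

-- Three exceptional events: the centred sum is large (Chebyshev), the sum of centred squares is
-- large (Markov), or the sum of absolute products is large (Markov, with mean at most δ/√n per
-- term). Here m is the size of a fold and n that of the whole sample.
include hf hρ hd in
theorem measure_pi_drError_le {m n : ℕ} (hmn : m ≤ n) (hn : 0 < n) {δ ε : ℝ} (hδ : 0 ≤ δ)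
    (hε : 0 < ε) (hε1 : ε ≤ 1)
    (hAf : errAf P f < ∞) (hEf : errEf P f ≤ ENNReal.ofReal δ) (hEρ : errEρ P ρ ≤ ENNReal.ofReal δ)
    (hA : (n : ℝ≥0∞) * (errAf P f * errAρ P ρ) ≤ ENNReal.ofReal (δ ^ 2)) (j : Fin d) :
    (Measure.pi fun _ : Fin m => (P : Measure (Obs d 𝒵)))
      {v | ¬ (|∑ i, drError P f ρ j (v i)| ≤ ε * √n ∧ ∑ i, drError P f ρ j (v i) ^ 2 ≤ ε * n)}
      ≤ ENNReal.ofReal (34 * δ / ε ^ 2) := by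
  have hn' : (0 : ℝ) < n := by exact_mod_cast hn
  have hmn' : (m : ℝ) ≤ n := by exact_mod_cast hmn
  have hsn : 0 < √(n : ℝ) := Real.sqrt_pos.2 hn'
  have hsq : √(n : ℝ) * √n = n := Real.mul_self_sqrt hn'.le
  have hEf' := hEf.trans_lt ENNReal.ofReal_lt_top
  have hEρ' := hEρ.trans_lt ENNReal.ofReal_lt_top
  have hmu := aemeasurable_centredError hP hf hρ hd j
  have hu2 := memLp_centredError hP hf hρ hd hEf' hEρ' j
  have hl2 : ∫⁻ w, ‖centredError P f ρ j w‖ₑ ^ 2 ∂(P : Measure (Obs d 𝒵))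
      ≤ ENNReal.ofReal (4 * δ) := by
    refine (lintegral_sq_centredError_le hP hρ j).trans ?_
    calc 2 * (errEf P f + errEρ P ρ) ≤ 2 * (ENNReal.ofReal δ + ENNReal.ofReal δ) := by gcongr
      _ = ENNReal.ofReal (4 * δ) := by
        rw [← ENNReal.ofReal_add hδ hδ, ← ENNReal.ofReal_ofNat 2,
            ← ENNReal.ofReal_mul (by norm_num)]
        congr 1; ring
  have hi2 : ∫ w, centredError P f ρ j w ^ 2 ∂(P : Measure (Obs d 𝒵)) ≤ 4 * δ := by
    rw [integral_sq_eq_toReal hmu]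
    exact ENNReal.toReal_le_of_le_ofReal (by positivity) hl2
  have hl1 : ∫⁻ w, ‖productError P f ρ j w‖ₑ ∂(P : Measure (Obs d 𝒵))
      ≤ ENNReal.ofReal (δ / √n) := by
    refine (lintegral_productError_le hP hf hρ j).trans ?_
    have h1 : errAf P f * errAρ P ρ ≤ ENNReal.ofReal ((δ / √n) ^ 2) := by
      rw [div_pow, sq (√(n : ℝ)), hsq, ENNReal.ofReal_div_of_pos hn', ENNReal.ofReal_natCast,
        ENNReal.le_div_iff_mul_le (by simp [hn.ne']) (by simp), mul_comm]
      exact hA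
    refine (ENNReal.rpow_le_rpow h1 (by norm_num)).trans (le_of_eq ?_)
    rw [ENNReal.ofReal_pow (by positivity), ← ENNReal.rpow_natCast, ← ENNReal.rpow_mul]
    norm_num
  have hsub : {v : Fin m → Obs d 𝒵 | ¬ (|∑ i, drError P f ρ j (v i)| ≤ ε * √n
      ∧ ∑ i, drError P f ρ j (v i) ^ 2 ≤ ε * n)} ⊆
      {v | ε * √n / 2 < |∑ i, centredError P f ρ j (v i)|} ∪
      ({v | ENNReal.ofReal (ε * n / 4) < ∑ i, ‖centredError P f ρ j (v i)‖ₑ ^ 2} ∪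
      {v | ENNReal.ofReal (ε * √n / 2) < ∑ i, ‖productError P f ρ j (v i)‖ₑ}) := by
    intro v hv
    by_contra hcon
    simp only [Set.mem_union, Set.mem_ofPred_eq, not_or, not_lt] at hcon hv
    obtain ⟨c1, c2, c3⟩ := hcon
    refine hv ?_
    have c2' : ∑ i, centredError P f ρ j (v i) ^ 2 ≤ ε * n / 4 := by
      have h1 : ∑ i, ‖centredError P f ρ j (v i)‖ₑ ^ 2
          = ENNReal.ofReal (∑ i, centredError P f ρ j (v i) ^ 2) := by
        rw [ENNReal.ofReal_sum_of_nonneg fun i _ => sq_nonneg _]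
        refine Finset.sum_congr rfl fun i _ => ?_
        rw [← ofReal_norm, ← ENNReal.ofReal_pow (norm_nonneg _), Real.norm_eq_abs, sq_abs]
      rw [h1] at c2
      exact (ENNReal.ofReal_le_ofReal_iff (by positivity)).1 c2
    have c3' : ∑ i, |productError P f ρ j (v i)| ≤ ε * √n / 2 := by
      have h1 : ∑ i, ‖productError P f ρ j (v i)‖ₑ
          = ENNReal.ofReal (∑ i, |productError P f ρ j (v i)|) := by
        rw [ENNReal.ofReal_sum_of_nonneg fun i _ => abs_nonneg _]
        refine Finset.sum_congr rfl fun i _ => ?_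
        rw [← ofReal_norm, Real.norm_eq_abs]
      rw [h1] at c3
      exact (ENNReal.ofReal_le_ofReal_iff (by positivity)).1 c3
    constructor
    · simp only [drError_eq, Finset.sum_add_distrib]
      refine (abs_add_le _ _).trans ?_
      have := Finset.abs_sum_le_sum_abs (fun i => productError P f ρ j (v i)) Finset.univ
      linarith
    -- No second moment of the product is available; its squares are controlled by the square of the
    -- sum of absolute values, already of order √n.
    · have h2 : ∑ i, productError P f ρ j (v i) ^ 2 ≤ ε * n / 4 := by
        calc ∑ i, productError P f ρ j (v i) ^ 2 = ∑ i, |productError P f ρ j (v i)| ^ 2 := by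
              simp only [sq_abs]
          _ ≤ (∑ i, |productError P f ρ j (v i)|) ^ 2 :=
              Finset.sum_sq_le_sq_sum_of_nonneg fun i _ => abs_nonneg _
          _ ≤ (ε * √n / 2) ^ 2 := by
              gcongr
          _ = ε * (ε * n) / 4 := by rw [div_pow, mul_pow, sq (√(n : ℝ)), hsq]; ring
          _ ≤ ε * n / 4 := by
              have : ε * (ε * n) ≤ 1 * (ε * n) := by gcongr
              linarith
      calc ∑ i, drError P f ρ j (v i) ^ 2
          ≤ ∑ i, (2 * centredError P f ρ j (v i) ^ 2 + 2 * productError P f ρ j (v i) ^ 2) := by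
            refine Finset.sum_le_sum fun i _ => ?_
            rw [drError_eq]
            nlinarith [sq_nonneg (centredError P f ρ j (v i) - productError P f ρ j (v i))]
        _ ≤ ε * n := by
            rw [Finset.sum_add_distrib, ← Finset.mul_sum, ← Finset.mul_sum]
            linarith
  have b1 := measure_pi_abs_sum_gt_le hu2
      (integral_centredError_eq_zero hP hf hρ hd hAf hEf' hEρ' j)
    m (t := ε * √n / 2) (by positivity)
  have b2 := measure_pi_sum_gt_le (hmu.enorm.pow_const 2) m (t := ENNReal.ofReal (ε * n / 4))
    (ENNReal.ofReal_pos.2 (by positivity)).ne' ENNReal.ofReal_ne_top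
  have b3 := measure_pi_sum_gt_le (aemeasurable_productError hP hf hρ j).enorm m
    (t := ENNReal.ofReal (ε * √n / 2)) (ENNReal.ofReal_pos.2 (by positivity)).ne'
    ENNReal.ofReal_ne_top
  refine (measure_mono hsub).trans ((measure_union_le _ _).trans ((add_le_add b1
    ((measure_union_le _ _).trans (add_le_add b2 b3))).trans ?_))
  have e1 : m * (∫ w, centredError P f ρ j w ^ 2 ∂(P : Measure (Obs d 𝒵))) / (ε * √n / 2) ^ 2
      ≤ 16 * δ / ε ^ 2 := by
    calc m * (∫ w, centredError P f ρ j w ^ 2 ∂(P : Measure (Obs d 𝒵))) / (ε * √n / 2) ^ 2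
        ≤ n * (4 * δ) / (ε * √n / 2) ^ 2 := by gcongr
      _ = 16 * δ / ε ^ 2 := by
          rw [show (ε * √n / 2) ^ 2 = ε ^ 2 * (√n * √n) / 4 by ring, hsq]
          field_simp; ring
  have e2 : m * (∫⁻ w, ‖centredError P f ρ j w‖ₑ ^ 2 ∂(P : Measure (Obs d 𝒵)))
      / ENNReal.ofReal (ε * n / 4) ≤ ENNReal.ofReal (16 * δ / ε) := by
    calc m * (∫⁻ w, ‖centredError P f ρ j w‖ₑ ^ 2 ∂(P : Measure (Obs d 𝒵)))
        / ENNReal.ofReal (ε * n / 4)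
        ≤ ENNReal.ofReal n * ENNReal.ofReal (4 * δ) / ENNReal.ofReal (ε * n / 4) := by
          rw [ENNReal.ofReal_natCast]; gcongr
      _ = ENNReal.ofReal (16 * δ / ε) := by
          rw [← ENNReal.ofReal_mul (by positivity), ← ENNReal.ofReal_div_of_pos (by positivity)]
          congr 1; field_simp; ring
  have e3 : m * (∫⁻ w, ‖productError P f ρ j w‖ₑ ∂(P : Measure (Obs d 𝒵)))
      / ENNReal.ofReal (ε * √n / 2) ≤ ENNReal.ofReal (2 * δ / ε) := by
    calc m * (∫⁻ w, ‖productError P f ρ j w‖ₑ ∂(P : Measure (Obs d 𝒵)))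
        / ENNReal.ofReal (ε * √n / 2)
        ≤ ENNReal.ofReal n * ENNReal.ofReal (δ / √n) / ENNReal.ofReal (ε * √n / 2) := by
          rw [ENNReal.ofReal_natCast]; gcongr
      _ = ENNReal.ofReal (2 * δ / ε) := by
          rw [← ENNReal.ofReal_mul (by positivity), ← ENNReal.ofReal_div_of_pos (by positivity)]
          congr 1
          nth_rewrite 1 [← hsq]
          field_simp
  refine (add_le_add (ENNReal.ofReal_le_ofReal e1) (add_le_add e2 e3)).trans ?_
  rw [← ENNReal.ofReal_add (by positivity) (by positivity),
    ← ENNReal.ofReal_add (by positivity) (by positivity)]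
  refine ENNReal.ofReal_le_ofReal ?_
  have h1 : δ / ε ≤ δ / ε ^ 2 := by
    gcongr
    nlinarith
  -- The constant is 34 = 16 + 16 + 2, one summand per event, with ε ≤ 1 used to replace 1/ε by
  -- 1/ε².
  calc 16 * δ / ε ^ 2 + (16 * δ / ε + 2 * δ / ε) = 16 * (δ / ε ^ 2) + 18 * (δ / ε) := by ring
    _ ≤ 16 * (δ / ε ^ 2) + 18 * (δ / ε ^ 2) := by gcongr
    _ = 34 * δ / ε ^ 2 := by ring

end Fixed

end APE

namespace APE

/-! ### Independence of a fold and its training data -/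

namespace Folds

variable {K m : ℕ} (I : Folds K m)

theorem card_fold_eq (k : Fin K) : (I.fold k).card = m := I.card_fold k

/-- The observations in the fold `I^(k)`, listed by increasing index. -/
def test {W : Type*} (k : Fin K) (D : Fin (K * m) → W) : Fin m → W :=
  fun i => D ((I.fold k).orderEmbOfFin (I.card_fold_eq k) i)

theorem sum_fold_eq_sum_test {W M : Type*} [AddCommMonoid M] (k : Fin K) (D : Fin (K * m) → W)
    (g : W → M) : ∑ i ∈ I.fold k, g (D i) = ∑ i, g (I.test k D i) := by
  rw [← Finset.map_orderEmbOfFin_univ (I.fold k) (I.card_fold_eq k), Finset.sum_map]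
  rfl

theorem sum_sum_fold {M : Type*} [AddCommMonoid M] (F : Fin K → Fin (K * m) → M) :
    ∑ k, ∑ i ∈ I.fold k, F k i = ∑ i, F (I.label i) i := by
  rw [← Finset.sum_fiberwise Finset.univ I.label]
  refine Finset.sum_congr rfl fun k _ => Finset.sum_congr rfl fun i hi => ?_
  rw [(Finset.mem_filter.1 hi).2]

/-- The indices, split into those outside and those inside of a fold. -/
noncomputable def splitIndex (k : Fin K) : Fin ((K - 1) * m) ⊕ Fin m ≃ Fin (K * m) :=
  Equiv.ofBijective
    (Sum.elim ((I.fold k)ᶜ.orderEmbOfFin (I.card_compl k))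
      ((I.fold k).orderEmbOfFin (I.card_fold_eq k))) <| by
    rw [Fintype.bijective_iff_surjective_and_card]
    constructor
    · intro i
      by_cases hi : i ∈ I.fold k
      · have : i ∈ Set.range ((I.fold k).orderEmbOfFin (I.card_fold_eq k)) := by
          rw [Finset.range_orderEmbOfFin]; exact hi
        obtain ⟨a, ha⟩ := this
        exact ⟨Sum.inr a, ha⟩
      · have : i ∈ Set.range ((I.fold k)ᶜ.orderEmbOfFin (I.card_compl k)) := by
          rw [Finset.range_orderEmbOfFin]; simpa using hi
        obtain ⟨a, ha⟩ := this
        exact ⟨Sum.inl a, ha⟩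
    · simp only [Fintype.card_sum, Fintype.card_fin]
      rw [← Nat.succ_mul, Nat.succ_eq_add_one, Nat.sub_add_cancel k.pos]

/-- A sample, split into the training data and the observations of a fold. -/
noncomputable def split (W : Type*) [MeasurableSpace W] (k : Fin K) :
    (Fin (K * m) → W) ≃ᵐ (Fin ((K - 1) * m) → W) × (Fin m → W) :=
  (MeasurableEquiv.piCongrLeft (fun _ => W) (I.splitIndex k)).symm.trans
    (MeasurableEquiv.sumPiEquivProdPi fun _ => W)

theorem split_apply {W : Type*} [MeasurableSpace W] (k : Fin K) (D : Fin (K * m) → W) :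
    I.split W k D = (I.train k D, I.test k D) := rfl

theorem measurePreserving_split {W : Type*} [MeasurableSpace W] (μ : Measure W)
    [IsProbabilityMeasure μ] (k : Fin K) :
    MeasurePreserving (I.split W k) (Measure.pi fun _ => μ)
      ((Measure.pi fun _ => μ).prod (Measure.pi fun _ => μ)) :=
  (measurePreserving_sumPiEquivProdPi fun _ => μ).comp
    ((measurePreserving_piCongrLeft (fun _ => μ) (I.splitIndex k)).symm _)

/-- The training data of any fold are an i.i.d. sample of size (K − 1) m, so their law does not
depend on k. Splitting the sample is a measurable equivalence, so S need not be measurable. -/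
theorem measure_train_preimage {W : Type*} [MeasurableSpace W] (μ : Measure W)
    [IsProbabilityMeasure μ] (k : Fin K) (S : Set (Fin ((K - 1) * m) → W)) :
    (Measure.pi fun _ : Fin (K * m) => μ) {D | I.train k D ∈ S}
      = (Measure.pi fun _ : Fin ((K - 1) * m) => μ) S := by
  have h := (I.measurePreserving_split μ k).measure_preimage_equiv (S ×ˢ Set.univ)
  rw [Measure.prod_prod, measure_univ, mul_one] at h
  rw [← h]
  congr 1
  ext D
  simp [split_apply]

end Folds

variable {d : ℕ} {𝒵 : Type*} [MeasurableSpace 𝒵] {P : ProbabilityMeasure (Obs d 𝒵)}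

instance (P : ProbabilityMeasure (Obs d 𝒵)) (n : ℕ) : IsProbabilityMeasure (sampleLaw P n) := by
  unfold sampleLaw; infer_instance

/-! ### Joint measurability, and the error of one fold given its training data -/

section Joint

variable {N : ℕ} {fhat : (Fin N → Obs d 𝒵) → E d → 𝒵 → ℝ} {ρhat : (Fin N → Obs d 𝒵) → E d → 𝒵 → E d}

theorem aemeasurable_drTerm (hP : P ∈ P₀ d 𝒵) :
    AEMeasurable (drTerm (regFun P) (score P)) (P : Measure (Obs d 𝒵)) :=
  (aemeasurable_comp_lawXZ (aemeasurable_gradX_regFun hP)).sub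
    ((measurable_fst.sub ((isRegFun_regFun hP).measurable.comp measurable_snd)).aemeasurable.smul
      (aemeasurable_comp_lawXZ (aemeasurable_score hP)))

theorem aemeasurable_drError_joint (hP : P ∈ P₀ d 𝒵)
    (hf : Measurable fun q : (Fin N → Obs d 𝒵) × E d × 𝒵 => fhat q.1 q.2.1 q.2.2)
    (hρ : Measurable fun q : (Fin N → Obs d 𝒵) × E d × 𝒵 => ρhat q.1 q.2.1 q.2.2)
    (hdiff : ∀ᵐ q ∂((sampleLaw P N).prod (lawZ P)), Differentiable ℝ fun x => fhat q.1 x q.2)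
    (j : Fin d) :
    AEMeasurable (fun q : (Fin N → Obs d 𝒵) × Obs d 𝒵 => drError P (fhat q.1) (ρhat q.1) j q.2)
      ((sampleLaw P N).prod (P : Measure (Obs d 𝒵))) := by
  have hz : MeasurePreserving (fun q : (Fin N → Obs d 𝒵) × Obs d 𝒵 => (q.1, q.2.2.2))
      ((sampleLaw P N).prod (P : Measure (Obs d 𝒵))) ((sampleLaw P N).prod (lawZ P)) :=
    (MeasurePreserving.id (sampleLaw P N)).prod
      (⟨measurable_snd.snd, rfl⟩ : MeasurePreserving (fun w : Obs d 𝒵 => w.2.2) P (lawZ P))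
  have hg : AEMeasurable (fun q : (Fin N → Obs d 𝒵) × Obs d 𝒵 => gradX (fhat q.1) q.2.2.1 q.2.2.2)
      ((sampleLaw P N).prod (P : Measure (Obs d 𝒵))) := by
    refine aemeasurable_gradient
      (F := fun (q : (Fin N → Obs d 𝒵) × Obs d 𝒵) x => fhat q.1 x q.2.2.2) (X := fun q => q.2.2.1)
      (hf.comp (by fun_prop : Measurable fun r : ((Fin N → Obs d 𝒵) × Obs d 𝒵) × E d =>
        (r.1.1, r.2, r.1.2.2.2))) (by fun_prop) ?_
    filter_upwards [hz.quasiMeasurePreserving.ae hdiff] with q hq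
    exact hq _
  have hm : Measurable fun q : (Fin N → Obs d 𝒵) × Obs d 𝒵 => (q.1, q.2.2.1, q.2.2.2) := by fun_prop
  have h1 : AEMeasurable (fun q : (Fin N → Obs d 𝒵) × Obs d 𝒵 => drTerm (fhat q.1) (ρhat q.1) q.2)
      ((sampleLaw P N).prod (P : Measure (Obs d 𝒵))) :=
    hg.sub (((by fun_prop : Measurable fun q : (Fin N → Obs d 𝒵) × Obs d 𝒵 => q.2.1).sub
      (hf.comp hm)).smul (hρ.comp hm)).aemeasurable
  have h2 := (aemeasurable_drTerm hP).comp_quasiMeasurePreserving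
    (Measure.quasiMeasurePreserving_snd (μ := sampleLaw P N) (ν := (P : Measure (Obs d 𝒵))))
  exact (aemeasurable_coord h1 j).sub (aemeasurable_coord h2 j)

theorem measurePreserving_eval_snd (P : ProbabilityMeasure (Obs d 𝒵)) (N : ℕ) {m : ℕ} (i : Fin m) :
    MeasurePreserving (fun q : (Fin N → Obs d 𝒵) × (Fin m → Obs d 𝒵) => (q.1, q.2 i))
      ((sampleLaw P N).prod (sampleLaw P m)) ((sampleLaw P N).prod (P : Measure (Obs d 𝒵))) := by
  have h : MeasurePreserving (fun v : Fin m → Obs d 𝒵 => v i) (sampleLaw P m)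
    (P : Measure (Obs d 𝒵)) := measurePreserving_eval (fun _ => (P : Measure (Obs d 𝒵))) i
  exact (MeasurePreserving.id (sampleLaw P N)).prod h

end Joint

/-- Bounds on the nuisance errors under which a fold contributes a negligible error. -/
def NuisanceBound (P : ProbabilityMeasure (Obs d 𝒵)) (f : E d → 𝒵 → ℝ) (ρ : E d → 𝒵 → E d) (n : ℕ)
    (δ : ℝ) : Prop :=
  errAf P f < ∞ ∧ errEf P f ≤ ENNReal.ofReal δ ∧ errEρ P ρ ≤ ENNReal.ofReal δ ∧
    (n : ℝ≥0∞) * (errAf P f * errAρ P ρ) ≤ ENNReal.ofReal (δ ^ 2)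

/-- Condition on the training data of fold k: the fold is a fresh sample, so `measure_pi_drError_le`
applies with the estimates fixed, unless the nuisance bound fails. The probability of failure is the
same for every training set, so it may be evaluated at another fold k₀. -/
theorem sampleLaw_fold_error_le {K m : ℕ} (I : Folds K m) (hm : 0 < m)
    {fhat : (Fin ((K - 1) * m) → Obs d 𝒵) → E d → 𝒵 → ℝ}
    {ρhat : (Fin ((K - 1) * m) → Obs d 𝒵) → E d → 𝒵 → E d} (hP : P ∈ P₀ d 𝒵)
    (hf : Measurable fun q : (Fin ((K - 1) * m) → Obs d 𝒵) × E d × 𝒵 => fhat q.1 q.2.1 q.2.2)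
    (hρ : Measurable fun q : (Fin ((K - 1) * m) → Obs d 𝒵) × E d × 𝒵 => ρhat q.1 q.2.1 q.2.2)
    (hdiff : ∀ᵐ q ∂((sampleLaw P ((K - 1) * m)).prod (lawZ P)),
      Differentiable ℝ fun x => fhat q.1 x q.2)
    {δ ε : ℝ} (hδ : 0 ≤ δ) (hε : 0 < ε) (hε1 : ε ≤ 1) (k k₀ : Fin K) (j : Fin d) :
    sampleLaw P (K * m) {D | ¬ (
      |∑ i ∈ I.fold k, drError P (fhat (I.train k D)) (ρhat (I.train k D)) j (D i)|
          ≤ ε * √((K * m : ℕ) : ℝ) ∧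
        ∑ i ∈ I.fold k, drError P (fhat (I.train k D)) (ρhat (I.train k D)) j (D i) ^ 2
          ≤ ε * (K * m : ℕ))}
      ≤ sampleLaw P (K * m) {D | ¬ NuisanceBound P (fhat (I.train k₀ D)) (ρhat (I.train k₀ D))
          (K * m) δ} + ENNReal.ofReal (34 * δ / ε ^ 2) := by
  have hn : 0 < K * m := Nat.mul_pos k.pos hm
  have hmn : m ≤ K * m := Nat.le_mul_of_pos_left m k.pos
  obtain ⟨A, hA⟩ : ∃ A : Set ((Fin ((K - 1) * m) → Obs d 𝒵) × (Fin m → Obs d 𝒵)),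
      A = {q | ¬ (
      |∑ i, drError P (fhat q.1) (ρhat q.1) j (q.2 i)| ≤ ε * √((K * m : ℕ) : ℝ) ∧
      ∑ i, drError P (fhat q.1) (ρhat q.1) j (q.2 i) ^ 2 ≤ ε * (K * m : ℕ))} := ⟨_, rfl⟩
  have hcoord := fun i : Fin m => (aemeasurable_drError_joint hP hf hρ hdiff
    j).comp_quasiMeasurePreserving (measurePreserving_eval_snd P _ i).quasiMeasurePreserving
  simp only [Function.comp_def] at hcoord
  have hAm : NullMeasurableSet A ((sampleLaw P ((K - 1) * m)).prod (sampleLaw P m)) := by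
    rw [hA]
    refine NullMeasurableSet.compl (NullMeasurableSet.inter ?_ ?_)
    · exact nullMeasurableSet_le (measurable_norm.comp_aemeasurable
        (Finset.aemeasurable_fun_sum _ fun i _ => hcoord i)) aemeasurable_const
    · exact nullMeasurableSet_le (Finset.aemeasurable_fun_sum _ fun i _ => (hcoord i).pow_const 2)
        aemeasurable_const
  have hbound := prod_measure_le_of_ae hAm
      (B := {T | ¬ NuisanceBound P (fhat T) (ρhat T) (K * m) δ})
    (δ := ENNReal.ofReal (34 * δ / ε ^ 2)) (by
      filter_upwards [Measure.ae_ae_of_ae_prod hdiff] with T hT hTB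
      simp only [not_not] at hTB
      rw [hA]
      exact measure_pi_drError_le hP (hf.comp (by fun_prop : Measurable fun q : E d × 𝒵 => (T, q)))
        (hρ.comp (by fun_prop : Measurable fun q : E d × 𝒵 => (T, q))) hT hmn hn hδ hε hε1
        hTB.1 hTB.2.1 hTB.2.2.1 hTB.2.2.2 j)
  have h1 : sampleLaw P (K * m) (I.split (Obs d 𝒵) k ⁻¹' A)
      = ((sampleLaw P ((K - 1) * m)).prod (sampleLaw P m)) A :=
    (I.measurePreserving_split (P : Measure (Obs d 𝒵)) k).measure_preimage_equiv A
  have h2 : sampleLaw P (K * m) {D | I.train k₀ D ∈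
        {T | ¬ NuisanceBound P (fhat T) (ρhat T) (K * m) δ}}
      = sampleLaw P ((K - 1) * m) {T | ¬ NuisanceBound P (fhat T) (ρhat T) (K * m) δ} :=
    I.measure_train_preimage (P : Measure (Obs d 𝒵)) k₀ _
  have h3 : {D | ¬ (
      |∑ i ∈ I.fold k, drError P (fhat (I.train k D)) (ρhat (I.train k D)) j (D i)|
          ≤ ε * √((K * m : ℕ) : ℝ) ∧
        ∑ i ∈ I.fold k, drError P (fhat (I.train k D)) (ρhat (I.train k D)) j (D i) ^ 2
          ≤ ε * (K * m : ℕ))} = I.split (Obs d 𝒵) k ⁻¹' A := by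
    ext D
    rw [Set.mem_preimage, I.split_apply, hA, Set.mem_ofPred_eq, Set.mem_ofPred_eq,
      I.sum_fold_eq_sum_test k D
        (fun w => drError P (fhat (I.train k D)) (ρhat (I.train k D)) j w),
      I.sum_fold_eq_sum_test k D
        (fun w => drError P (fhat (I.train k D)) (ρhat (I.train k D)) j w ^ 2)]
  rw [← h1, ← h2] at hbound
  rw [h3]
  exact hbound

end APE

namespace APE

variable {d : ℕ} {𝒵 : Type*} [MeasurableSpace 𝒵] {P : ProbabilityMeasure (Obs d 𝒵)}

/-! ### Moments of the influence function -/

theorem lintegral_rpow_le_of_le {α F : Type*} [MeasurableSpace α] {μ : Measure α}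
    [IsProbabilityMeasure μ] [NormedAddCommGroup F] {ξ : α → F} {p r C : ℝ} (hC : 0 ≤ C)
    (hp : 0 ≤ p) (hpr : p ≤ r) (h : ∫⁻ a, ‖ξ a‖ₑ ^ r ∂μ ≤ ENNReal.ofReal C) :
    ∫⁻ a, ‖ξ a‖ₑ ^ p ∂μ ≤ ENNReal.ofReal (1 + C) := by
  calc ∫⁻ a, ‖ξ a‖ₑ ^ p ∂μ ≤ ∫⁻ a, 1 + ‖ξ a‖ₑ ^ r ∂μ := by
        refine lintegral_mono fun a => ?_
        rcases le_total ‖ξ a‖ₑ 1 with h1 | h1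
        · exact (ENNReal.rpow_le_one h1 hp).trans le_self_add
        · exact (ENNReal.rpow_le_rpow_of_exponent_le h1 hpr).trans le_add_self
    _ ≤ ENNReal.ofReal (1 + C) := by
        rw [lintegral_add_left measurable_const, ENNReal.ofReal_add zero_le_one hC]
        simpa using h

theorem integrable_norm_rpow_of_lintegral {α F : Type*} [MeasurableSpace α] {μ : Measure α}
    [NormedAddCommGroup F] [MeasurableSpace F] [OpensMeasurableSpace F] {ξ : α → F}
    (hξ : AEMeasurable ξ μ) {p C : ℝ} (hC : 0 ≤ C) (hp : 0 ≤ p)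
    (h : ∫⁻ a, ‖ξ a‖ₑ ^ p ∂μ ≤ ENNReal.ofReal C) :
    Integrable (fun a => ‖ξ a‖ ^ p) μ ∧ ∫ a, ‖ξ a‖ ^ p ∂μ ≤ C := by
  have hm : AEMeasurable (fun a => ‖ξ a‖ ^ p) μ :=
    (measurable_norm.comp_aemeasurable hξ).pow_const p
  have he : ∫⁻ a, ENNReal.ofReal (‖ξ a‖ ^ p) ∂μ = ∫⁻ a, ‖ξ a‖ₑ ^ p ∂μ := by
    refine lintegral_congr fun a => ?_
    rw [← ofReal_norm, ENNReal.ofReal_rpow_of_nonneg (norm_nonneg _) hp]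
  constructor
  · refine ⟨hm.aestronglyMeasurable, ?_⟩
    rw [hasFiniteIntegral_iff_ofReal (Eventually.of_forall fun a => by positivity), he]
    exact h.trans_lt ENNReal.ofReal_lt_top
  · rw [integral_eq_lintegral_of_nonneg_ae (Eventually.of_forall fun a => by positivity)
      hm.aestronglyMeasurable, he]
    exact ENNReal.toReal_le_of_le_ofReal hC h

theorem abs_apply_le_norm (x : E d) (j : Fin d) : |x j| ≤ ‖x‖ := PiLp.norm_apply_le x j

section Psi

variable {c₂ η : ℝ} (hP : P ∈ P₀ d 𝒵) (hc₂ : 0 < c₂) (hη : 0 < η)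
  (hψ : ∫⁻ w, ‖psi P w‖ₑ ^ (2 + η) ∂(P : Measure (Obs d 𝒵)) ≤ ENNReal.ofReal c₂)

include hP in
theorem aemeasurable_psi : AEMeasurable (psi P) (P : Measure (Obs d 𝒵)) :=
  (aemeasurable_drTerm hP).sub aemeasurable_const

include hP hc₂ hη hψ

theorem memLp_psi : MemLp (psi P) 2 (P : Measure (Obs d 𝒵)) := by
  refine ⟨(aemeasurable_psi hP).aestronglyMeasurable, ?_⟩
  rw [eLpNorm_lt_top_iff_lintegral_rpow_enorm_lt_top (by norm_num) (by norm_num)]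
  exact (lintegral_rpow_le_of_le hc₂.le (by norm_num) (by simpa using hη.le) hψ).trans_lt
    ENNReal.ofReal_lt_top

theorem memLp_psi_apply (j : Fin d) : MemLp (fun w => psi P w j) 2 (P : Measure (Obs d 𝒵)) :=
  (memLp_psi hP hc₂ hη hψ).mono (aemeasurable_coord (aemeasurable_psi hP) j).aestronglyMeasurable
    (Eventually.of_forall fun _ => abs_apply_le_norm _ j)

theorem integral_norm_psi_sq_le :
    Integrable (fun w => ‖psi P w‖ ^ 2) (P : Measure (Obs d 𝒵)) ∧
      ∫ w, ‖psi P w‖ ^ 2 ∂(P : Measure (Obs d 𝒵)) ≤ 1 + c₂ := by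
  have := integrable_norm_rpow_of_lintegral (aemeasurable_psi hP) (by positivity)
    (by norm_num : (0 : ℝ) ≤ 2)
    (lintegral_rpow_le_of_le hc₂.le (by norm_num) (by linarith : (2 : ℝ) ≤ 2 + η) hψ)
  simpa using this

/-- The residual term has mean zero given (X, Z), so the doubly robust term has mean E ∇f_P.
Integrability of ∇f_P, without which `theta` would not be this mean, is deduced from that of ψ_P
through `integrable_and_integral_of_add_residual`. -/
theorem integral_psi_apply_eq_zero (j : Fin d) :
    ∫ w, psi P w j ∂(P : Measure (Obs d 𝒵)) = 0 := by
  have hmp := measurePreserving_lawXZ P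
  have hg := aemeasurable_gradX_regFun hP
  have hkey : ∀ j : Fin d, Integrable (fun q : E d × 𝒵 => gradX (regFun P) q.1 q.2 j) (lawXZ P) ∧
      ∫ w, drTerm (regFun P) (score P) w j ∂(P : Measure (Obs d 𝒵))
        = ∫ q, gradX (regFun P) q.1 q.2 j ∂(lawXZ P) ∧
      Integrable (fun w => drTerm (regFun P) (score P) w j) (P : Measure (Obs d 𝒵)) := by
    intro j
    have e : ∀ w : Obs d 𝒵, drTerm (regFun P) (score P) w j = gradX (regFun P) w.2.1 w.2.2 j
        + (-score P w.2.1 w.2.2 j) * (w.1 - regFun P w.2.1 w.2.2) := fun w => by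
      simp only [drTerm, PiLp.sub_apply, PiLp.smul_apply, smul_eq_mul]; ring
    have hi : Integrable (fun w => drTerm (regFun P) (score P) w j) (P : Measure (Obs d 𝒵)) := by
      have := ((memLp_psi_apply hP hc₂ hη hψ j).integrable (by norm_num)).add
        (integrable_const (theta P j))
      refine this.congr (Eventually.of_forall fun w => ?_)
      simp [psi]
    have h := integrable_and_integral_of_add_residual hP
      (a := fun q => gradX (regFun P) q.1 q.2 j) (b := fun q => -score P q.1 q.2 j)
      (aemeasurable_coord hg j) (aemeasurable_coord (aemeasurable_score hP) j).neg
      (hi.congr (Eventually.of_forall e))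
    exact ⟨h.1, (integral_congr_ae (Eventually.of_forall e)).trans h.2, hi⟩
  have hθ : theta P j = ∫ q, gradX (regFun P) q.1 q.2 j ∂(lawXZ P) := by
    rw [theta, eval_integral_piLp fun i => (hmp.integrable_comp
      (aemeasurable_coord hg i).aestronglyMeasurable).2 (hkey i).1, ← hmp.map_eq,
      integral_map hmp.measurable.aemeasurable
        (by rw [hmp.map_eq]; exact (hkey j).1.aestronglyMeasurable)]
  simp only [psi, PiLp.sub_apply]
  rw [integral_sub (hkey j).2.2 (integrable_const _), (hkey j).2.1, hθ]
  simp

theorem integrable_psi_mul_psi (a b : Fin d) :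
    Integrable (fun w => psi P w a * psi P w b) (P : Measure (Obs d 𝒵)) :=
  (memLp_psi_apply hP hc₂ hη hψ a).integrable_mul (memLp_psi_apply hP hc₂ hη hψ b)

theorem abs_Sigma_le (a b : Fin d) : |Sigma P a b| ≤ 1 + c₂ := by
  obtain ⟨h1, h2⟩ := integral_norm_psi_sq_le hP hc₂ hη hψ
  have h3 : ‖∫ w, psi P w a * psi P w b ∂(P : Measure (Obs d 𝒵))‖
      ≤ ∫ w, ‖psi P w‖ ^ 2 ∂(P : Measure (Obs d 𝒵)) := by
    refine norm_integral_le_of_norm_le h1 (Eventually.of_forall fun w => ?_)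
    rw [norm_mul, sq]
    exact mul_le_mul (abs_apply_le_norm _ a) (abs_apply_le_norm _ b) (norm_nonneg _) (norm_nonneg _)
  exact h3.trans h2

omit hP hc₂ in
theorem lintegral_psi_mul_psi_rpow_le (a b : Fin d) :
    ∫⁻ w, ‖psi P w a * psi P w b‖ₑ ^ (1 + η / 2) ∂(P : Measure (Obs d 𝒵)) ≤ ENNReal.ofReal c₂ := by
  refine (lintegral_mono fun w => ?_).trans hψ
  have h : ∀ j, ‖psi P w j‖ₑ ≤ ‖psi P w‖ₑ := fun j =>
    enorm_le_iff_norm_le.2 (abs_apply_le_norm _ j)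
  calc ‖psi P w a * psi P w b‖ₑ ^ (1 + η / 2) ≤ (‖psi P w‖ₑ * ‖psi P w‖ₑ) ^ (1 + η / 2) := by
        rw [enorm_mul]
        exact ENNReal.rpow_le_rpow (mul_le_mul' (h a) (h b)) (by positivity)
    _ = ‖psi P w‖ₑ ^ (2 + η) := by
        rw [ENNReal.mul_rpow_of_nonneg _ _ (by positivity), ← ENNReal.rpow_add_of_nonneg _ _
          (by positivity) (by positivity)]
        congr 1; ring

theorem integral_dotProduct_psi (v : Fin d → ℝ) :
    ∫ w, v ⬝ᵥ (psi P w).ofLp ∂(P : Measure (Obs d 𝒵)) = 0 := by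
  simp only [dotProduct]
  rw [integral_finsetSum _ fun j _ =>
    ((memLp_psi_apply hP hc₂ hη hψ j).integrable (by norm_num)).const_mul _]
  simp [integral_const_mul, integral_psi_apply_eq_zero hP hc₂ hη hψ]

theorem integral_dotProduct_psi_sq (v : Fin d → ℝ) :
    ∫ w, (v ⬝ᵥ (psi P w).ofLp) ^ 2 ∂(P : Measure (Obs d 𝒵)) = v ⬝ᵥ (Sigma P).mulVec v := by
  have e : ∀ w, (v ⬝ᵥ (psi P w).ofLp) ^ 2
      = ∑ a, ∑ b, v a * v b * (psi P w a * psi P w b) := fun w => by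
    rw [sq, dotProduct, Finset.sum_mul_sum]
    exact Finset.sum_congr rfl fun a _ => Finset.sum_congr rfl fun b _ => by ring
  simp_rw [e]
  rw [integral_finsetSum _ fun a _ => integrable_finsetSum _ fun b _ =>
    (integrable_psi_mul_psi hP hc₂ hη hψ a b).const_mul _]
  simp only [dotProduct, Matrix.mulVec]
  refine Finset.sum_congr rfl fun a _ => ?_
  rw [integral_finsetSum _ fun b _ => (integrable_psi_mul_psi hP hc₂ hη hψ a b).const_mul _,
    Finset.mul_sum]
  refine Finset.sum_congr rfl fun b _ => ?_
  rw [integral_const_mul]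
  simp only [Sigma, Matrix.of_apply]
  ring

end Psi

/-! ### The standardized influence function and its central limit theorem -/

theorem isHermitian_Sigma (P : ProbabilityMeasure (Obs d 𝒵)) : (Sigma P).IsHermitian := by
  ext a b
  simp [Sigma, mul_comm]

theorem transpose_invSqrt (A : Matrix (Fin d) (Fin d) ℝ) : (invSqrt A).transpose = invSqrt A := by
  have := isSelfAdjoint_invSqrt A
  rwa [IsSelfAdjoint, Matrix.star_eq_conjTranspose, Matrix.conjTranspose_eq_transpose_of_trivial]
    at this

/-- Applied to a basis vector, the bound |A^{-1/2} v|² ≤ |v|²/c controls each column. -/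
theorem abs_invSqrt_apply_le {A : Matrix (Fin d) (Fin d) ℝ} {c : ℝ} (hA : A.IsHermitian)
    (hc : 0 < c)
    (hs : ∀ s ∈ spectrum ℝ A, c ≤ s) (i j : Fin d) : |invSqrt A i j| ≤ (√c)⁻¹ := by
  have h := dotProduct_invSqrt_mulVec_self_le hA hc hs (Pi.single j 1)
  rw [Matrix.mulVec_single_one, single_dotProduct, one_mul, Pi.single_eq_same] at h
  have h1 : (invSqrt A i j) ^ 2 ≤ (invSqrt A).col j ⬝ᵥ (invSqrt A).col j := by
    rw [sq]
    exact Finset.single_le_sum (f := fun i => (invSqrt A).col j i * (invSqrt A).col j i)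
      (fun i _ => mul_self_nonneg _) (Finset.mem_univ i)
  rw [← Real.sqrt_inv]
  apply Real.abs_le_sqrt
  rw [← one_div, le_div_iff₀ hc]
  nlinarith

/-- The standardized influence function `Σ_P^{-1/2} ψ_P`. -/
noncomputable def stdPsi (P : ProbabilityMeasure (Obs d 𝒵)) (w : Obs d 𝒵) : E d :=
  WithLp.toLp 2 ((invSqrt (Sigma P)).mulVec (psi P w).ofLp)

theorem inner_stdPsi (w : Obs d 𝒵) (u : E d) :
    inner ℝ (stdPsi P w) u = ((invSqrt (Sigma P)).mulVec u.ofLp) ⬝ᵥ (psi P w).ofLp := by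
  rw [EuclideanSpace.inner_eq_star_dotProduct, star_trivial, stdPsi, Matrix.dotProduct_mulVec,
    ← Matrix.mulVec_transpose, transpose_invSqrt]

theorem norm_stdPsi_le {c₁ : ℝ} (hc₁ : 0 < c₁) (hs : ∀ s ∈ spectrum ℝ (Sigma P), c₁ ≤ s)
    (w : Obs d 𝒵) : ‖stdPsi P w‖ ≤ (√c₁)⁻¹ * ‖psi P w‖ := by
  have h := dotProduct_invSqrt_mulVec_self_le (isHermitian_Sigma P) hc₁ hs (psi P w).ofLp
  have e : ∀ x : E d, x.ofLp ⬝ᵥ x.ofLp = ‖x‖ ^ 2 := fun x => by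
    rw [EuclideanSpace.real_norm_sq_eq]; simp [dotProduct, sq]
  have h1 : c₁ * ‖stdPsi P w‖ ^ 2 ≤ ‖psi P w‖ ^ 2 := by
    rw [← e, ← e]; exact h
  refine (sq_le_sq₀ (norm_nonneg _) (by positivity)).1 ?_
  rw [mul_pow, inv_pow, Real.sq_sqrt hc₁.le, inv_mul_eq_div, le_div_iff₀ hc₁]
  linarith

/-- Standardization makes every covariance the identity, and the lower bound on the eigenvalues
keeps the moments of Σ^{-1/2}ψ bounded, so the triangular-array theorem applies. -/
theorem eventually_abs_sampleLaw_stdPsi_sub_Phi_le {K : ℕ} [NeZero K]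
    {Ps : ℕ → ProbabilityMeasure (Obs d 𝒵)} (hP : ∀ m, Ps m ∈ P₀ d 𝒵) {c₁ c₂ η : ℝ} (hc₁ : 0 < c₁)
    (hc₂ : 0 < c₂) (hη : 0 < η) (hs : ∀ m, ∀ s ∈ spectrum ℝ (Sigma (Ps m)), c₁ ≤ s)
    (hψ : ∀ m, ∫⁻ w, ‖psi (Ps m) w‖ₑ ^ (2 + η) ∂(Ps m : Measure (Obs d 𝒵)) ≤ ENNReal.ofReal c₂)
    {r : ℝ} (hr : 0 < r) :
    ∀ᶠ m in atTop, ∀ t : Fin d → ℝ, |(sampleLaw (Ps m) (K * m)).real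
      {D | ∀ j, ((√((K * m : ℕ) : ℝ))⁻¹ • ∑ i, stdPsi (Ps m) (D i)) j ≤ t j} - Phi t| ≤ r := by
  have hm : ∀ m, AEMeasurable (stdPsi (Ps m)) (Ps m : Measure (Obs d 𝒵)) := fun m =>
    ((by fun_prop : Measurable fun x : E d =>
      (WithLp.toLp 2 ((invSqrt (Sigma (Ps m))).mulVec x.ofLp) : E d))).comp_aemeasurable
      (aemeasurable_psi (hP m))
  -- The exponent is capped at 3, as the Taylor estimate requires.
  set p : ℝ := 2 + min η 1 with hp
  have hp2 : 2 < p := by simp [hp, hη]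
  have hp3 : p ≤ 3 := by have := min_le_right η 1; linarith
  have hpη : p ≤ 2 + η := by have := min_le_left η 1; linarith
  have hpow : ∀ m w, ‖stdPsi (Ps m) w‖ ^ p ≤ (√c₁)⁻¹ ^ p * ‖psi (Ps m) w‖ ^ p := fun m w => by
    rw [← Real.mul_rpow (by positivity) (norm_nonneg _)]
    exact Real.rpow_le_rpow (norm_nonneg _) (norm_stdPsi_le hc₁ (hs m) w) (by linarith)
  have hψp : ∀ m, Integrable (fun w => ‖psi (Ps m) w‖ ^ p) (Ps m : Measure (Obs d 𝒵)) ∧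
      ∫ w, ‖psi (Ps m) w‖ ^ p ∂(Ps m : Measure (Obs d 𝒵)) ≤ 1 + c₂ := fun m =>
    integrable_norm_rpow_of_lintegral (aemeasurable_psi (hP m)) (by positivity) (by linarith)
      (lintegral_rpow_le_of_le hc₂.le (by linarith) hpη (hψ m))
  have hip : ∀ m, Integrable (fun w => ‖stdPsi (Ps m) w‖ ^ p) (Ps m : Measure (Obs d 𝒵)) := fun m =>
    ((hψp m).1.const_mul ((√c₁)⁻¹ ^ p)).mono'
      ((measurable_norm.comp_aemeasurable (hm m)).pow_const p).aestronglyMeasurable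
      (Eventually.of_forall fun w => by
        rw [Real.norm_of_nonneg (by positivity)]; exact hpow m w)
  have hS : ∀ m, AEMeasurable (fun D : Fin (K * m) → Obs d 𝒵 =>
      (√((K * m : ℕ) : ℝ))⁻¹ • ∑ i, stdPsi (Ps m) (D i)) (sampleLaw (Ps m) (K * m)) := fun m =>
    (measurable_const_smul ((√((K * m : ℕ) : ℝ))⁻¹)).comp_aemeasurable
      (aemeasurable_pi_sum (hm m) (K * m))
  have hN : Tendsto (fun m => K * m) atTop atTop :=
    tendsto_id.const_mul_atTop' (Nat.pos_of_ne_zero (NeZero.ne K))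
  have key := tendsto_map_sum_stdGaussian (fun m => (Ps m : Measure (Obs d 𝒵)))
    (fun m => stdPsi (Ps m)) hm (fun m => K * m) hN hp2 hp3
    (fun m => (MemLp.of_le_mul (memLp_psi (hP m) hc₂ hη (hψ m)) (hm m).aestronglyMeasurable
      (Eventually.of_forall fun w => norm_stdPsi_le hc₁ (hs m) w))) hip
    (C := (√c₁)⁻¹ ^ p * (1 + c₂)) (fun m => by
      refine (integral_mono (hip m) ((hψp m).1.const_mul _) (hpow m)).trans ?_
      rw [integral_const_mul]
      exact mul_le_mul_of_nonneg_left (hψp m).2 (by positivity))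
    (fun m u => by
      simp_rw [inner_stdPsi]; exact integral_dotProduct_psi (hP m) hc₂ hη (hψ m) _)
    (fun m u => by
      simp_rw [inner_stdPsi]
      rw [integral_dotProduct_psi_sq (hP m) hc₂ hη (hψ m),
        dotProduct_invSqrt_mulVec (isHermitian_Sigma _) hc₁ (hs m), EuclideanSpace.real_norm_sq_eq]
      simp [dotProduct, sq])
    (M := fun m => ⟨_, Measure.isProbabilityMeasure_map (hS m)⟩)
    (G := ⟨stdGaussian (E d), inferInstance⟩) (fun m => rfl) rfl
  filter_upwards [eventually_abs_orthant_sub_Phi_le rfl key hr] with m hmr t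
  refine le_trans (le_of_eq ?_) (hmr t)
  congr 2
  change _ = (Measure.map _ (sampleLaw (Ps m) (K * m))).real _
  rw [map_measureReal_apply_of_aemeasurable (hS m) (measurableSet_orthant t)]
  rfl

end APE

namespace APE

/-! ### Limits in `[0, ∞]` -/

theorem tendsto_zero_of_eventually_le_ofReal {α : Type*} {l : Filter α} {f : α → ℝ≥0∞}
    (h : ∀ τ : ℝ, 0 < τ → ∀ᶠ m in l, f m ≤ ENNReal.ofReal τ) : Tendsto f l (𝓝 0) := by
  refine ENNReal.tendsto_nhds_zero.2 fun τ hτ => ?_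
  obtain ⟨s, hs, hsτ⟩ := ENNReal.lt_iff_exists_nnreal_btwn.1 hτ
  filter_upwards [h s (by exact_mod_cast hs)] with m hm
  exact hm.trans (by rw [ENNReal.ofReal_coe_nnreal]; exact hsτ.le)

theorem eventually_le_ofReal_of_tendsto_zero {α : Type*} {l : Filter α} {f : α → ℝ≥0∞}
    (h : Tendsto f l (𝓝 0)) {τ : ℝ} (hτ : 0 < τ) : ∀ᶠ m in l, f m ≤ ENNReal.ofReal τ :=
  ENNReal.tendsto_nhds_zero.1 h _ (by simpa using hτ)

theorem tendsto_zero_of_le {α : Type*} {l : Filter α} {f g : α → ℝ≥0∞} (hg : Tendsto g l (𝓝 0))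
    (h : ∀ᶠ m in l, f m ≤ g m) : Tendsto f l (𝓝 0) :=
  tendsto_of_tendsto_of_tendsto_of_le_of_le' tendsto_const_nhds hg
    (Eventually.of_forall fun _ => zero_le) h

theorem tendsto_measure_exists {Ω : ℕ → Type*} [∀ m, MeasurableSpace (Ω m)]
    {μ : ∀ m, Measure (Ω m)} {ι : Type*} [Fintype ι] {p : ∀ m, ι → Ω m → Prop}
    (h : ∀ i, Tendsto (fun m => μ m {ω | p m i ω}) atTop (𝓝 0)) :
    Tendsto (fun m => μ m {ω | ∃ i, p m i ω}) atTop (𝓝 0) := by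
  have h1 := tendsto_finsetSum Finset.univ fun i _ => h i
  simp only [Finset.sum_const_zero] at h1
  refine tendsto_zero_of_le h1 (Eventually.of_forall fun m => ?_)
  refine (measure_mono fun ω hω => ?_).trans (measure_iUnion_fintype_le (μ m)
      fun i => {ω | p m i ω})
  simpa using hω

theorem tendsto_measure_or {Ω : ℕ → Type*} [∀ m, MeasurableSpace (Ω m)]
    {μ : ∀ m, Measure (Ω m)} {p q : ∀ m, Ω m → Prop}
    (hp : Tendsto (fun m => μ m {ω | p m ω}) atTop (𝓝 0))
    (hq : Tendsto (fun m => μ m {ω | q m ω}) atTop (𝓝 0)) :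
    Tendsto (fun m => μ m {ω | p m ω ∨ q m ω}) atTop (𝓝 0) := by
  have h := hp.add hq
  rw [add_zero] at h
  exact tendsto_zero_of_le h (Eventually.of_forall fun m => measure_union_le _ _)

/-! ### Perturbed second moments -/

theorem abs_sum_mul_le {n : ℕ} {x y : Fin n → ℝ} {a b : ℝ} (ha : 0 ≤ a) (hb : 0 ≤ b)
    (hx : ∑ i, x i ^ 2 ≤ a ^ 2 * n) (hy : ∑ i, y i ^ 2 ≤ b ^ 2 * n) :
    |∑ i, x i * y i| ≤ a * b * n := by
  refine abs_le_of_sq_le_sq ?_ (by positivity)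
  calc (∑ i, x i * y i) ^ 2 ≤ (∑ i, x i ^ 2) * ∑ i, y i ^ 2 := Finset.sum_mul_sq_le_sq_mul_sq _ _ _
    _ ≤ (a ^ 2 * n) * (b ^ 2 * n) :=
      mul_le_mul hx hy (Finset.sum_nonneg fun i _ => sq_nonneg _) (by positivity)
    _ = (a * b * n) ^ 2 := by ring

theorem average_mul_sub_average {n : ℕ} (hn : 0 < n) (u v : Fin n → ℝ) :
    (n : ℝ)⁻¹ * ∑ i, (u i - (n : ℝ)⁻¹ * ∑ i, u i) * (v i - (n : ℝ)⁻¹ * ∑ i, v i)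
      = (n : ℝ)⁻¹ * ∑ i, u i * v i - ((n : ℝ)⁻¹ * ∑ i, u i) * ((n : ℝ)⁻¹ * ∑ i, v i) := by
  have hn' : (n : ℝ) ≠ 0 := by positivity
  obtain ⟨s, hs⟩ : ∃ s, s = (n : ℝ)⁻¹ * ∑ i, u i := ⟨_, rfl⟩
  obtain ⟨t, ht⟩ : ∃ t, t = (n : ℝ)⁻¹ * ∑ i, v i := ⟨_, rfl⟩
  have hs' : ∑ i, u i = n * s := by rw [hs]; field_simp
  have ht' : ∑ i, v i = n * t := by rw [ht]; field_simp
  rw [← hs, ← ht]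
  have e : ∀ i, (u i - s) * (v i - t) = u i * v i - t * u i - s * v i + s * t := fun i => by ring
  simp_rw [e, Finset.sum_add_distrib, Finset.sum_sub_distrib, ← Finset.mul_sum, hs', ht']
  simp only [Finset.sum_const, Finset.card_univ, Fintype.card_fin, nsmul_eq_mul]
  field_simp
  ring

/-- In the application x and y are coordinates of ψ_P at the data, and e and f the estimation
errors. By Cauchy–Schwarz the mixed terms cost (C + 1)ε each and the error term ε². The product of
the means costs 4ε² and the average of x y costs ε, which totals at most (8 + 2C)ε since ε ≤ 1. -/
theorem abs_covariance_sub_le {n : ℕ} (hn : 0 < n) {x y e f : Fin n → ℝ} {S C ε : ℝ} (hC : 0 ≤ C)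
    (hε : 0 < ε) (hε1 : ε ≤ 1) (hxy : |(n : ℝ)⁻¹ * ∑ i, x i * y i - S| ≤ ε)
    (hx : ∑ i, x i ^ 2 ≤ (C + 1) * n) (hy : ∑ i, y i ^ 2 ≤ (C + 1) * n)
    (he : ∑ i, e i ^ 2 ≤ ε ^ 2 * n) (hf : ∑ i, f i ^ 2 ≤ ε ^ 2 * n)
    (hx1 : |(n : ℝ)⁻¹ * ∑ i, x i| ≤ ε) (hy1 : |(n : ℝ)⁻¹ * ∑ i, y i| ≤ ε)
    (he1 : |∑ i, e i| ≤ ε * n) (hf1 : |∑ i, f i| ≤ ε * n) :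
    |(n : ℝ)⁻¹ * ∑ i, (x i + e i - (n : ℝ)⁻¹ * ∑ i, (x i + e i))
        * (y i + f i - (n : ℝ)⁻¹ * ∑ i, (y i + f i)) - S| ≤ (8 + 2 * C) * ε := by
  have hn' : (0 : ℝ) < n := by positivity
  -- Puts the second-moment bounds in the form a² n used for Cauchy–Schwarz, avoiding square roots.
  have hC1 : C + 1 ≤ (C + 1) ^ 2 := by nlinarith
  have hxx : ∑ i, x i ^ 2 ≤ (C + 1) ^ 2 * n := hx.trans (by gcongr)
  have hyy : ∑ i, y i ^ 2 ≤ (C + 1) ^ 2 * n := hy.trans (by gcongr)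
  have h1 := abs_sum_mul_le (by positivity) hε.le hxx hf
  have h2 := abs_sum_mul_le hε.le (by positivity) he hyy
  have h3 := abs_sum_mul_le hε.le hε.le he hf
  have hbar : ∀ {a b : Fin n → ℝ}, |(n : ℝ)⁻¹ * ∑ i, a i| ≤ ε → |∑ i, b i| ≤ ε * n →
      |(n : ℝ)⁻¹ * ∑ i, (a i + b i)| ≤ 2 * ε := fun {a b} ha hb => by
    rw [Finset.sum_add_distrib, mul_add]
    refine (abs_add_le _ _).trans ?_
    have : |(n : ℝ)⁻¹ * ∑ i, b i| ≤ ε := by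
      rw [abs_mul, abs_of_pos (by positivity), inv_mul_le_iff₀ hn']; linarith
    linarith
  have h4 : |((n : ℝ)⁻¹ * ∑ i, (x i + e i)) * ((n : ℝ)⁻¹ * ∑ i, (y i + f i))|
      ≤ (2 * ε) * (2 * ε) := by
    rw [abs_mul]
    exact mul_le_mul (hbar hx1 he1) (hbar hy1 hf1) (abs_nonneg _) (by positivity)
  have hdiv : ∀ {s b : ℝ}, |s| ≤ b * n → |(n : ℝ)⁻¹ * s| ≤ b := fun {s b} h => by
    rw [abs_mul, abs_of_pos (by positivity), inv_mul_le_iff₀ hn']; linarith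
  rw [average_mul_sub_average hn (fun i => x i + e i) fun i => y i + f i]
  have e1 : ∑ i, (x i + e i) * (y i + f i)
      = ∑ i, x i * y i + ∑ i, x i * f i + ∑ i, e i * y i + ∑ i, e i * f i := by
    simp_rw [← Finset.sum_add_distrib]
    exact Finset.sum_congr rfl fun i _ => by ring
  rw [e1, mul_add, mul_add, mul_add]
  have h1' := abs_le.1 (hdiv h1)
  have h2' := abs_le.1 (hdiv h2)
  have h3' := abs_le.1 (hdiv h3)
  have h4' := abs_le.1 h4
  have h5' := abs_le.1 hxy
  have hεε : ε * ε ≤ ε := by nlinarith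
  rw [abs_le]
  constructor <;> nlinarith

/-! ### The estimators in terms of the influence function -/

section Pointwise

variable {d : ℕ} {𝒵 : Type*} [MeasurableSpace 𝒵] {K m : ℕ} (I : Folds K m)
  (fhat : (Fin ((K - 1) * m) → Obs d 𝒵) → E d → 𝒵 → ℝ)
  (ρhat : (Fin ((K - 1) * m) → Obs d 𝒵) → E d → 𝒵 → E d) (P : ProbabilityMeasure (Obs d 𝒵))

/-- The error of the cross-fitted summand at the `i`-th observation. -/
noncomputable def crossFitError (D : Fin (K * m) → Obs d 𝒵) (j : Fin d) (i : Fin (K * m)) : ℝ :=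
  drError P (fhat (I.train (I.label i) D)) (ρhat (I.train (I.label i) D)) j (D i)

theorem drTerm_crossFit_apply (D : Fin (K * m) → Obs d 𝒵) (j : Fin d) (i : Fin (K * m)) :
    drTerm (fhat (I.train (I.label i) D)) (ρhat (I.train (I.label i) D)) (D i) j
      = theta P j + (psi P (D i) j + crossFitError I fhat ρhat P D j i) := by
  simp only [crossFitError, drError, psi, PiLp.sub_apply]
  ring

theorem thetaHat_sub_theta_apply (hn : 0 < K * m) (D : Fin (K * m) → Obs d 𝒵) (j : Fin d) :
    (thetaHat I fhat ρhat D - theta P) j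
      = ((K * m : ℕ) : ℝ)⁻¹ * ∑ i, (psi P (D i) j + crossFitError I fhat ρhat P D j i) := by
  have hn' : ((K * m : ℕ) : ℝ) ≠ 0 := by positivity
  rw [thetaHat, I.sum_sum_fold fun k i =>
    drTerm (fhat (I.train k D)) (ρhat (I.train k D)) (D i)]
  simp only [PiLp.sub_apply, PiLp.smul_apply, WithLp.ofLp_sum, Finset.sum_apply, smul_eq_mul]
  simp_rw [drTerm_crossFit_apply I fhat ρhat P D j]
  rw [Finset.sum_add_distrib]
  simp only [Finset.sum_const, Finset.card_univ, Fintype.card_fin, nsmul_eq_mul, one_div]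
  rw [mul_add, inv_mul_cancel_left₀ hn']
  ring

/-- Centring at θ̂ removes θ_P, which leaves the empirical covariance of ψ_P plus the cross-fitting
error. -/
theorem SigmaHat_apply (hn : 0 < K * m) (D : Fin (K * m) → Obs d 𝒵) (a b : Fin d) :
    SigmaHat I fhat ρhat D a b = ((K * m : ℕ) : ℝ)⁻¹ * ∑ i,
      (psi P (D i) a + crossFitError I fhat ρhat P D a i - ((K * m : ℕ) : ℝ)⁻¹ * ∑ i,
        (psi P (D i) a + crossFitError I fhat ρhat P D a i)) *
      (psi P (D i) b + crossFitError I fhat ρhat P D b i - ((K * m : ℕ) : ℝ)⁻¹ * ∑ i,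
        (psi P (D i) b + crossFitError I fhat ρhat P D b i)) := by
  simp only [SigmaHat, Matrix.of_apply, one_div]
  rw [I.sum_sum_fold fun k i =>
    psiHat I fhat ρhat D k (D i) a * psiHat I fhat ρhat D k (D i) b]
  congr 1
  refine Finset.sum_congr rfl fun i _ => ?_
  have h : ∀ j, psiHat I fhat ρhat D (I.label i) (D i) j
      = psi P (D i) j + crossFitError I fhat ρhat P D j i - ((K * m : ℕ) : ℝ)⁻¹ * ∑ i,
        (psi P (D i) j + crossFitError I fhat ρhat P D j i) := fun j => by
    rw [← thetaHat_sub_theta_apply I fhat ρhat P hn D j, psiHat, PiLp.sub_apply, PiLp.sub_apply,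
      drTerm_crossFit_apply I fhat ρhat P D j i]
    ring
  rw [h, h]

omit [MeasurableSpace 𝒵] in
theorem isHermitian_SigmaHat (D : Fin (K * m) → Obs d 𝒵) :
    (SigmaHat I fhat ρhat D).IsHermitian := by
  ext a b
  simp [SigmaHat, mul_comm]

theorem stdPsi_average_apply (D : Fin (K * m) → Obs d 𝒵) (i : Fin d) :
    ((√((K * m : ℕ) : ℝ))⁻¹ • ∑ l, stdPsi P (D l)) i
      = ∑ j, invSqrt (Sigma P) i j * ((√((K * m : ℕ) : ℝ))⁻¹ * ∑ l, psi P (D l) j) := by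
  simp only [PiLp.smul_apply, WithLp.ofLp_sum, Finset.sum_apply, smul_eq_mul, stdPsi,
    Matrix.mulVec, dotProduct]
  rw [Finset.sum_comm, Finset.mul_sum]
  refine Finset.sum_congr rfl fun j _ => ?_
  rw [← Finset.mul_sum]
  ring

theorem standardize_thetaHat_apply (hn : 0 < K * m) (B : Matrix (Fin d) (Fin d) ℝ)
    (D : Fin (K * m) → Obs d 𝒵) (i : Fin d) :
    standardize (K * m) B (thetaHat I fhat ρhat D - theta P) i
      = ∑ j, invSqrt B i j * ((√((K * m : ℕ) : ℝ))⁻¹ *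
        ∑ l, (psi P (D l) j + crossFitError I fhat ρhat P D j l)) := by
  have hn' : (0 : ℝ) < ((K * m : ℕ) : ℝ) := by positivity
  have hs : √((K * m : ℕ) : ℝ) * ((K * m : ℕ) : ℝ)⁻¹ = (√((K * m : ℕ) : ℝ))⁻¹ := by
    rw [← div_eq_mul_inv, Real.sqrt_div_self]
  simp only [standardize, Pi.smul_apply, smul_eq_mul, Matrix.mulVec, dotProduct]
  rw [Finset.mul_sum]
  refine Finset.sum_congr rfl fun j _ => ?_
  rw [thetaHat_sub_theta_apply I fhat ρhat P hn D j, ← hs]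
  ring

/-- With p and q the normalized sums of ψ_P and of the errors, B^{-1/2}(p + q) − Σ^{-1/2} p =
(B^{-1/2} − Σ^{-1/2})(p + q) + Σ^{-1/2} q. The bound L on p is the tightness needed to control the
first term. -/
theorem abs_standardize_sub_le (hn : 0 < K * m) {B : Matrix (Fin d) (Fin d) ℝ} {c κ L ε : ℝ}
    (D : Fin (K * m) → Obs d 𝒵)
    (hc : ∀ i j, |invSqrt (Sigma P) i j| ≤ c)
        (hB : ∀ i j, |invSqrt B i j - invSqrt (Sigma P) i j| ≤ κ)
    (hψ : ∀ j, |∑ l, psi P (D l) j| ≤ L * √((K * m : ℕ) : ℝ))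
    (he : ∀ j, |∑ l, crossFitError I fhat ρhat P D j l| ≤ ε * √((K * m : ℕ) : ℝ)) (i : Fin d) :
    |standardize (K * m) B (thetaHat I fhat ρhat D - theta P) i
      - ((√((K * m : ℕ) : ℝ))⁻¹ • ∑ l, stdPsi P (D l)) i| ≤ d * (κ * (L + ε) + c * ε) := by
  have hn' : (0 : ℝ) < √((K * m : ℕ) : ℝ) := Real.sqrt_pos.2 (by positivity)
  rw [standardize_thetaHat_apply I fhat ρhat P hn B D i, stdPsi_average_apply,
    ← Finset.sum_sub_distrib]
  refine (Finset.abs_sum_le_sum_abs _ _).trans ((Finset.sum_le_sum fun j _ =>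
    (?_ : _ ≤ κ * (L + ε) + c * ε)).trans (by simp [mul_add]))
  have hdiv : ∀ {s b : ℝ}, |s| ≤ b * √((K * m : ℕ) : ℝ) → |(√((K * m : ℕ) : ℝ))⁻¹ * s| ≤ b :=
    fun {s b} h => by
      rw [abs_mul, abs_of_pos (by positivity), inv_mul_le_iff₀ hn']; linarith
  rw [Finset.sum_add_distrib, mul_add]
  have h1 := hdiv (hψ j)
  have h2 := hdiv (he j)
  generalize (√((K * m : ℕ) : ℝ))⁻¹ * ∑ l, psi P (D l) j = p at *
  generalize (√((K * m : ℕ) : ℝ))⁻¹ * ∑ l, crossFitError I fhat ρhat P D j l = q at *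
  have e : invSqrt B i j * (p + q) - invSqrt (Sigma P) i j * p
      = (invSqrt B i j - invSqrt (Sigma P) i j) * (p + q) + invSqrt (Sigma P) i j * q := by ring
  rw [e]
  refine (abs_add_le _ _).trans (add_le_add ?_ ?_)
  · rw [abs_mul]
    exact mul_le_mul (hB i j) ((abs_add_le _ _).trans (add_le_add h1 h2)) (abs_nonneg _)
      ((abs_nonneg _).trans (hB i j))
  · rw [abs_mul]
    exact mul_le_mul (hc i j) h2 (abs_nonneg _) ((abs_nonneg _).trans (hc i j))

end Pointwise

end APE

namespace APE

/-! ### Convergence along a sequence of laws -/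

variable {d : ℕ} {𝒵 : Type*} [MeasurableSpace 𝒵] {K : ℕ} {𝒬 : Set (ProbabilityMeasure (Obs d 𝒵))}
  {Ps : ℕ → ProbabilityMeasure (Obs d 𝒵)}

theorem IsLittleOP.tendsto_seq
    {W : ProbabilityMeasure (Obs d 𝒵) → (m : ℕ) → (Fin (K * m) → Obs d 𝒵) → ℝ≥0∞}
    (h : IsLittleOP 𝒬 W) (hP : ∀ m, Ps m ∈ 𝒬) {δ : ℝ} (hδ : 0 < δ) :
    Tendsto (fun m => sampleLaw (Ps m) (K * m) {D | ENNReal.ofReal δ < W (Ps m) m D}) atTop (𝓝 0) :=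
  tendsto_of_tendsto_iSup_zero
    (G := fun P m => sampleLaw P (K * m) {D | ENNReal.ofReal δ < W P m D})
    (h δ.toNNReal (by simpa using hδ)) hP

/-- Exceeding any finite level M contains the event of being infinite, and the probability of
exceeding M can be made smaller than any τ. -/
theorem IsBigOP.tendsto_seq_eq_top
    {W : ProbabilityMeasure (Obs d 𝒵) → (m : ℕ) → (Fin (K * m) → Obs d 𝒵) → ℝ≥0∞}
    (h : IsBigOP 𝒬 W) (hP : ∀ m, Ps m ∈ 𝒬) :
    Tendsto (fun m => sampleLaw (Ps m) (K * m) {D | W (Ps m) m D = ∞}) atTop (𝓝 0) := by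
  refine tendsto_zero_of_eventually_le_ofReal fun τ hτ => ?_
  obtain ⟨M, -, N, hN⟩ := h τ.toNNReal (by simpa using hτ)
  filter_upwards [eventually_ge_atTop N] with m hm
  refine le_trans ?_ hN.le
  refine le_trans (measure_mono fun D (hD : W (Ps m) m D = ∞) => ?_)
    ((le_iSup₂_of_le (f := fun P _ => sampleLaw P (K * m) {D | M < W P m D}) (Ps m) (hP m)
      le_rfl).trans (le_iSup₂_of_le (f := fun m (_ : m ≥ N) =>
        ⨆ P ∈ 𝒬, sampleLaw P (K * m) {D | M < W P m D}) m hm le_rfl))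
  rw [Set.mem_ofPred_eq, hD]
  exact ENNReal.coe_lt_top

theorem tendsto_mul_left_atTop [NeZero K] : Tendsto (fun m => K * m) atTop atTop :=
  tendsto_id.const_mul_atTop' (NeZero.pos K)

section Sequence

variable [NeZero K] {I : (m : ℕ) → Folds K m}
  {fhat : (m : ℕ) → (Fin ((K - 1) * m) → Obs d 𝒵) → E d → 𝒵 → ℝ}
  {ρhat : (m : ℕ) → (Fin ((K - 1) * m) → Obs d 𝒵) → E d → 𝒵 → E d}

theorem tendsto_sampleLaw_not_nuisanceBound (hP : ∀ m, Ps m ∈ 𝒬)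
    (hAf : IsBigOP (K := K) 𝒬 fun P m D => errAf P (fhat m ((I m).train 0 D)))
    (hAfAρ : IsLittleOP (K := K) 𝒬 fun P m D => ((K * m : ℕ) : ℝ≥0∞) *
      (errAf P (fhat m ((I m).train 0 D)) * errAρ P (ρhat m ((I m).train 0 D))))
    (hEf : IsLittleOP (K := K) 𝒬 fun P m D => errEf P (fhat m ((I m).train 0 D)))
    (hEρ : IsLittleOP (K := K) 𝒬 fun P m D => errEρ P (ρhat m ((I m).train 0 D)))
    {δ : ℝ} (hδ : 0 < δ) :
    Tendsto (fun m => sampleLaw (Ps m) (K * m) {D | ¬ NuisanceBound (Ps m)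
      (fhat m ((I m).train 0 D)) (ρhat m ((I m).train 0 D)) (K * m) δ}) atTop (𝓝 0) := by
  have h := tendsto_measure_or (hAf.tendsto_seq_eq_top hP) (tendsto_measure_or
    (hEf.tendsto_seq hP hδ) (tendsto_measure_or (hEρ.tendsto_seq hP hδ)
      (hAfAρ.tendsto_seq hP (pow_pos hδ 2))))
  refine tendsto_zero_of_le h (Eventually.of_forall fun m => measure_mono fun D hD => ?_)
  rw [Set.mem_ofPred_eq, NuisanceBound, not_and_or, not_and_or, not_and_or, not_lt, not_le, not_le,
    not_le, top_le_iff] at hD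
  exact hD

theorem tendsto_sampleLaw_crossFitError (hP₀ : ∀ m, Ps m ∈ P₀ d 𝒵)
    (hf : ∀ m, Measurable
      fun q : (Fin ((K - 1) * m) → Obs d 𝒵) × E d × 𝒵 => fhat m q.1 q.2.1 q.2.2)
    (hρ : ∀ m, Measurable
      fun q : (Fin ((K - 1) * m) → Obs d 𝒵) × E d × 𝒵 => ρhat m q.1 q.2.1 q.2.2)
    (hdiff : ∀ m, ∀ᵐ q ∂((sampleLaw (Ps m) ((K - 1) * m)).prod (lawZ (Ps m))),
      Differentiable ℝ fun x => fhat m q.1 x q.2)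
    (hN : ∀ δ : ℝ, 0 < δ → Tendsto (fun m => sampleLaw (Ps m) (K * m) {D | ¬ NuisanceBound (Ps m)
      (fhat m ((I m).train 0 D)) (ρhat m ((I m).train 0 D)) (K * m) δ}) atTop (𝓝 0))
    {ε : ℝ} (hε : 0 < ε) :
    Tendsto (fun m => sampleLaw (Ps m) (K * m) {D | ¬ ∀ j,
      |∑ i, crossFitError (I m) (fhat m) (ρhat m) (Ps m) D j i| ≤ ε * √((K * m : ℕ) : ℝ) ∧
        ∑ i, crossFitError (I m) (fhat m) (ρhat m) (Ps m) D j i ^ 2 ≤ ε * (K * m : ℕ)})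
      atTop (𝓝 0) := by
  have hK : (0 : ℝ) < K := by exact_mod_cast NeZero.pos K
  -- The K folds add up, hence ε/K; the estimate for one fold also needs a tolerance of at most 1.
  obtain ⟨ε', hε', hε1, hεK⟩ : ∃ ε' : ℝ, 0 < ε' ∧ ε' ≤ 1 ∧ K * ε' ≤ ε :=
    ⟨min (ε / K) 1, by positivity, min_le_right _ _, by
      have := min_le_left (ε / K) 1
      calc K * min (ε / K) 1 ≤ K * (ε / K) := by gcongr
        _ = ε := by field_simp⟩
  have h1 : ∀ k j, Tendsto (fun m => sampleLaw (Ps m) (K * m) {D | ¬ (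
      |∑ i ∈ (I m).fold k, drError (Ps m) (fhat m ((I m).train k D)) (ρhat m ((I m).train k D)) j
          (D i)| ≤ ε' * √((K * m : ℕ) : ℝ) ∧
        ∑ i ∈ (I m).fold k, drError (Ps m) (fhat m ((I m).train k D)) (ρhat m ((I m).train k D)) j
          (D i) ^ 2 ≤ ε' * (K * m : ℕ))}) atTop (𝓝 0) := fun k j => by
    refine tendsto_zero_of_eventually_le_ofReal fun τ hτ => ?_
    filter_upwards [eventually_gt_atTop 0, eventually_le_ofReal_of_tendsto_zero
      -- With this δ the fold bound 34 δ/ε'² equals τ/2; the other half of τ is the probability that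
      -- the nuisance bound fails.
      (hN (τ * ε' ^ 2 / 68) (by positivity)) (half_pos hτ)] with m hm h
    refine (sampleLaw_fold_error_le (I m) hm (hP₀ m) (hf m) (hρ m) (hdiff m)
      (by positivity : 0 ≤ τ * ε' ^ 2 / 68) hε' hε1 k 0 j).trans ((add_le_add_left h _).trans ?_)
    rw [← ENNReal.ofReal_add (by positivity) (by positivity)]
    refine ENNReal.ofReal_le_ofReal (le_of_eq ?_)
    field_simp
    norm_num
  refine tendsto_zero_of_le (tendsto_measure_exists fun j => tendsto_measure_exists fun k => h1 k j)
    (Eventually.of_forall fun m => measure_mono fun D hD => ?_)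
  rw [Set.mem_ofPred_eq] at hD ⊢
  contrapose! hD
  intro j
  have hsum : ∀ g : ℝ → ℝ, ∑ i, g (crossFitError (I m) (fhat m) (ρhat m) (Ps m) D j i)
      = ∑ k, ∑ i ∈ (I m).fold k, g (drError (Ps m) (fhat m ((I m).train k D))
        (ρhat m ((I m).train k D)) j (D i)) := fun g =>
    ((I m).sum_sum_fold fun k i => g (drError (Ps m) (fhat m ((I m).train k D))
        (ρhat m ((I m).train k D)) j (D i))).symm
  constructor
  · rw [hsum fun x => x]
    calc _ ≤ ∑ k : Fin K, ε' * √((K * m : ℕ) : ℝ) :=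
          (Finset.abs_sum_le_sum_abs _ _).trans (Finset.sum_le_sum fun k _ => (hD j k).1)
      _ = K * ε' * √((K * m : ℕ) : ℝ) := by simp; ring
      _ ≤ _ := by gcongr
  · rw [hsum fun x => x ^ 2]
    calc _ ≤ ∑ k : Fin K, ε' * (K * m : ℕ) := Finset.sum_le_sum fun k _ => (hD j k).2
      _ = K * ε' * (K * m : ℕ) := by simp; ring
      _ ≤ _ := by gcongr

/-! ### Laws of large numbers, consistency of Σ̂ and Slutsky's argument along a sequence -/

section Moments

variable {c₁ c₂ η : ℝ} (hP₀ : ∀ m, Ps m ∈ P₀ d 𝒵) (hc₂ : 0 < c₂) (hη : 0 < η)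
  (hψ : ∀ m, ∫⁻ w, ‖psi (Ps m) w‖ₑ ^ (2 + η) ∂(Ps m : Measure (Obs d 𝒵)) ≤ ENNReal.ofReal c₂)

include hP₀ hc₂ hη hψ

omit hc₂ in
theorem tendsto_sampleLaw_psi_mul_psi {ε : ℝ} (hε : 0 < ε) :
    Tendsto (fun m => sampleLaw (Ps m) (K * m) {D | ∃ a b, ε < |((K * m : ℕ) : ℝ)⁻¹ *
      ∑ i, psi (Ps m) (D i) a * psi (Ps m) (D i) b - Sigma (Ps m) a b|}) atTop (𝓝 0) :=
  tendsto_measure_exists fun a => tendsto_measure_exists fun b => tendsto_measure_pi_average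
    (X := fun m w => psi (Ps m) w a * psi (Ps m) w b)
    (fun m => (aemeasurable_coord (aemeasurable_psi (hP₀ m)) a).mul
      (aemeasurable_coord (aemeasurable_psi (hP₀ m)) b)) tendsto_mul_left_atTop
    (by linarith : 1 < 1 + η / 2) (fun m => lintegral_psi_mul_psi_rpow_le hη (hψ m) a b) hε

theorem tendsto_sampleLaw_psi {ε : ℝ} (hε : 0 < ε) :
    Tendsto (fun m => sampleLaw (Ps m) (K * m) {D | ∃ a, ε < |((K * m : ℕ) : ℝ)⁻¹ *
      ∑ i, psi (Ps m) (D i) a|}) atTop (𝓝 0) := by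
  refine tendsto_measure_exists fun a => ?_
  have h := tendsto_measure_pi_average (X := fun m w => psi (Ps m) w a)
    (fun m => aemeasurable_coord (aemeasurable_psi (hP₀ m)) a)
    (tendsto_mul_left_atTop (K := K)) (by linarith : 1 < 2 + η)
    (fun m => (lintegral_mono fun w => ENNReal.rpow_le_rpow
      (enorm_le_iff_norm_le.2 (abs_apply_le_norm _ a)) (by positivity)).trans (hψ m)) hε
  simp only [integral_psi_apply_eq_zero (hP₀ _) hc₂ hη (hψ _) a, sub_zero] at h
  exact h

theorem sampleLaw_abs_sum_psi_gt_le {m : ℕ} (hm : 0 < m) {L : ℝ} (hL : 0 < L) (j : Fin d) :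
    sampleLaw (Ps m) (K * m) {D | L * √((K * m : ℕ) : ℝ) < |∑ i, psi (Ps m) (D i) j|}
      ≤ ENNReal.ofReal ((1 + c₂) / L ^ 2) := by
  have hn : (0 : ℝ) < (K * m : ℕ) := by exact_mod_cast Nat.mul_pos (NeZero.pos K) hm
  refine (measure_pi_abs_sum_gt_le (memLp_psi_apply (hP₀ m) hc₂ hη (hψ m) j)
    (integral_psi_apply_eq_zero (hP₀ m) hc₂ hη (hψ m) j) (K * m)
    (mul_pos hL (Real.sqrt_pos.2 hn))).trans (ENNReal.ofReal_le_ofReal ?_)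
  have h := abs_Sigma_le (hP₀ m) hc₂ hη (hψ m) j j
  have e : ∫ w, psi (Ps m) w j ^ 2 ∂(Ps m : Measure (Obs d 𝒵)) = Sigma (Ps m) j j := by
    simp [Sigma, sq]
  rw [e, mul_pow, Real.sq_sqrt hn.le, mul_comm (L ^ 2), mul_div_mul_left _ _ hn.ne']
  gcongr
  exact (le_abs_self _).trans h

theorem tendsto_sampleLaw_SigmaHat
    (he : ∀ ε : ℝ, 0 < ε → Tendsto (fun m => sampleLaw (Ps m) (K * m) {D | ¬ ∀ j,
      |∑ i, crossFitError (I m) (fhat m) (ρhat m) (Ps m) D j i| ≤ ε * √((K * m : ℕ) : ℝ) ∧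
        ∑ i, crossFitError (I m) (fhat m) (ρhat m) (Ps m) D j i ^ 2 ≤ ε * (K * m : ℕ)})
      atTop (𝓝 0)) {τ : ℝ} (hτ : 0 < τ) :
    Tendsto (fun m => sampleLaw (Ps m) (K * m) {D | ¬ ∀ a b,
      |SigmaHat (I m) (fhat m) (ρhat m) D a b - Sigma (Ps m) a b| ≤ τ}) atTop (𝓝 0) := by
  obtain ⟨ε, hε, hε1, hετ⟩ : ∃ ε : ℝ, 0 < ε ∧ ε ≤ 1 ∧ (8 + 2 * (1 + c₂)) * ε ≤ τ :=
    ⟨min (τ / (8 + 2 * (1 + c₂))) 1, by positivity, min_le_right _ _, by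
      have := min_le_left (τ / (8 + 2 * (1 + c₂))) 1
      rwa [le_div_iff₀' (by positivity)] at this⟩
  -- The tolerance ε² bounds the squared errors by ε² n, and the summed errors by ε² √n ≤ ε n.
  have h := tendsto_measure_or (he (ε ^ 2) (by positivity))
    (tendsto_measure_or (tendsto_sampleLaw_psi_mul_psi (K := K) hP₀ hη hψ hε)
      (tendsto_sampleLaw_psi hP₀ hc₂ hη hψ hε))
  refine tendsto_zero_of_le h ?_
  filter_upwards [eventually_gt_atTop 0] with m hm
  refine measure_mono fun D hD => ?_
  have hn : 0 < K * m := Nat.mul_pos (NeZero.pos K) hm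
  have hn1 : (1 : ℝ) ≤ (K * m : ℕ) := by exact_mod_cast hn
  rw [Set.mem_ofPred_eq] at hD ⊢
  contrapose! hD
  obtain ⟨h1, h2, h3⟩ := hD
  intro a b
  have hx : ∀ j, ∑ i, psi (Ps m) (D i) j ^ 2 ≤ (1 + c₂ + 1) * (K * m : ℕ) := fun j => by
    have h4 := (abs_le.1 (h2 j j)).2
    have h5 := (abs_le.1 (abs_Sigma_le (hP₀ m) hc₂ hη (hψ m) j j)).2
    have h6 : ((K * m : ℕ) : ℝ)⁻¹ * ∑ i, psi (Ps m) (D i) j * psi (Ps m) (D i) j ≤ 1 + c₂ + 1 := by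
      linarith
    rw [inv_mul_le_iff₀ (by positivity)] at h6
    simp_rw [sq]
    linarith
  have he1 : ∀ j, |∑ i, crossFitError (I m) (fhat m) (ρhat m) (Ps m) D j i| ≤ ε * (K * m : ℕ) :=
    fun j => (h1 j).1.trans (mul_le_mul (by nlinarith) (Real.sqrt_le_iff.2 ⟨by positivity,
      by nlinarith⟩) (Real.sqrt_nonneg _) hε.le)
  rw [SigmaHat_apply (I m) (fhat m) (ρhat m) (Ps m) hn]
  exact (abs_covariance_sub_le hn (by positivity) hε hε1 (h2 a b) (hx a) (hx b) (h1 a).2 (h1 b).2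
    (h3 a) (h3 b) (he1 a) (he1 b)).trans hετ

omit [NeZero K] in
theorem tendsto_sampleLaw_invSqrt_SigmaHat (hc₁ : 0 < c₁)
    (hs : ∀ m, ∀ s ∈ spectrum ℝ (Sigma (Ps m)), c₁ ≤ s)
    (hS : ∀ τ : ℝ, 0 < τ → Tendsto (fun m => sampleLaw (Ps m) (K * m) {D | ¬ ∀ a b,
      |SigmaHat (I m) (fhat m) (ρhat m) D a b - Sigma (Ps m) a b| ≤ τ}) atTop (𝓝 0))
    {κ : ℝ} (hκ : 0 < κ) :
    Tendsto (fun m => sampleLaw (Ps m) (K * m) {D | ¬ ∀ a b,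
      |invSqrt (SigmaHat (I m) (fhat m) (ρhat m) D) a b - invSqrt (Sigma (Ps m)) a b| ≤ κ})
      atTop (𝓝 0) := by
  obtain ⟨δ, hδ, h⟩ := exists_forall_abs_invSqrt_sub_le (d := d) hc₁ (1 + c₂) hκ
  refine tendsto_zero_of_le (hS δ hδ) (Eventually.of_forall fun m => measure_mono fun D hD => ?_)
  rw [Set.mem_ofPred_eq] at hD ⊢
  exact fun hle => hD (h _ _ (isHermitian_Sigma _) (isHermitian_SigmaHat _ _ _ _) (hs m)
    (abs_Sigma_le (hP₀ m) hc₂ hη (hψ m)) hle)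

/-- The standardized estimator is close to n^{-1/2} ∑ Σ^{-1/2}ψ outside a small event, so Slutsky's
argument transfers the central limit theorem. Leaving B free covers both Σ_P and Σ̂. The budget is
r/4 for the central limit theorem, r/8 + r/8 for the exceptional events and r/4 for the Gaussian
slabs. -/
theorem tendsto_iSup_standardize (hc₁ : 0 < c₁)
    (hs : ∀ m, ∀ s ∈ spectrum ℝ (Sigma (Ps m)), c₁ ≤ s)
    (he : ∀ ε : ℝ, 0 < ε → Tendsto (fun m => sampleLaw (Ps m) (K * m) {D | ¬ ∀ j,
      |∑ i, crossFitError (I m) (fhat m) (ρhat m) (Ps m) D j i| ≤ ε * √((K * m : ℕ) : ℝ) ∧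
        ∑ i, crossFitError (I m) (fhat m) (ρhat m) (Ps m) D j i ^ 2 ≤ ε * (K * m : ℕ)})
      atTop (𝓝 0))
    {B : (m : ℕ) → (Fin (K * m) → Obs d 𝒵) → Matrix (Fin d) (Fin d) ℝ}
    (hB : ∀ κ : ℝ, 0 < κ → Tendsto (fun m => sampleLaw (Ps m) (K * m) {D | ¬ ∀ a b,
      |invSqrt (B m D) a b - invSqrt (Sigma (Ps m)) a b| ≤ κ}) atTop (𝓝 0)) :
    Tendsto (fun m => ⨆ t : Fin d → ℝ, ENNReal.ofReal |(sampleLaw (Ps m) (K * m)).real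
      {D | ∀ j, standardize (K * m) (B m D) (thetaHat (I m) (fhat m) (ρhat m) D - theta (Ps m)) j
        ≤ t j} - Phi t|) atTop (𝓝 0) := by
  refine tendsto_zero_of_eventually_le_ofReal fun r hr => ?_
  have hd : (0 : ℝ) < d + 1 := by positivity
  -- A tightness level for n^{-1/2} ∑ ψ_j, from Chebyshev with variance at most 1 + c₂ and a union
  -- over the d coordinates.
  obtain ⟨L, hL, hLr⟩ : ∃ L : ℝ, 0 < L ∧ d * ((1 + c₂) / L ^ 2) ≤ r / 8 := by
    refine ⟨√(8 * (d + 1) * (1 + c₂) / r), by positivity, ?_⟩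
    rw [Real.sq_sqrt (by positivity), div_div_eq_mul_div, mul_div_assoc', div_le_div_iff₀
      (by positivity) (by positivity)]
    have : 0 < r * (1 + c₂) := by positivity
    nlinarith
  obtain ⟨ε₀, hε₀, hε₀r⟩ : ∃ ε₀ : ℝ, 0 < ε₀ ∧ d * ε₀ ≤ r / 4 := by
    refine ⟨r / (4 * (d + 1)), by positivity, ?_⟩
    rw [mul_div_assoc', div_le_div_iff₀ (by positivity) (by positivity)]
    nlinarith
  obtain ⟨c, hc, hcT⟩ : ∃ c : ℝ, 0 ≤ c ∧ ∀ m i j, |invSqrt (Sigma (Ps m)) i j| ≤ c :=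
    ⟨(√c₁)⁻¹, by positivity, fun m => abs_invSqrt_apply_le (isHermitian_Sigma _) hc₁ (hs m)⟩
  -- ε bounds the cross-fitting error and κ the error in B^{-1/2}; each accounts for half of the
  -- permitted distance ε₀.
  obtain ⟨ε, hε, hε1, hεc⟩ : ∃ ε : ℝ, 0 < ε ∧ ε ≤ 1 ∧ d * (c * ε) ≤ ε₀ / 2 := by
    refine ⟨min (ε₀ / (2 * (d * c + 1))) 1, by positivity, min_le_right _ _, ?_⟩
    have h := min_le_left (ε₀ / (2 * (d * c + 1))) 1
    have h0 : 0 < min (ε₀ / (2 * (d * c + 1))) 1 := by positivity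
    rw [le_div_iff₀ (by positivity)] at h
    nlinarith
  obtain ⟨κ, hκ, hκL⟩ : ∃ κ : ℝ, 0 < κ ∧ d * (κ * (L + 1)) ≤ ε₀ / 2 := by
    refine ⟨ε₀ / (2 * (d + 1) * (L + 1)), by positivity, ?_⟩
    have e : ε₀ / (2 * (d + 1) * (L + 1)) * (L + 1) = ε₀ / (2 * (d + 1)) := by field_simp
    rw [e, mul_div_assoc', div_le_div_iff₀ (by positivity) (by positivity)]
    nlinarith
  have hbad := eventually_le_ofReal_of_tendsto_zero (tendsto_measure_or (he ε hε) (hB κ hκ))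
    (by positivity : 0 < r / 8)
  filter_upwards [eventually_gt_atTop 0, hbad,
    eventually_abs_sampleLaw_stdPsi_sub_Phi_le (K := K) hP₀ hc₁ hc₂ hη hs hψ
        (by positivity : 0 < r / 4)]
    with m hm hbad hclt
  have hn : 0 < K * m := Nat.mul_pos (NeZero.pos K) hm
  have hLm : sampleLaw (Ps m) (K * m)
      {D | ∃ j, L * √((K * m : ℕ) : ℝ) < |∑ i, psi (Ps m) (D i) j|} ≤ ENNReal.ofReal (r / 8) := by
    refine (measure_mono (fun D hD => ?_)).trans ((measure_iUnion_fintype_le _ fun j : Fin d =>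
      {D : Fin (K * m) → Obs d 𝒵 | L * √((K * m : ℕ) : ℝ) < |∑ i, psi (Ps m) (D i) j|}).trans
      ((Finset.sum_le_sum fun j _ =>
        sampleLaw_abs_sum_psi_gt_le (K := K) hP₀ hc₂ hη hψ hm hL j).trans ?_))
    · simpa using hD
    · rw [Finset.sum_const, Finset.card_univ, Fintype.card_fin, nsmul_eq_mul,
        ← ENNReal.ofReal_natCast, ← ENNReal.ofReal_mul (by positivity)]
      exact ENNReal.ofReal_le_ofReal hLr
  refine iSup_le fun t => ENNReal.ofReal_le_ofReal ?_
  refine (abs_orthant_sub_Phi_le_of_close (δ := r / 4) hε₀.le hclt ?_ t).trans (by linarith)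
  refine ENNReal.toReal_le_of_le_ofReal (by positivity) ?_
  refine (measure_mono (fun D hD => ?_)).trans ((measure_union_le _ _).trans
    ((add_le_add hbad hLm).trans ?_))
  · rw [Set.mem_ofPred_eq] at hD
    by_contra hnot
    rw [Set.mem_union, Set.mem_ofPred_eq, Set.mem_ofPred_eq] at hnot
    push Not at hnot
    obtain ⟨⟨h1, h2⟩, h3⟩ := hnot
    obtain ⟨i, hi⟩ := hD
    have h := abs_standardize_sub_le (I m) (fhat m) (ρhat m) (Ps m) hn D (hcT m) h2 h3
      (fun j => (h1 j).1) i
    have h4 : (d : ℝ) * (κ * (L + ε) + c * ε) ≤ ε₀ := by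
      have : (d : ℝ) * (κ * (L + ε)) ≤ d * (κ * (L + 1)) := by gcongr
      linarith
    linarith
  · rw [← ENNReal.ofReal_add (by positivity) (by positivity)]
    exact ENNReal.ofReal_le_ofReal (by linarith)

end Moments

end Sequence

end APE

/-! ### The theorem -/

theorem theorem1 {d : ℕ} {𝒵 : Type*} [MeasurableSpace 𝒵] (K : ℕ) [NeZero K]
    -- for each sample size `n = K m`: the folds, and the methods producing `f̂` and `ρ̂`
    (I : (m : ℕ) → APE.Folds K m)
    (fhat : (m : ℕ) → (Fin ((K - 1) * m) → APE.Obs d 𝒵) → APE.E d → 𝒵 → ℝ)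
    (ρhat : (m : ℕ) → (Fin ((K - 1) * m) → APE.Obs d 𝒵) → APE.E d → 𝒵 → APE.E d)
    (hfhat : ∀ m, Measurable
      (fun q : (Fin ((K - 1) * m) → APE.Obs d 𝒵) × APE.E d × 𝒵 => fhat m q.1 q.2.1 q.2.2))
    (hρhat : ∀ m, Measurable
      (fun q : (Fin ((K - 1) * m) → APE.Obs d 𝒵) × APE.E d × 𝒵 => ρhat m q.1 q.2.1 q.2.2))
    (𝒬 : Set (ProbabilityMeasure (APE.Obs d 𝒵))) (h𝒬 : 𝒬 ⊆ APE.P₀ d 𝒵)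
    -- `f̂` is differentiable in `x`, almost surely and for almost every `z`
    (hdiff : ∀ P ∈ 𝒬, ∀ m, ∀ᵐ q ∂((APE.sampleLaw P ((K - 1) * m)).prod (APE.lawZ P)),
      Differentiable ℝ (fun x => fhat m q.1 x q.2))
    (c₁ c₂ η : ℝ) (hc₁ : 0 < c₁) (hc₂ : 0 < c₂) (hη : 0 < η)
    -- every eigenvalue of `Σ_P` is at least `c₁`
    (hSigma : ∀ P ∈ 𝒬, ∀ s ∈ spectrum ℝ (APE.Sigma P), c₁ ≤ s)
    (hψ : ∀ P ∈ 𝒬, ∫⁻ w, ‖APE.psi P w‖ₑ ^ (2 + η) ∂(P : Measure (APE.Obs d 𝒵))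
      ≤ ENNReal.ofReal c₂)
    (hAf : APE.IsBigOP (K := K) 𝒬 fun P m D => APE.errAf P (fhat m ((I m).train 0 D)))
    (hAfAρ : APE.IsLittleOP (K := K) 𝒬 fun P m D =>
      ((K * m : ℕ) : ℝ≥0∞) * (APE.errAf P (fhat m ((I m).train 0 D))
        * APE.errAρ P (ρhat m ((I m).train 0 D))))
    (hEf : APE.IsLittleOP (K := K) 𝒬 fun P m D => APE.errEf P (fhat m ((I m).train 0 D)))
    (hEρ : APE.IsLittleOP (K := K) 𝒬 fun P m D => APE.errEρ P (ρhat m ((I m).train 0 D))) :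
    APE.UnifAsympGaussian (K := K) 𝒬 (fun P m D =>
      APE.standardize (K * m) (APE.Sigma P)
        (APE.thetaHat (I m) (fhat m) (ρhat m) D - APE.theta P)) ∧
    APE.IsLittleOP (K := K) 𝒬 (fun P m D =>
      ⨆ a, ⨆ b, ‖APE.SigmaHat (I m) (fhat m) (ρhat m) D a b - APE.Sigma P a b‖ₑ) ∧
    APE.UnifAsympGaussian (K := K) 𝒬 (fun P m D =>
      APE.standardize (K * m) (APE.SigmaHat (I m) (fhat m) (ρhat m) D)
        (APE.thetaHat (I m) (fhat m) (ρhat m) D - APE.theta P)) := by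
  have hP₀ : ∀ {Ps : ℕ → ProbabilityMeasure (APE.Obs d 𝒵)}, (∀ m, Ps m ∈ 𝒬) →
      ∀ m, Ps m ∈ APE.P₀ d 𝒵 := fun hP m => h𝒬 (hP m)
  have he : ∀ {Ps : ℕ → ProbabilityMeasure (APE.Obs d 𝒵)}, (∀ m, Ps m ∈ 𝒬) → ∀ ε : ℝ, 0 < ε → _ :=
    fun hP _ hε => APE.tendsto_sampleLaw_crossFitError (hP₀ hP) hfhat hρhat
      (fun m => hdiff _ (hP m) m)
      (fun _ hδ => APE.tendsto_sampleLaw_not_nuisanceBound hP hAf hAfAρ hEf hEρ hδ) hε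
  have hS : ∀ {Ps : ℕ → ProbabilityMeasure (APE.Obs d 𝒵)}, (∀ m, Ps m ∈ 𝒬) → ∀ τ : ℝ, 0 < τ → _ :=
    fun hP _ hτ => APE.tendsto_sampleLaw_SigmaHat (hP₀ hP) hc₂ hη (fun m => hψ _ (hP m)) (he hP) hτ
  refine ⟨APE.tendsto_iSup_zero_of_forall_seq fun Ps hP => ?_, fun ε hε =>
    APE.tendsto_iSup_zero_of_forall_seq fun Ps hP => ?_,
    APE.tendsto_iSup_zero_of_forall_seq fun Ps hP => ?_⟩
  · refine APE.tendsto_iSup_standardize (B := fun m _ => APE.Sigma (Ps m)) (hP₀ hP) hc₂ hη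
      (fun m => hψ _ (hP m)) hc₁ (fun m => hSigma _ (hP m)) (he hP) fun κ hκ => ?_
    -- Here B is Σ_P itself, so the exceptional event is empty.
    simp [hκ.le]
  · refine APE.tendsto_zero_of_le (hS hP ε (by exact_mod_cast hε)) (Eventually.of_forall fun m =>
      measure_mono fun D hD hle => ?_)
    rw [Set.mem_ofPred_eq] at hD
    refine hD.not_ge (iSup₂_le fun a b => ?_)
    have := hle a b
    rw [← Real.norm_eq_abs] at this
    rw [← enorm_norm, Real.enorm_of_nonneg (norm_nonneg _), ← ENNReal.ofReal_coe_nnreal]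
    exact ENNReal.ofReal_le_ofReal this
  · exact APE.tendsto_iSup_standardize (hP₀ hP) hc₂ hη (fun m => hψ _ (hP m)) hc₁
      (fun m => hSigma _ (hP m)) (he hP) fun κ hκ =>
        APE.tendsto_sampleLaw_invSqrt_SigmaHat (hP₀ hP) hc₂ hη (fun m => hψ _ (hP m)) hc₁
          (fun m => hSigma _ (hP m)) (hS hP) hκ
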